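/- **Notation.** For real $\alpha>0,\beta,\gamma$ let $E^{\gamma}_{\alpha,\beta}(z)=\sum_{k\ge0}\frac{(\gamma)_k}{\Gamma(\alpha k+\beta)}\frac{z^k}{k!}$ with $(\gamma)_k=\gamma(\gamma+1)\cdots(\gamma+k-1)$. For $t>0$ let $$\mathbf E^{\gamma}_{\rho,\mu,\omega,0^+}f(t)=\int_0^t(t-y)^{\mu-1}E^{\gamma}_{\rho,\mu}\big(\omega(t-y)^\rho\big)f(y)\,dy\quad(\mu>0),\qquad \mathbf E^{0}_{\rho,0,\omega,0^+}f=f,$$ and let $$\mathbf D^{\gamma,\mu,\nu}_{\rho,\omega,0^+}f=\mathbf E^{-\gamma\nu}_{\rho,\nu(1-\mu),\omega,0^+}\,\frac{d}{dt}\,\mathbf E^{-\gamma(1-\nu)}_{\rho,(1-\nu)(1-\mu),\omega,0^+}f$$ be the Hilfer–Prabhakar derivative, defined for $f\in L^1[0,b]$ with $\mathbf E^{-\gamma(1-\nu)}_{\rho,(1-\nu)(1-\mu),\omega,0^+}f\in AC[0,b]$ for all $b>0$ (with value at $0$ equal to the limit at $0^+$). Put $\hat g(p)=\int_{\mathbb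 R}e^{-ipx}g(x)\,dx$. **Theorem 4.3.** Let $\mu\in(0,1)$, $\nu\in[0,1]$, $\rho>0$, $\omega\in\mathbb R$, $K\ge0$, $\gamma\ge0$. Let $g:\mathbb R\to\mathbb C$ be continuous and integrable with $\hat g$ integrable; if $K=0$, let $g$ also be of class $C^2$. Consider the Cauchy problem $$\mathbf D^{\gamma,\mu,\nu}_{\rho,\omega,0^+}u(x,t)=K\,\frac{\partial^2u}{\partial x^2}(x,t)\quad(x\in\mathbb R,\ t>0),$$ $$\Big[\mathbf E^{-\gamma(1-\nu)}_{\rho,(1-\nu)(1-\mu),\omega,0^+}u(x,t)\Big]_{t=0^+}=g(x)\quad(x\in\mathbb R),\qquad \lim_{x\to\pm\infty}u(x,t)=0\quad(t>0),$$ where the fractional operators act in $t$. A solution is a function $u:\mathbb R\times(0,\infty)\to\mathbb C$ that is continuous in $t$ and of class $C^2$ in $x$, for which $u(x,\cdot)$ is in the domain of the fractional derivative for every $x$, all derivatives and integrals in the equation exist at every $(x,t)$ with $t>0$, and the three conditions hold. Then the function $$u(x,t)=\frac1{2\pi}\int_{-\infty}^{\infty}e^{ipx}\,\hat g(p)\sum_{n=0}^{\infty}(-K)^n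 p^{2n}\,t^{\mu(n+1)-\nu(\mu-1)-1}\,E^{\gamma(n+1-\nu)}_{\rho,\mu(n+1)-\nu(\mu-1)}(\omega t^\rho)\,dp$$ is a solution; for all $t>0$ the series converges absolutely for every $p\in\mathbb R$ and the integral converges absolutely for every $x\in\mathbb R$. Moreover $u$ is the only solution with the following property, which it has: for every $T>0$ there is an integrable function $m$ on $(0,T]$ with $|u(x,t)|\le m(t)$ for all $x\in\mathbb R$, $0<t\le T$, and $u_{xx}$ is integrable on $[-R,R]\times(0,T]$ for every $R>0$. -/

import Mathlib

open MeasureTheory Filter Topology Set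

noncomputable section

/-- The three-parameter Mittag-Leffler (Prabhakar) function
`E^γ_{α,β}(z) = ∑ₖ (γ)ₖ / Γ(α k + β) * z ^ k / k!` for real parameters, `α > 0`.
The Pochhammer symbol `(γ)ₖ = γ (γ + 1) ⋯ (γ + k - 1)` is the usual meaning of `Γ(γ + k) / Γ(γ)`,
also when `γ` is a pole of `Γ`; the reciprocal `1 / Γ` is `0` at the poles of `Γ`. -/
def prabhakarE (γ α β z : ℝ) : ℝ :=
  ∑' k : ℕ, (ascPochhammer ℝ k).eval γ / Real.Gamma (α * k + β) * (z ^ k / (k.factorial : ℝ))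

/-- The Prabhakar kernel `e^γ_{ρ,μ,ω}(t) = t ^ (μ - 1) * E^γ_{ρ,μ}(ω t ^ ρ)`, for `t > 0`. -/
def prabhakarKernel (γ ρ μ ω t : ℝ) : ℝ :=
  t ^ (μ - 1) * prabhakarE γ ρ μ (ω * t ^ ρ)

open Classical in
/-- The Prabhakar integral `(𝐄^γ_{ρ,μ,ω,0⁺} f)(t) = ∫₀ᵗ e^γ_{ρ,μ,ω}(t - y) f(y) dy`,
with the convention `𝐄^0_{ρ,0,ω,0⁺} f = f`. -/
def prabhakarIntegral (γ ρ μ ω : ℝ) (f : ℝ → ℂ) (t : ℝ) : ℂ :=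
  if μ = 0 ∧ γ = 0 then f t
  else ∫ y in (0 : ℝ)..t, prabhakarKernel γ ρ μ ω (t - y) • f y

/-- The integral defining `(𝐄^γ_{ρ,μ,ω,0⁺} f)(t)` converges absolutely
(no condition in the case of the identity operator). -/
def PrabhakarConverges (γ ρ μ ω : ℝ) (f : ℝ → ℂ) (t : ℝ) : Prop :=
  (μ = 0 ∧ γ = 0) ∨
    IntervalIntegrable (fun y => prabhakarKernel γ ρ μ ω (t - y) • f y) volume 0 t

/-- The inner operator `𝐄^{-γ(1-ν)}_{ρ,(1-ν)(1-μ),ω,0⁺} f`. -/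
def hilferPrabhakarInner (γ μ ν ρ ω : ℝ) (f : ℝ → ℂ) : ℝ → ℂ :=
  prabhakarIntegral (-(γ * (1 - ν))) ρ ((1 - ν) * (1 - μ)) ω f

/-- The Hilfer-Prabhakar fractional derivative
`𝐃^{γ,μ,ν}_{ρ,ω,0⁺} f = 𝐄^{-γν}_{ρ,ν(1-μ),ω,0⁺} (d/dt) (𝐄^{-γ(1-ν)}_{ρ,(1-ν)(1-μ),ω,0⁺} f)`. -/
def hilferPrabhakarDeriv (γ μ ν ρ ω : ℝ) (f : ℝ → ℂ) (t : ℝ) : ℂ :=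
  prabhakarIntegral (-(γ * ν)) ρ (ν * (1 - μ)) ω (deriv (hilferPrabhakarInner γ μ ν ρ ω f)) t

/-- `f` is in the domain of the Hilfer-Prabhakar derivative, and the derivative exists at every
`t > 0`. The first two fields say `f ∈ L¹[0,b]` and `𝐄 f ∈ AC[0,b]` for all `b > 0`, where the
value of `𝐄 f` at `0` is its limit `𝐄 f (0⁺)`. The remaining fields say that all expressions in
the definition of the derivative make sense at each `t > 0`, not only at almost every `t`. -/
structure HilferPrabhakarDifferentiable (γ μ ν ρ ω : ℝ) (f : ℝ → ℂ) : Prop where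
  integrable : ∀ b : ℝ, 0 < b → IntervalIntegrable f volume 0 b
  absolutelyContinuous : ∀ b : ℝ, 0 < b → ∃ F : ℝ → ℂ, AbsolutelyContinuousOnInterval F 0 b ∧
    EqOn (hilferPrabhakarInner γ μ ν ρ ω f) F (Ioc 0 b)
  converges_inner : ∀ t : ℝ, 0 < t →
    PrabhakarConverges (-(γ * (1 - ν))) ρ ((1 - ν) * (1 - μ)) ω f t
  differentiable_inner : ∀ t : ℝ, 0 < t →
    DifferentiableAt ℝ (hilferPrabhakarInner γ μ ν ρ ω f) t
  converges_outer : ∀ t : ℝ, 0 < t →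
    PrabhakarConverges (-(γ * ν)) ρ (ν * (1 - μ)) ω
      (deriv (hilferPrabhakarInner γ μ ν ρ ω f)) t

/-- The Fourier transform `ĝ(p) = ∫ e^{-ipx} g(x) dx` (without `2π` in the exponent). -/
def fourierHat (g : ℝ → ℂ) (p : ℝ) : ℂ :=
  ∫ x : ℝ, Complex.exp (-(Complex.I * p * x)) * g x

/-- `u` is a classical solution of the Cauchy problem
`𝐃^{γ,μ,ν}_{ρ,ω,0⁺} u = K u_xx` for `x ∈ ℝ`, `t > 0` (the fractional derivative in `t`),
`[𝐄^{-γ(1-ν)}_{ρ,(1-ν)(1-μ),ω,0⁺} u(x,·)](0⁺) = g(x)`, `u(x,t) → 0` as `x → ±∞`. -/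
structure IsDiffusionSolution (γ μ ν ρ ω K : ℝ) (g : ℝ → ℂ) (u : ℝ → ℝ → ℂ) : Prop where
  continuous_time : ∀ x : ℝ, ContinuousOn (u x) (Ioi 0)
  contDiff_space : ∀ t : ℝ, 0 < t → ContDiff ℝ 2 (fun x => u x t)
  differentiable_time : ∀ x : ℝ, HilferPrabhakarDifferentiable γ μ ν ρ ω (u x)
  equation : ∀ x t : ℝ, 0 < t →
    hilferPrabhakarDeriv γ μ ν ρ ω (u x) t = K * iteratedDeriv 2 (fun ξ => u ξ t) x
  initial : ∀ x : ℝ, Tendsto (hilferPrabhakarInner γ μ ν ρ ω (u x)) (𝓝[>] 0) (𝓝 (g x))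
  decay_atTop : ∀ t : ℝ, 0 < t → Tendsto (fun x => u x t) atTop (𝓝 0)
  decay_atBot : ∀ t : ℝ, 0 < t → Tendsto (fun x => u x t) atBot (𝓝 0)

/-- The class of functions in which the solution is unique: on each strip `ℝ × (0,T]` the function
`u` has a majorant that depends only on `t` and is integrable, and `u_xx` is integrable on each
bounded part of the strip. -/
structure IsDiffusionAdmissible (u : ℝ → ℝ → ℂ) : Prop where
  majorant : ∀ T : ℝ, 0 < T → ∃ m : ℝ → ℝ, IntegrableOn m (Ioc 0 T) ∧
    ∀ x : ℝ, ∀ t ∈ Ioc 0 T, ‖u x t‖ ≤ m t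
  integrable_xx : ∀ R T : ℝ, 0 < R → 0 < T →
    IntegrableOn (fun q : ℝ × ℝ => iteratedDeriv 2 (fun ξ => u ξ q.2) q.1)
      (Icc (-R) R ×ˢ Ioc 0 T)

/-- The `n`-th term
`(-K)^n p^{2n} t^{μ(n+1)-ν(μ-1)-1} E^{γ(n+1-ν)}_{ρ,μ(n+1)-ν(μ-1)}(ω t^ρ)`. -/
def diffusionTerm (γ μ ν ρ ω K p t : ℝ) (n : ℕ) : ℝ :=
  (-K) ^ n * p ^ (2 * n) * t ^ (μ * (n + 1) - ν * (μ - 1) - 1) *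
    prabhakarE (γ * (n + 1 - ν)) ρ (μ * (n + 1) - ν * (μ - 1)) (ω * t ^ ρ)

/-- The integrand `e^{ipx} ĝ(p) ∑ₙ diffusionTerm n` of the inverse Fourier integral. -/
def diffusionIntegrand (γ μ ν ρ ω K : ℝ) (g : ℝ → ℂ) (x t p : ℝ) : ℂ :=
  Complex.exp (Complex.I * p * x) * fourierHat g p *
    ((∑' n : ℕ, diffusionTerm γ μ ν ρ ω K p t n : ℝ) : ℂ)

/-- The inverse Fourier integral
`u(x,t) = (1/2π) ∫ e^{ipx} ĝ(p) ∑ₙ diffusionTerm n dp`. -/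
def diffusionSolution (γ μ ν ρ ω K : ℝ) (g : ℝ → ℂ) (x t : ℝ) : ℂ :=
  1 / (2 * (Real.pi : ℂ)) * ∫ p : ℝ, diffusionIntegrand γ μ ν ρ ω K g x t p

end

/-! Laplace transforms in `t` make every kernel explicit. With `A = 1 - ω s^(-ρ)`, the Prabhakar
kernel of indices `γ, μ` has transform `s^(-μ) A^(-γ)`, so convolution adds indices. After a Fourier
transform in `x`, with `l = K p²`, the solution operator is the multiplier with transform `s^(-b)
A^(-γ(1-ν)) / (1 + l s^(-μ) A^(-γ))`, `b = μ - ν(μ-1)`; its geometric expansion is the series of the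
theorem. Kernel identities are proved through `HasSymbol.eqOn`: two series of power kernels whose
transforms agree for large `s` agree on `(0,∞)`.

Existence needs bounds uniform in `l ≥ 0`, because `ĝ` is only integrable while the equation brings
in a factor `p²`. Let `r_l` be the function with transform `l s^(-μ) A^(-γ) / (1 + l s^(-μ)
A^(-γ))`. For `γ = 0` it is a Mittag-Leffler relaxation function: a first-zero argument in its
Volterra equation shows that it is nonnegative, and then that it has integral at most `1` and is at
most `1/t`. The general `r_l` solves a Volterra equation perturbing this one, with a kernel that is
`O(t^(ρ-1))` independently of `l`, and `exists_volterra_bound` carries the estimates over: `|r_l| ≤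
M/t` and `∫|r_l| ≤ M` on bounded time intervals. Hence the solution multiplier is `O(t^(b-1))` and
`l` times it is `O(1/t)` with bounded integral, uniformly in `p`. Fubini moves the fractional
operators inside the inverse Fourier integral. The inner operator applied to `u` gives `g - ∫₀ᵗ R`,
where `R` is the inverse Fourier integral of `ĝ r_l`, and the initial value, absolute continuity and
the equation follow.

For uniqueness, let `w` be the difference of two solutions and let `Z_n(x)` be the convolution in
time, at a fixed `t`, of `w(x,·)` with the Prabhakar kernel of indices `γn, μn+2`. Integrating the
equation gives `Z_n = K Z_{n+1}''` when `K ≠ 0`, and `Z_n` is bounded in `x` by numbers `a_n`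
decaying faster than every geometric sequence. Pair `Z_0` with a rescaled bandlimited function,
whose derivatives grow only geometrically in `L¹`, and integrate by parts `2n` times: the pairing is
zero. Letting the scale shrink gives `Z_0 = 0` (`eq_zero_of_bounded_second_primitives`). Since `Z_0`
is a double time primitive of `w`, also `w = 0`. For `K = 0` the integrated equation gives `Z_0 = 0`
directly. -/

open scoped FourierTransform

/-! ### Power kernels and injectivity of the Laplace transform -/

/-- The power kernel `t ^ (θ - 1) / Γ θ`, whose Laplace transform is `s ^ (-θ)`. -/
noncomputable def powerKernel (θ t : ℝ) : ℝ := t ^ (θ - 1) / Real.Gamma θ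

theorem powerKernel_nonneg {θ t : ℝ} (hθ : 0 < θ) (ht : 0 ≤ t) : 0 ≤ powerKernel θ t :=
  div_nonneg (Real.rpow_nonneg ht _) (Real.Gamma_pos_of_pos hθ).le

theorem powerKernel_pos {θ t : ℝ} (hθ : 0 < θ) (ht : 0 < t) : 0 < powerKernel θ t :=
  div_pos (Real.rpow_pos_of_pos ht _) (Real.Gamma_pos_of_pos hθ)

theorem continuousOn_powerKernel (θ : ℝ) : ContinuousOn (powerKernel θ) (Ioi 0) := by
  unfold powerKernel
  refine ContinuousOn.div_const (fun t ht => ?_) _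
  exact (Real.continuousAt_rpow_const _ _ (Or.inl (ne_of_gt ht))).continuousWithinAt

theorem rpow_mul_exp_neg_le_Gamma {θ x : ℝ} (hθ : 0 < θ) (hx : 0 < x) :
    x ^ θ * Real.exp (-x) ≤ Real.Gamma (θ + 1) := by
  rw [Real.Gamma_eq_integral (by linarith), ← integral_exp_neg_Ioi, ← integral_const_mul]
  have h1 := Real.GammaIntegral_convergent (s := θ + 1) (by linarith)
  have hsub : Ioi x ⊆ Ioi 0 := Ioi_subset_Ioi hx.le
  calc ∫ y in Ioi x, x ^ θ * Real.exp (-y)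
      ≤ ∫ y in Ioi x, Real.exp (-y) * y ^ (θ + 1 - 1) := by
        refine setIntegral_mono_on ?_ (h1.mono_set hsub) measurableSet_Ioi fun y hy => ?_
        · exact (integrableOn_exp_neg_Ioi x).const_mul _
        · rw [mul_comm, add_sub_cancel_right]
          have : x ^ θ ≤ y ^ θ := Real.rpow_le_rpow hx.le (le_of_lt hy) hθ.le
          gcongr
    _ ≤ _ := by
        refine setIntegral_mono_set h1 ?_ hsub.eventuallyLE
        refine (ae_restrict_iff' measurableSet_Ioi).2 (Eventually.of_forall fun y hy => ?_)
        exact mul_nonneg (Real.exp_pos _).le (Real.rpow_nonneg (le_of_lt hy) _)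

/-- The dependence on `θ` is isolated in `s ^ (-θ)`, so summability of `|c i| s ^ (-θ i)` at a
single `s` controls a series of power kernels at every `t > 0`. Taking `x = e s t` in the Gamma
bound produces a factor `e^θ ≥ θ`, which cancels the `θ` in `Γ(θ + 1) = θ Γ(θ)`. -/
theorem powerKernel_le {θ s t : ℝ} (hθ : 0 < θ) (hs : 0 < s) (ht : 0 < t) :
    powerKernel θ t ≤ t⁻¹ * Real.exp (Real.exp 1 * s * t) * s ^ (-θ) := by
  have he := Real.exp_pos 1
  set x := Real.exp 1 * s * t with hx
  have hxp : 0 < x := by positivity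
  have hG := rpow_mul_exp_neg_le_Gamma hθ hxp
  have hGp := Real.Gamma_pos_of_pos hθ
  rw [Real.Gamma_add_one hθ.ne'] at hG
  have hx1 : x ^ θ = Real.exp θ * s ^ θ * t ^ θ := by
    rw [hx, Real.mul_rpow (by positivity) ht.le, Real.mul_rpow he.le hs.le, ← Real.exp_mul, one_mul]
  have h2 : θ ≤ Real.exp θ := by linarith [Real.add_one_le_exp θ]
  have hs' : 0 < s ^ θ := Real.rpow_pos_of_pos hs _
  have ht' : 0 < t ^ θ := Real.rpow_pos_of_pos ht _
  rw [powerKernel, Real.rpow_sub_one ht.ne', Real.rpow_neg hs.le, div_le_iff₀ hGp]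
  rw [Real.exp_neg, hx1] at hG
  have hE := Real.exp_pos x
  have h3 : s ^ θ * t ^ θ ≤ Real.Gamma θ * Real.exp x := by
    rw [← div_eq_mul_inv, div_le_iff₀ hE] at hG
    have h4 : θ * (s ^ θ * t ^ θ) ≤ θ * (Real.Gamma θ * Real.exp x) := by
      calc θ * (s ^ θ * t ^ θ) ≤ Real.exp θ * (s ^ θ * t ^ θ) := by gcongr
        _ ≤ _ := by linarith
    exact le_of_mul_le_mul_left h4 hθ
  field_simp
  linarith

theorem integral_exp_mul_powerKernel {θ s : ℝ} (hθ : 0 < θ) (hs : 0 < s) :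
    ∫ t in Ioi (0 : ℝ), Real.exp (-(s * t)) * powerKernel θ t = s ^ (-θ) := by
  have := Real.integral_rpow_mul_exp_neg_mul_Ioi hθ hs
  simp only [powerKernel]
  have h2 : ∀ t : ℝ, Real.exp (-(s * t)) * (t ^ (θ - 1) / Real.Gamma θ) =
      (Real.Gamma θ)⁻¹ * (t ^ (θ - 1) * Real.exp (-(s * t))) := fun t => by ring
  simp only [h2]
  rw [integral_const_mul, this, one_div, Real.inv_rpow hs.le, Real.rpow_neg hs.le]
  have := (Real.Gamma_pos_of_pos hθ).ne'
  field_simp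

theorem integrableOn_exp_mul_powerKernel {θ s : ℝ} (hθ : 0 < θ) (hs : 0 < s) :
    IntegrableOn (fun t => Real.exp (-(s * t)) * powerKernel θ t) (Ioi (0 : ℝ)) := by
  apply Integrable.of_integral_ne_zero
  rw [integral_exp_mul_powerKernel hθ hs]
  exact (Real.rpow_pos_of_pos hs _).ne'

theorem intervalIntegrable_powerKernel {θ : ℝ} (hθ : 0 < θ) (a b : ℝ) :
    IntervalIntegrable (powerKernel θ) volume a b :=
  (intervalIntegral.intervalIntegrable_rpow' (by linarith)).div_const _

theorem integral_powerKernel_mul {θ η t : ℝ} (hθ : 0 < θ) (hη : 0 < η) (ht : 0 < t) :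
    ∫ y in (0 : ℝ)..t, powerKernel θ (t - y) * powerKernel η y = powerKernel (θ + η) t := by
  have h1 := Complex.betaIntegral_scaled η θ ht
  have h2 := ProbabilityTheory.beta_eq_betaIntegralReal η θ hη hθ
  have h3 : Complex.betaIntegral η θ = ((ProbabilityTheory.beta η θ : ℝ) : ℂ) := by
    rw [Complex.betaIntegral_eq_Gamma_mul_div _ _ (by simpa) (by simpa), ProbabilityTheory.beta]
    simp only [← Complex.ofReal_add, Complex.Gamma_ofReal]
    push_cast; rfl
  have h4 : ∫ y in (0 : ℝ)..t, y ^ (η - 1) * (t - y) ^ (θ - 1) =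
      t ^ (η + θ - 1) * ProbabilityTheory.beta η θ := by
    apply Complex.ofReal_injective
    rw [← intervalIntegral.integral_ofReal]
    rw [h3] at h1
    push_cast
    rw [Complex.ofReal_cpow ht.le]
    push_cast
    rw [← h1]
    refine intervalIntegral.integral_congr fun y hy => ?_
    rw [uIcc_of_le ht.le] at hy
    rw [Complex.ofReal_cpow hy.1, Complex.ofReal_cpow (sub_nonneg.2 hy.2)]
    push_cast; rfl
  have hG1 := (Real.Gamma_pos_of_pos hθ).ne'
  have hG2 := (Real.Gamma_pos_of_pos hη).ne'
  simp only [powerKernel]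
  have h5 : ∀ y : ℝ, (t - y) ^ (θ - 1) / Real.Gamma θ * (y ^ (η - 1) / Real.Gamma η) =
      (Real.Gamma θ * Real.Gamma η)⁻¹ * (y ^ (η - 1) * (t - y) ^ (θ - 1)) := fun y => by
    field_simp
  simp only [h5]
  rw [intervalIntegral.integral_const_mul, h4, ProbabilityTheory.beta, add_comm θ η]
  field_simp

theorem intervalIntegrable_powerKernel_mul {θ η t : ℝ} (hθ : 0 < θ) (hη : 0 < η) (ht : 0 < t) :
    IntervalIntegrable (fun y => powerKernel θ (t - y) * powerKernel η y) volume 0 t := by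
  by_contra h
  have := intervalIntegral.integral_undef h
  rw [integral_powerKernel_mul hθ hη ht] at this
  exact (powerKernel_pos (add_pos hθ hη) ht).ne' this

theorem rpow_neg_le_of_le {θ s₀ s : ℝ} (hθ : 0 ≤ θ) (h0 : 0 < s₀) (hs : s₀ ≤ s) :
    s ^ (-θ) ≤ s₀ ^ (-θ) := Real.rpow_le_rpow_of_nonpos h0 hs (by linarith)

/-- Lerch's argument: in the variable `y = e^(-t)`, vanishing at `s₀ + n` says that all moments of
`e^(-s₀ t) f` vanish. By Weierstrass approximation on `[0,1]` it then annihilates every test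
function, and continuity upgrades the almost everywhere conclusion. -/
theorem eqOn_zero_of_integral_exp_mul_eq_zero {f : ℝ → ℝ} {s₀ : ℝ} (hf : ContinuousOn f (Ioi 0))
    (hint : IntegrableOn (fun t => Real.exp (-(s₀ * t)) * f t) (Ioi 0))
    (h0 : ∀ s, s₀ ≤ s → ∫ t in Ioi (0 : ℝ), Real.exp (-(s * t)) * f t = 0) :
    EqOn f 0 (Ioi 0) := by
  set G : ℝ → ℝ := fun t => Real.exp (-(s₀ * t)) * f t with hG
  have hmono : ∀ n : ℕ, IntegrableOn (fun t => Real.exp (-t) ^ n * G t) (Ioi 0) := by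
    intro n
    refine Integrable.bdd_mul (c := 1) hint (by fun_prop) ?_
    refine (ae_restrict_iff' measurableSet_Ioi).2 (Eventually.of_forall fun t ht => ?_)
    rw [Real.norm_of_nonneg (by positivity)]
    exact pow_le_one₀ (Real.exp_pos _).le (Real.exp_le_one_iff.2 (by simpa using (le_of_lt ht)))
  have hmom : ∀ n : ℕ, ∫ t in Ioi (0 : ℝ), Real.exp (-t) ^ n * G t = 0 := by
    intro n
    refine Eq.trans ?_ (h0 (s₀ + n) (by linarith [n.cast_nonneg (α := ℝ)]))
    congr 1 with t
    rw [hG, ← Real.exp_nat_mul, ← mul_assoc, ← Real.exp_add]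
    congr 2; ring
  have hpolint : ∀ p : Polynomial ℝ, IntegrableOn (fun t => p.eval (Real.exp (-t)) * G t) (Ioi 0) := by
    intro p
    simp only [Polynomial.eval_eq_sum_range, Finset.sum_mul]
    refine integrable_finsetSum _ fun i _ => ?_
    simpa only [mul_assoc] using (hmono i).const_mul (p.coeff i)
  have hpol : ∀ p : Polynomial ℝ, ∫ t in Ioi (0 : ℝ), p.eval (Real.exp (-t)) * G t = 0 := by
    intro p
    simp only [Polynomial.eval_eq_sum_range, Finset.sum_mul, mul_assoc]
    rw [integral_finsetSum]
    · simp only [integral_const_mul, hmom, mul_zero, Finset.sum_const_zero]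
    · intro i _
      exact (hmono i).const_mul (p.coeff i)
  have hGc : ContinuousOn G (Ioi 0) := by fun_prop
  have key : ∀ φ : ℝ → ℝ, ContDiff ℝ (⊤ : ℕ∞) φ → HasCompactSupport φ → tsupport φ ⊆ Ioi 0 →
      ∫ t, φ t • (Ioi (0 : ℝ)).indicator G t = 0 := by
    intro φ hφ hφc hsupp
    have e1 : ∫ t, φ t • (Ioi (0 : ℝ)).indicator G t = ∫ t in Ioi (0 : ℝ), φ t * G t := by
      rw [← integral_indicator measurableSet_Ioi]
      congr 1 with t
      by_cases ht : t ∈ Ioi (0 : ℝ) <;> simp [ht]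
    rw [e1]
    obtain ⟨T, hT⟩ := hφc.isCompact.bddAbove
    have hφT : ∀ t, T < t → φ t = 0 := fun t ht => by
      by_contra h
      exact absurd (hT (subset_tsupport _ h)) (not_le.2 ht)
    have hφ0 : ∀ t, t ≤ 0 → φ t = 0 := fun t ht => by
      by_contra h
      exact absurd (hsupp (subset_tsupport _ h)) (not_lt.2 ht)
    -- Compact support of `φ` makes this function vanish for small `y ≠ 0`; at `y = 0` the
    -- convention `log 0 = 0` gives `φ 0`, which is also zero.
    have hh : ContinuousOn (fun y => φ (-Real.log y)) (Icc 0 1) := by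
      intro y hy
      rcases hy.1.eq_or_lt with rfl | hy0
      · refine ContinuousAt.continuousWithinAt ?_
        have : (fun y => φ (-Real.log y)) =ᶠ[𝓝 0] fun _ => 0 := by
          filter_upwards [Metric.ball_mem_nhds (0 : ℝ) (Real.exp_pos (-T))] with y hy
          rcases eq_or_ne y 0 with rfl | hne
          · simp [hφ0 0 le_rfl]
          · apply hφT
            rw [Metric.mem_ball, dist_zero_right, Real.norm_eq_abs] at hy
            rw [← Real.log_abs, lt_neg]
            exact (Real.log_lt_iff_lt_exp (abs_pos.2 hne)).2 hy
        exact (continuousAt_const (y := (0 : ℝ))).congr this.symm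
      · exact (hφ.continuous.continuousAt.comp (Real.continuousAt_log hy0.ne').neg).continuousWithinAt
    by_contra hne
    set I := ∫ t in Ioi (0 : ℝ), φ t * G t with hI
    have hφint : IntegrableOn (fun t => φ t * G t) (Ioi 0) := by
      obtain ⟨C, hC⟩ := hφ.continuous.bounded_above_of_compact_support hφc
      exact Integrable.bdd_mul hint hφ.continuous.aestronglyMeasurable (Eventually.of_forall hC)
    set N := ∫ t in Ioi (0 : ℝ), ‖G t‖ with hN
    have hNn : 0 ≤ N := integral_nonneg fun _ => norm_nonneg _
    -- The tolerance `|I| / (N + 1)` is chosen so that approximation gives `|I| ≤ |I| N / (N + 1)`,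
    -- impossible for `I ≠ 0`.
    obtain ⟨p, hp⟩ := exists_polynomial_near_of_continuousOn 0 1 _ hh (|I| / (N + 1))
      (by have := abs_pos.2 hne; positivity)
    have hbd : |I| ≤ |I| / (N + 1) * N := by
      have e2 : I = ∫ t in Ioi (0 : ℝ), (φ t - p.eval (Real.exp (-t))) * G t := by
        simp only [sub_mul]
        rw [integral_sub hφint (hpolint p), hpol p, sub_zero]
      calc |I| = ‖∫ t in Ioi (0 : ℝ), (φ t - p.eval (Real.exp (-t))) * G t‖ := by rw [← e2]; rfl
        _ ≤ ∫ t in Ioi (0 : ℝ), |I| / (N + 1) * ‖G t‖ := by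
          refine norm_integral_le_of_norm_le (hint.norm.const_mul _) ?_
          refine (ae_restrict_iff' measurableSet_Ioi).2 (Eventually.of_forall fun t ht => ?_)
          rw [norm_mul]
          refine mul_le_mul_of_nonneg_right ?_ (norm_nonneg _)
          have := hp (Real.exp (-t)) ⟨(Real.exp_pos _).le,
            Real.exp_le_one_iff.2 (by simpa using (le_of_lt ht))⟩
          rw [Real.log_exp, neg_neg, abs_sub_comm] at this
          exact this.le
        _ = _ := by rw [integral_const_mul]
    have hIp := abs_pos.2 hne
    have : |I| / (N + 1) * N < |I| := by
      rw [div_mul_eq_mul_div, div_lt_iff₀ (by linarith)]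
      nlinarith
    linarith
  have hz := isOpen_Ioi.ae_eq_zero_of_integral_contDiff_smul_eq_zero (U := Ioi (0 : ℝ))
    (f := (Ioi (0 : ℝ)).indicator G) ?_ key
  · have h3 : ∀ᵐ t ∂(volume.restrict (Ioi (0 : ℝ))), G t = 0 := by
      rw [ae_restrict_iff' measurableSet_Ioi]
      filter_upwards [hz] with t ht hm
      simpa [hm] using ht hm
    have h4 := MeasureTheory.Measure.eqOn_open_of_ae_eq (f := G) (g := fun _ => 0) h3 isOpen_Ioi hGc
      continuousOn_const
    intro t ht
    have := h4 ht
    simp only [hG, mul_eq_zero, (Real.exp_pos _).ne', false_or] at this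
    exact this
  · exact (((integrable_indicator_iff measurableSet_Ioi).2 hint).locallyIntegrable).locallyIntegrableOn _

/-! ### Series of power kernels -/

/-- Admissibility of the coefficients `c` and exponents `θ` of a series of power kernels. -/
structure SymbolData {ι : Type} (c θ : ι → ℝ) (b s₀ : ℝ) : Prop where
  b_pos : 0 < b
  s_pos : 0 < s₀
  le : ∀ i, b ≤ θ i
  summable : Summable fun i => |c i| * s₀ ^ (-θ i)

namespace SymbolData

variable {ι κ : Type} {c θ : ι → ℝ} {b s₀ : ℝ} {d η : κ → ℝ} {b' : ℝ}

theorem pos (h : SymbolData c θ b s₀) (i : ι) : 0 < θ i := h.b_pos.trans_le (h.le i)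

theorem mono (h : SymbolData c θ b s₀) {s : ℝ} (hs : s₀ ≤ s) : SymbolData c θ b s :=
  ⟨h.b_pos, h.s_pos.trans_le hs, h.le, by
    refine Summable.of_nonneg_of_le (fun i => ?_) (fun i => ?_) h.summable
    · exact mul_nonneg (abs_nonneg _) (Real.rpow_nonneg (h.s_pos.le.trans hs) _)
    · exact mul_le_mul_of_nonneg_left (rpow_neg_le_of_le (h.pos i).le h.s_pos hs) (abs_nonneg _)⟩

theorem summable_abs_mul_powerKernel (h : SymbolData c θ b s₀) {t : ℝ} (ht : 0 < t) :
    Summable fun i => |c i| * powerKernel (θ i) t := by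
  refine Summable.of_nonneg_of_le (fun i => ?_) (fun i => ?_)
    (h.summable.mul_left (t⁻¹ * Real.exp (Real.exp 1 * s₀ * t)))
  · exact mul_nonneg (abs_nonneg _) (powerKernel_nonneg (h.pos i) ht.le)
  · have := mul_le_mul_of_nonneg_left (powerKernel_le (h.pos i) h.s_pos ht) (abs_nonneg (c i))
    linarith

theorem summable_mul_powerKernel (h : SymbolData c θ b s₀) {t : ℝ} (ht : 0 < t) :
    Summable fun i => c i * powerKernel (θ i) t := by
  refine Summable.of_norm ?_
  refine (h.summable_abs_mul_powerKernel ht).congr fun i => ?_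
  rw [norm_mul, Real.norm_eq_abs, Real.norm_of_nonneg (powerKernel_nonneg (h.pos i) ht.le)]

theorem summable_mul_rpow (h : SymbolData c θ b s₀) :
    Summable fun i => c i * s₀ ^ (-θ i) := by
  refine Summable.of_norm (h.summable.congr fun i => ?_)
  rw [norm_mul, Real.norm_eq_abs, Real.norm_of_nonneg (Real.rpow_nonneg h.s_pos.le _)]

theorem exists_bound (h : SymbolData c θ b s₀) (T : ℝ) : ∃ C, 0 ≤ C ∧ ∀ t ∈ Ioc 0 T,
    |∑' i, c i * powerKernel (θ i) t| ≤ C * t ^ (b - 1) := by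
  by_cases hT : 0 < T
  swap
  · exact ⟨0, le_rfl, fun t ht => absurd (ht.1.trans_le ht.2) hT⟩
  have hS := h.summable_abs_mul_powerKernel hT
  have hS0 : 0 ≤ ∑' i, |c i| * powerKernel (θ i) T :=
    tsum_nonneg fun i => mul_nonneg (abs_nonneg _) (powerKernel_nonneg (h.pos i) hT.le)
  -- Since `θ i ≥ b`, each term at `t ≤ T` is at most `(t/T)^(b-1)` times its absolute value at `T`.
  refine ⟨T ^ (1 - b) * ∑' i, |c i| * powerKernel (θ i) T,
    mul_nonneg (Real.rpow_nonneg hT.le _) hS0, fun t ht => ?_⟩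
  have hle : ∀ i, |c i * powerKernel (θ i) t| ≤
      T ^ (1 - b) * t ^ (b - 1) * (|c i| * powerKernel (θ i) T) := by
    intro i
    rw [abs_mul, abs_of_nonneg (powerKernel_nonneg (h.pos i) ht.1.le)]
    have h1 : t ^ (θ i - 1) = t ^ (b - 1) * t ^ (θ i - b) := by
      rw [← Real.rpow_add ht.1]; congr 1; ring
    have h2 : T ^ (θ i - 1) * T ^ (1 - b) = T ^ (θ i - b) := by
      rw [← Real.rpow_add hT]; congr 1; ring
    have h3 : t ^ (θ i - b) ≤ T ^ (θ i - b) :=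
      Real.rpow_le_rpow ht.1.le ht.2 (sub_nonneg.2 (h.le i))
    have hG := Real.Gamma_pos_of_pos (h.pos i)
    have ht' : 0 ≤ t ^ (b - 1) := Real.rpow_nonneg ht.1.le _
    simp only [powerKernel]
    calc |c i| * (t ^ (θ i - 1) / Real.Gamma (θ i))
        = |c i| * (t ^ (b - 1) / Real.Gamma (θ i)) * t ^ (θ i - b) := by rw [h1]; ring
      _ ≤ |c i| * (t ^ (b - 1) / Real.Gamma (θ i)) * T ^ (θ i - b) := by gcongr
      _ = _ := by rw [← h2]; ring
  have hs2 := hS.mul_left (T ^ (1 - b) * t ^ (b - 1))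
  calc |∑' i, c i * powerKernel (θ i) t| ≤ ∑' i, T ^ (1 - b) * t ^ (b - 1) * (|c i| * powerKernel (θ i) T) :=
        tsum_of_norm_bounded (f := fun i => c i * powerKernel (θ i) t) hs2.hasSum hle
    _ = _ := by rw [tsum_mul_left]; ring

/-- Continuity of a series of power kernels whose coefficients depend on a parameter. -/
theorem continuousOn_tsum_param {X : Type} [TopologicalSpace X] {S : Set X} {a : ι → X → ℝ}
    (h : SymbolData c θ b s₀) (ha : ∀ i, ContinuousOn (a i) S) (hac : ∀ i, ∀ x ∈ S, |a i x| ≤ |c i|) :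
    ContinuousOn (fun q : X × ℝ => ∑' i, a i q.1 * powerKernel (θ i) q.2) (S ×ˢ Ioi 0) := by
  have main : ∀ t₁ t₂ : ℝ, 0 < t₁ → ContinuousOn
      (fun q : X × ℝ => ∑' i, a i q.1 * powerKernel (θ i) q.2) (S ×ˢ Ioo t₁ t₂) := by
    intro t₁ t₂ h1
    refine continuousOn_tsum (fun i => ?_)
      (h.summable.mul_left (t₁⁻¹ * Real.exp (Real.exp 1 * s₀ * t₂))) fun i q hq => ?_
    · refine ((ha i).comp continuousOn_fst fun q hq => hq.1).mul
        ((continuousOn_powerKernel (θ i)).comp continuousOn_snd fun q hq => h1.trans hq.2.1)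
    · have hq2 : 0 < q.2 := h1.trans hq.2.1
      rw [norm_mul, Real.norm_eq_abs, Real.norm_of_nonneg (powerKernel_nonneg (h.pos i) hq2.le)]
      have hs := h.s_pos
      have e1 := powerKernel_le (h.pos i) h.s_pos hq2
      have e2 : q.2⁻¹ * Real.exp (Real.exp 1 * s₀ * q.2) * s₀ ^ (-θ i) ≤
          t₁⁻¹ * Real.exp (Real.exp 1 * s₀ * t₂) * s₀ ^ (-θ i) := by
        have := hq.2.1.le
        have := hq.2.2.le
        gcongr
      calc |a i q.1| * powerKernel (θ i) q.2
          ≤ |c i| * (t₁⁻¹ * Real.exp (Real.exp 1 * s₀ * t₂) * s₀ ^ (-θ i)) :=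
            mul_le_mul (hac i _ hq.1) (e1.trans e2) (powerKernel_nonneg (h.pos i) hq2.le) (abs_nonneg _)
        _ = _ := by ring
  rintro ⟨x, t⟩ ⟨hx, ht⟩
  have ht : 0 < t := ht
  have := main (t / 2) (2 * t) (by linarith) (x, t) ⟨hx, by constructor <;> linarith⟩
  refine this.mono_of_mem_nhdsWithin ?_
  have h2 : (univ : Set X) ×ˢ Ioo (t / 2) (2 * t) ∈ 𝓝 (x, t) :=
    prod_mem_nhds univ_mem (Ioo_mem_nhds (by linarith) (by linarith))
  filter_upwards [self_mem_nhdsWithin, mem_nhdsWithin_of_mem_nhds h2] with q hq1 hq2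
  exact ⟨hq1.1, hq2.2⟩

theorem continuousOn_tsum (h : SymbolData c θ b s₀) :
    ContinuousOn (fun t => ∑' i, c i * powerKernel (θ i) t) (Ioi 0) := by
  have := h.continuousOn_tsum_param (X := Unit) (S := univ) (a := fun i _ => c i)
    (fun i => continuousOn_const) (fun i _ _ => le_rfl)
  exact this.comp (f := fun t : ℝ => ((), t)) (by fun_prop) fun t ht => ⟨mem_univ _, ht⟩

theorem hasSum_integral [Countable ι] (h : SymbolData c θ b s₀) :
    IntegrableOn (fun t => Real.exp (-(s₀ * t)) * ∑' i, c i * powerKernel (θ i) t) (Ioi 0) ∧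
    ∫ t in Ioi (0 : ℝ), Real.exp (-(s₀ * t)) * ∑' i, c i * powerKernel (θ i) t =
      ∑' i, c i * s₀ ^ (-θ i) := by
  set F : ι → ℝ → ℝ := fun i t => c i * (Real.exp (-(s₀ * t)) * powerKernel (θ i) t) with hF
  have h1 : ∀ i, Integrable (F i) (volume.restrict (Ioi 0)) := fun i =>
    (integrableOn_exp_mul_powerKernel (h.pos i) h.s_pos).const_mul (c i)
  have h2 : ∀ i, ∫ t in Ioi (0 : ℝ), ‖F i t‖ = |c i| * s₀ ^ (-θ i) := by
    intro i
    rw [← integral_exp_mul_powerKernel (h.pos i) h.s_pos, ← integral_const_mul]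
    refine setIntegral_congr_fun measurableSet_Ioi fun t ht => ?_
    have := powerKernel_nonneg (h.pos i) (le_of_lt ht)
    simp only [hF]
    rw [norm_mul, Real.norm_eq_abs, Real.norm_of_nonneg (by positivity)]
  have h3 : Summable fun i => ∫ t in Ioi (0 : ℝ), ‖F i t‖ := by simpa only [h2] using h.summable
  have h4 : ∀ t, ∑' i, F i t = Real.exp (-(s₀ * t)) * ∑' i, c i * powerKernel (θ i) t := by
    intro t
    rw [← tsum_mul_left]
    congr 1 with i; simp only [hF]; ring
  have h5 := hasSum_integral_of_summable_integral_norm h1 h3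
  simp only [h4] at h5
  constructor
  · refine ⟨(ContinuousOn.aestronglyMeasurable ?_ measurableSet_Ioi), ?_⟩
    · exact ContinuousOn.mul (by fun_prop) h.continuousOn_tsum
    · have hb : ∫⁻ t in Ioi (0 : ℝ), ‖Real.exp (-(s₀ * t)) * ∑' i, c i * powerKernel (θ i) t‖ₑ ≤
          ∑' i, ∫⁻ t in Ioi (0 : ℝ), ‖F i t‖ₑ := by
        rw [← lintegral_tsum fun i => (h1 i).1.enorm]
        refine setLIntegral_mono' measurableSet_Ioi fun t ht => ?_
        rw [← h4]
        exact enorm_tsum_le_tsum_enorm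
      refine lt_of_le_of_lt hb ?_
      have : ∀ i, ∫⁻ t in Ioi (0 : ℝ), ‖F i t‖ₑ = ENNReal.ofReal (∫ t in Ioi (0 : ℝ), ‖F i t‖) :=
        fun i => (ofReal_integral_norm_eq_lintegral_enorm (h1 i)).symm
      simp only [this]
      rw [← ENNReal.ofReal_tsum_of_nonneg (fun i => integral_nonneg fun _ => norm_nonneg _) h3]
      exact ENNReal.ofReal_lt_top
  · rw [← h5.tsum_eq]
    congr 1 with i
    simp only [hF]
    rw [integral_const_mul, integral_exp_mul_powerKernel (h.pos i) h.s_pos]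

theorem prod (h : SymbolData c θ b s₀) (h' : SymbolData d η b' s₀) :
    SymbolData (fun p : ι × κ => c p.1 * d p.2) (fun p => θ p.1 + η p.2) (b + b') s₀ := by
  refine ⟨add_pos h.b_pos h'.b_pos, h.s_pos, fun p => add_le_add (h.le _) (h'.le _), ?_⟩
  have := h.summable.mul_of_nonneg h'.summable
    (fun i => mul_nonneg (abs_nonneg _) (Real.rpow_nonneg h.s_pos.le _))
    (fun i => mul_nonneg (abs_nonneg _) (Real.rpow_nonneg h.s_pos.le _))
  refine this.congr fun p => ?_
  rw [neg_add, Real.rpow_add h.s_pos, abs_mul]; ring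

/-- The Beta integral convolves two power kernels into one. The same formula with absolute values,
summed over pairs, gives the summability that permits termwise integration. -/
theorem integral_conv [Countable ι] [Countable κ] (h : SymbolData c θ b s₀)
    (h' : SymbolData d η b' s₀) {t : ℝ} (ht : 0 < t) :
    ∫ y in (0 : ℝ)..t, (∑' i, c i * powerKernel (θ i) (t - y)) * ∑' j, d j * powerKernel (η j) y =
      ∑' p : ι × κ, (c p.1 * d p.2) * powerKernel (θ p.1 + η p.2) t := by
  set F : ι × κ → ℝ → ℝ := fun p y =>
    (c p.1 * d p.2) * (powerKernel (θ p.1) (t - y) * powerKernel (η p.2) y) with hF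
  have h1 : ∀ p, Integrable (F p) (volume.restrict (Ioc 0 t)) := fun p => by
    have := (intervalIntegrable_powerKernel_mul (h.pos p.1) (h'.pos p.2) ht).const_mul (c p.1 * d p.2)
    rwa [intervalIntegrable_iff_integrableOn_Ioc_of_le ht.le] at this
  have h2 : ∀ p, ∫ y in Ioc (0 : ℝ) t, ‖F p y‖ = |c p.1 * d p.2| * powerKernel (θ p.1 + η p.2) t := by
    intro p
    rw [← integral_powerKernel_mul (h.pos p.1) (h'.pos p.2) ht,
      intervalIntegral.integral_of_le ht.le, ← integral_const_mul]
    refine setIntegral_congr_fun measurableSet_Ioc fun y hy => ?_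
    have e1 := powerKernel_nonneg (h.pos p.1) (sub_nonneg.2 hy.2)
    have e2 := powerKernel_nonneg (h'.pos p.2) hy.1.le
    simp only [hF]
    rw [norm_mul, Real.norm_eq_abs, Real.norm_of_nonneg (by positivity)]
  have h3 : Summable fun p => ∫ y in Ioc (0 : ℝ) t, ‖F p y‖ := by
    simpa only [h2] using (h.prod h').summable_abs_mul_powerKernel ht
  have h5 := hasSum_integral_of_summable_integral_norm h1 h3
  -- The endpoint `y = t` is dropped because the series in `t - y` is only known to be summable at
  -- positive arguments.
  rw [intervalIntegral.integral_of_le ht.le, integral_Ioc_eq_integral_Ioo]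
  rw [integral_Ioc_eq_integral_Ioo] at h5
  have h6 : ∫ y in Ioo (0 : ℝ) t, (∑' i, c i * powerKernel (θ i) (t - y)) *
      ∑' j, d j * powerKernel (η j) y = ∫ y in Ioo (0 : ℝ) t, ∑' p, F p y := by
    refine setIntegral_congr_fun measurableSet_Ioo fun y hy => ?_
    have e1 := h.summable_mul_powerKernel (sub_pos.2 hy.2)
    have e2 := h'.summable_mul_powerKernel hy.1
    rw [tsum_mul_tsum_of_summable_norm e1.norm e2.norm]
    congr 1 with p; simp only [hF]; ring
  rw [h6, ← h5.tsum_eq]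
  congr 1 with p
  rw [← integral_powerKernel_mul (h.pos p.1) (h'.pos p.2) ht, intervalIntegral.integral_of_le ht.le]
  simp only [hF]
  rw [integral_const_mul]

end SymbolData

/-! ### Calculus of Laplace symbols -/

/-- `f` is, on `(0, ∞)`, a series of power kernels of exponents at least `b > 0`, with Laplace
transform `D`. -/
def HasSymbol (f : ℝ → ℝ) (b : ℝ) (D : ℝ → ℝ) : Prop :=
  ∃ (ι : Type) (_ : Countable ι) (c θ : ι → ℝ) (s₀ : ℝ), SymbolData c θ b s₀ ∧
    (∀ t, 0 < t → f t = ∑' i, c i * powerKernel (θ i) t) ∧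
    ∀ s, s₀ ≤ s → D s = ∑' i, c i * s ^ (-θ i)

namespace HasSymbol

variable {f g : ℝ → ℝ} {b b' : ℝ} {D D' : ℝ → ℝ}

theorem exponent_pos (h : HasSymbol f b D) : 0 < b := by
  obtain ⟨ι, _, c, θ, s₀, hd, -⟩ := h
  exact hd.b_pos

theorem congr (h : HasSymbol f b D) (hfg : EqOn g f (Ioi 0)) (hD : D =ᶠ[atTop] D') :
    HasSymbol g b D' := by
  obtain ⟨ι, _, c, θ, s₀, hd, hf, hDs⟩ := h
  obtain ⟨s₁, hs₁⟩ := eventually_atTop.1 hD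
  refine ⟨ι, ‹_›, c, θ, max s₀ s₁, hd.mono (le_max_left _ _), fun t ht => ?_, fun s hs => ?_⟩
  · rw [hfg ht, hf t ht]
  · rw [← hs₁ s ((le_max_right _ _).trans hs), hDs s ((le_max_left _ _).trans hs)]

theorem weaken (h : HasSymbol f b D) (hb : 0 < b') (hbb : b' ≤ b) : HasSymbol f b' D := by
  obtain ⟨ι, _, c, θ, s₀, hd, hf, hDs⟩ := h
  exact ⟨ι, ‹_›, c, θ, s₀, ⟨hb, hd.s_pos, fun i => hbb.trans (hd.le i), hd.summable⟩, hf, hDs⟩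

theorem continuousOn (h : HasSymbol f b D) : ContinuousOn f (Ioi 0) := by
  obtain ⟨ι, _, c, θ, s₀, hd, hf, hDs⟩ := h
  exact hd.continuousOn_tsum.congr fun t ht => hf t ht

theorem exists_bound (h : HasSymbol f b D) (T : ℝ) :
    ∃ C, 0 ≤ C ∧ ∀ t ∈ Ioc 0 T, |f t| ≤ C * t ^ (b - 1) := by
  obtain ⟨ι, _, c, θ, s₀, hd, hf, hDs⟩ := h
  obtain ⟨C, hC0, hC⟩ := hd.exists_bound T
  exact ⟨C, hC0, fun t ht => by rw [hf t ht.1]; exact hC t ht⟩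

theorem smul (h : HasSymbol f b D) (a : ℝ) :
    HasSymbol (fun t => a * f t) b (fun s => a * D s) := by
  obtain ⟨ι, _, c, θ, s₀, hd, hf, hDs⟩ := h
  refine ⟨ι, ‹_›, fun i => a * c i, θ, s₀, ⟨hd.b_pos, hd.s_pos, hd.le, ?_⟩, fun t ht => ?_,
    fun s hs => ?_⟩
  · simpa only [abs_mul, mul_assoc] using hd.summable.mul_left |a|
  · simp only [hf t ht, mul_assoc, tsum_mul_left]
  · simp only [hDs s hs, mul_assoc, tsum_mul_left]

theorem add (h : HasSymbol f b D) (h' : HasSymbol g b D') :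
    HasSymbol (fun t => f t + g t) b (fun s => D s + D' s) := by
  obtain ⟨ι, _, c, θ, s₀, hd, hf, hDs⟩ := h
  obtain ⟨κ, _, d, η, s₁, hd', hf', hDs'⟩ := h'
  have h1 := hd.mono (le_max_left s₀ s₁)
  have h2 := hd'.mono (le_max_right s₀ s₁)
  refine ⟨ι ⊕ κ, inferInstance, Sum.elim c d, Sum.elim θ η, max s₀ s₁,
    ⟨h1.b_pos, h1.s_pos, ?_, ?_⟩, fun t ht => ?_, fun s hs => ?_⟩
  · rintro (i | i)
    exacts [h1.le i, h2.le i]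
  · exact Summable.sum (f := fun i => |Sum.elim c d i| * max s₀ s₁ ^ (-Sum.elim θ η i))
      h1.summable h2.summable
  · beta_reduce
    rw [hf t ht, hf' t ht]
    exact ((h1.summable_mul_powerKernel ht).tsum_sum (f := fun i => Sum.elim c d i *
      powerKernel (Sum.elim θ η i) t) (h2.summable_mul_powerKernel ht)).symm
  · beta_reduce
    rw [hDs s ((le_max_left _ _).trans hs), hDs' s ((le_max_right _ _).trans hs)]
    exact ((h1.mono hs).summable_mul_rpow.tsum_sum (f := fun i => Sum.elim c d i *
      s ^ (-Sum.elim θ η i)) (h2.mono hs).summable_mul_rpow).symm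

theorem sub (h : HasSymbol f b D) (h' : HasSymbol g b D') :
    HasSymbol (fun t => f t - g t) b (fun s => D s - D' s) :=
  (h.add (h'.smul (-1))).congr (fun t _ => by simp only; ring)
    (Eventually.of_forall fun s => by simp only; ring)

theorem conv (h : HasSymbol f b D) (h' : HasSymbol g b' D') :
    HasSymbol (fun t => ∫ y in (0 : ℝ)..t, f (t - y) * g y) (b + b') (fun s => D s * D' s) := by
  obtain ⟨ι, _, c, θ, s₀, hd, hf, hDs⟩ := h
  obtain ⟨κ, _, d, η, s₁, hd', hf', hDs'⟩ := h'
  have h1 := hd.mono (le_max_left s₀ s₁)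
  have h2 := hd'.mono (le_max_right s₀ s₁)
  refine ⟨ι × κ, inferInstance, _, _, _, h1.prod h2, fun t ht => ?_, fun s hs => ?_⟩
  · beta_reduce
    rw [← h1.integral_conv h2 ht, intervalIntegral.integral_of_le ht.le,
      intervalIntegral.integral_of_le ht.le, integral_Ioc_eq_integral_Ioo, integral_Ioc_eq_integral_Ioo]
    refine setIntegral_congr_fun measurableSet_Ioo fun y hy => ?_
    rw [hf _ (sub_pos.2 hy.2), hf' _ hy.1]
  · beta_reduce
    rw [hDs s ((le_max_left _ _).trans hs), hDs' s ((le_max_right _ _).trans hs),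
      tsum_mul_tsum_of_summable_norm (h1.mono hs).summable_mul_rpow.norm
        (h2.mono hs).summable_mul_rpow.norm]
    congr 1 with p
    rw [neg_add, Real.rpow_add (h1.s_pos.trans_le hs)]; ring

theorem eqOn_zero (h : HasSymbol f b D) (hD : D =ᶠ[atTop] 0) : EqOn f 0 (Ioi 0) := by
  obtain ⟨ι, _, c, θ, s₀, hd, hf, hDs⟩ := h.congr (fun _ _ => rfl) hD
  have hint : ∀ s, s₀ ≤ s → _ := fun s hs => (hd.mono hs).hasSum_integral
  have hfe : EqOn f (fun t => ∑' i, c i * powerKernel (θ i) t) (Ioi 0) := fun t ht => hf t ht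
  refine hfe.trans (eqOn_zero_of_integral_exp_mul_eq_zero hd.continuousOn_tsum (hint s₀ le_rfl).1 ?_)
  intro s hs
  rw [(hint s hs).2, ← hDs s hs]; rfl

/-- This turns each convolution identity below into algebra of symbols for large `s`. The lower
bounds on the exponents may differ, so both are first weakened to their minimum. -/
theorem eqOn (h : HasSymbol f b D) (h' : HasSymbol g b' D') (hD : D =ᶠ[atTop] D') :
    EqOn f g (Ioi 0) := by
  have hm : 0 < min b b' := lt_min h.exponent_pos h'.exponent_pos
  have := ((h.weaken hm (min_le_left _ _)).sub (h'.weaken hm (min_le_right _ _))).eqOn_zero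
    (hD.mono fun s hs => by simp [hs])
  intro t ht
  exact sub_eq_zero.1 (this ht)

theorem intervalIntegrable (h : HasSymbol f b D) {t : ℝ} (ht : 0 ≤ t) :
    IntervalIntegrable f volume 0 t := by
  obtain ⟨C, hC0, hC⟩ := h.exists_bound t
  have h1 : IntervalIntegrable (fun y : ℝ => C * y ^ (b - 1)) volume 0 t :=
    (intervalIntegral.intervalIntegrable_rpow' (by linarith [h.exponent_pos])).const_mul C
  rw [intervalIntegrable_iff_integrableOn_Ioc_of_le ht] at h1 ⊢
  refine h1.mono' ?_ ?_
  · exact (h.continuousOn.mono fun y hy => hy.1).aestronglyMeasurable measurableSet_Ioc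
  · exact (ae_restrict_iff' measurableSet_Ioc).2 (Eventually.of_forall fun y hy => hC y hy)

end HasSymbol

theorem hasSymbol_powerKernel {θ : ℝ} (hθ : 0 < θ) :
    HasSymbol (powerKernel θ) θ (fun s => s ^ (-θ)) :=
  ⟨Unit, inferInstance, fun _ => 1, fun _ => θ, 1, ⟨hθ, one_pos, fun _ => le_rfl, Summable.of_finite⟩,
    fun t _ => by simp, fun s _ => by simp⟩

theorem hasSymbol_one : HasSymbol (fun _ => 1) 1 (fun s => s⁻¹) :=
  (hasSymbol_powerKernel one_pos).congr (fun t _ => by simp [powerKernel])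
    (Eventually.of_forall fun s => by simp [Real.rpow_neg_one])

/-! ### Symbols of Prabhakar kernels and of their geometric series -/

theorem hasSum_ascPochhammer_mul_pow (γ : ℝ) {x : ℝ} (hx : |x| < 1) :
    HasSum (fun k : ℕ => (ascPochhammer ℝ k).eval γ / (k.factorial : ℝ) * x ^ k) ((1 - x) ^ (-γ)) := by
  have h := (Real.one_div_one_sub_rpow_hasFPowerSeriesOnBall_zero γ).hasSum (y := x) (by
    simpa [enorm_eq_nnnorm, ← NNReal.coe_lt_one] using hx)
  have hx' : 0 ≤ 1 - x := by linarith [(abs_lt.1 hx).2]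
  simp only [zero_add, one_div, ← Real.rpow_neg hx'] at h
  have hk : ∀ k : ℕ, (ascPochhammer ℝ k).eval γ / (k.factorial : ℝ) = Ring.choose (γ + k - 1) k := by
    intro k
    rw [← Ring.multichoose_eq, div_eq_iff (by positivity), mul_comm, ← nsmul_eq_mul,
      Ring.factorial_nsmul_multichoose_eq_ascPochhammer, Polynomial.ascPochhammer_smeval_eq_eval]
  simpa [FormalMultilinearSeries.ofScalars_apply_eq, hk, mul_comm] using h

namespace SymbolData

theorem of_abs_le {ι : Type} {c c' θ : ι → ℝ} {b s₀ : ℝ} (h : SymbolData c θ b s₀)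
    (hc : ∀ i, |c' i| ≤ |c i|) : SymbolData c' θ b s₀ :=
  ⟨h.b_pos, h.s_pos, h.le, Summable.of_nonneg_of_le
    (fun _ => mul_nonneg (abs_nonneg _) (Real.rpow_nonneg h.s_pos.le _))
    (fun i => mul_le_mul_of_nonneg_right (hc i) (Real.rpow_nonneg h.s_pos.le _)) h.summable⟩

end SymbolData

theorem abs_ascPochhammer_eval_le {γ γ' : ℝ} (h : |γ| ≤ γ') (k : ℕ) :
    |(ascPochhammer ℝ k).eval γ| ≤ (ascPochhammer ℝ k).eval γ' := by
  induction k with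
  | zero => simp
  | succ k ih =>
    simp only [ascPochhammer_succ_eval, abs_mul]
    have h0 : 0 ≤ γ' := (abs_nonneg γ).trans h
    refine mul_le_mul ih ?_ (abs_nonneg _) ((abs_nonneg _).trans ih)
    calc |γ + k| ≤ |γ| + |(k : ℝ)| := abs_add_le _ _
      _ ≤ γ' + k := by rw [Nat.abs_cast]; linarith

theorem ascPochhammer_eval_nonneg {γ : ℝ} (h : 0 ≤ γ) (k : ℕ) : 0 ≤ (ascPochhammer ℝ k).eval γ :=
  (abs_nonneg _).trans (abs_ascPochhammer_eval_le (abs_of_nonneg h).le k)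

theorem prabhakarKernel_eq_tsum (γ ρ μ ω : ℝ) {t : ℝ} (ht : 0 < t) :
    prabhakarKernel γ ρ μ ω t = ∑' k : ℕ, (ascPochhammer ℝ k).eval γ / (k.factorial : ℝ) * ω ^ k *
      powerKernel (ρ * k + μ) t := by
  rw [prabhakarKernel, prabhakarE, ← tsum_mul_left]
  congr 1 with k
  have : t ^ (ρ * k + μ - 1) = t ^ (μ - 1) * (t ^ ρ) ^ k := by
    rw [← Real.rpow_natCast, ← Real.rpow_mul ht.le, ← Real.rpow_add ht]; congr 1; ring
  rw [powerKernel, this, mul_pow]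
  ring

theorem tendsto_mul_rpow_neg (c : ℝ) {a : ℝ} (ha : 0 < a) :
    Tendsto (fun s : ℝ => c * s ^ (-a)) atTop (𝓝 0) := by
  simpa using (tendsto_rpow_neg_atTop ha).const_mul c

theorem tendsto_one_sub_mul_rpow (ω : ℝ) {ρ : ℝ} (hρ : 0 < ρ) :
    Tendsto (fun s : ℝ => 1 - ω * s ^ (-ρ)) atTop (𝓝 1) := by
  simpa using (tendsto_mul_rpow_neg ω hρ).const_sub 1

theorem eventually_one_sub_mul_rpow_pos (ω : ℝ) {ρ : ℝ} (hρ : 0 < ρ) :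
    ∀ᶠ s : ℝ in atTop, 0 < 1 - ω * s ^ (-ρ) :=
  (tendsto_one_sub_mul_rpow ω hρ).eventually_const_lt one_pos

theorem tendsto_ratio (c ω γ : ℝ) {ρ μ : ℝ} (hρ : 0 < ρ) (hμ : 0 < μ) :
    Tendsto (fun s : ℝ => c * s ^ (-μ) * (1 - ω * s ^ (-ρ)) ^ (-γ)) atTop (𝓝 0) := by
  have h1 : Tendsto (fun s : ℝ => (1 - ω * s ^ (-ρ)) ^ (-γ)) atTop (𝓝 (1 ^ (-γ))) :=
    (tendsto_one_sub_mul_rpow ω hρ).rpow_const (Or.inl one_ne_zero)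
  simpa using (tendsto_mul_rpow_neg c hμ).mul h1

section Family

variable {γ ρ μ ω a b : ℝ}

/-- The sums over `k` and over `n` and `k` in the transform of a geometric series of Prabhakar
kernels. -/
theorem hasSum_family {Λ s : ℝ} (hs : 0 < s) (hx : |ω| * s ^ (-ρ) < 1)
    (n : ℕ) :
    HasSum (fun k : ℕ => Λ ^ n * ((ascPochhammer ℝ k).eval (γ * n + a) / (k.factorial : ℝ) * ω ^ k) *
      s ^ (-(ρ * k + (μ * n + b))))
      (s ^ (-b) * (1 - ω * s ^ (-ρ)) ^ (-a) * (Λ * s ^ (-μ) * (1 - ω * s ^ (-ρ)) ^ (-γ)) ^ n) := by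
  have hx' : |ω * s ^ (-ρ)| < 1 := by rwa [abs_mul, abs_of_nonneg (Real.rpow_nonneg hs.le _)]
  have hA : 0 < 1 - ω * s ^ (-ρ) := by linarith [(abs_lt.1 hx').2]
  have h := (hasSum_ascPochhammer_mul_pow (γ * n + a) hx').mul_left (Λ ^ n * s ^ (-(μ * n + b)))
  convert! h using 1
  · ext k
    have e1 : s ^ (-(ρ * k + (μ * n + b))) = (s ^ (-ρ)) ^ k * s ^ (-(μ * n + b)) := by
      rw [← Real.rpow_natCast, ← Real.rpow_mul hs.le, ← Real.rpow_add hs]; congr 1; ring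
    rw [e1, mul_pow]; ring
  · have e1 : s ^ (-(μ * n + b)) = (s ^ (-μ)) ^ n * s ^ (-b) := by
      rw [← Real.rpow_natCast, ← Real.rpow_mul hs.le, ← Real.rpow_add hs]; congr 1; ring
    have e2 : (1 - ω * s ^ (-ρ)) ^ (-(γ * n + a)) =
        ((1 - ω * s ^ (-ρ)) ^ (-γ)) ^ n * (1 - ω * s ^ (-ρ)) ^ (-a) := by
      rw [← Real.rpow_natCast, ← Real.rpow_mul hA.le, ← Real.rpow_add hA]; congr 1; ring
    rw [e1, e2, mul_pow, mul_pow]; ring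

/-- With `ω` and `-l` replaced by `|ω|` and `Λ` all coefficients are nonnegative, so the double sum
may be taken iteratively: a binomial series in `k`, then a geometric series in `n`. Its ratio tends
to `0` as `s → ∞`. -/
theorem eventually_symbolData_family (hρ : 0 < ρ) (hμ : 0 < μ) (hb : 0 < b) (hγ : 0 ≤ γ) (ha : 0 ≤ a)
    (ω : ℝ) {Λ : ℝ} (hΛ : 0 ≤ Λ) :
    ∀ᶠ s : ℝ in atTop, SymbolData
      (fun p : ℕ × ℕ => Λ ^ p.1 *
        ((ascPochhammer ℝ p.2).eval (γ * p.1 + a) / (p.2.factorial : ℝ) * |ω| ^ p.2))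
      (fun p => ρ * p.2 + (μ * p.1 + b)) b s := by
  filter_upwards [eventually_gt_atTop 0, (tendsto_mul_rpow_neg |ω| hρ).eventually_lt_const one_pos,
    (tendsto_ratio Λ |ω| γ hρ hμ).eventually_lt_const one_pos] with s hs hx hr
  have hpos : ∀ p : ℕ × ℕ, 0 ≤ Λ ^ p.1 *
      ((ascPochhammer ℝ p.2).eval (γ * p.1 + a) / (p.2.factorial : ℝ) * |ω| ^ p.2) := fun p => by
    have := ascPochhammer_eval_nonneg (γ := γ * p.1 + a) (by positivity) p.2
    positivity
  refine ⟨hb, hs, fun p => ?_, ?_⟩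
  · have : 0 ≤ ρ * p.2 + μ * p.1 := by positivity
    linarith
  · simp only [abs_of_nonneg (hpos _)]
    rw [summable_prod_of_nonneg fun p => mul_nonneg (hpos p) (Real.rpow_nonneg hs.le _)]
    have hs' := fun n => hasSum_family (γ := γ) (μ := μ) (a := a) (b := b) (Λ := Λ) hs
      (by rwa [abs_abs]) n
    refine ⟨fun n => (hs' n).summable, ?_⟩
    simp only [(hs' _).tsum_eq]
    refine (summable_geometric_of_lt_one ?_ hr).mul_left _
    have : 0 ≤ 1 - |ω| * s ^ (-ρ) := by linarith
    positivity

theorem abs_family_le {l Λ : ℝ} (hl : |l| ≤ Λ) (p : ℕ × ℕ) :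
    |(-l) ^ p.1 * ((ascPochhammer ℝ p.2).eval (γ * p.1 + a) / (p.2.factorial : ℝ) * ω ^ p.2)| ≤
      |Λ ^ p.1 * ((ascPochhammer ℝ p.2).eval (γ * p.1 + a) / (p.2.factorial : ℝ) * |ω| ^ p.2)| := by
  have h0 : 0 ≤ Λ := (abs_nonneg l).trans hl
  simp only [abs_mul, abs_pow, abs_neg, abs_abs]
  rw [abs_of_nonneg h0]
  gcongr

/-- `∑ₙ (-l)ⁿ e^{γ n + a}_{ρ, μ n + b, ω}(t)`, the geometric series of Prabhakar kernels. -/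
noncomputable def prabhakarResolvent (γ ρ μ ω a b l t : ℝ) : ℝ :=
  ∑' n : ℕ, (-l) ^ n * prabhakarKernel (γ * n + a) ρ (μ * n + b) ω t

theorem prabhakar_term_eq (n : ℕ) (l : ℝ) {t : ℝ} (ht : 0 < t) :
    (-l) ^ n * prabhakarKernel (γ * n + a) ρ (μ * n + b) ω t = ∑' k : ℕ, (-l) ^ n *
      ((ascPochhammer ℝ k).eval (γ * n + a) / (k.factorial : ℝ) * ω ^ k) *
        powerKernel (ρ * k + (μ * n + b)) t := by
  rw [prabhakarKernel_eq_tsum _ _ _ _ ht, ← tsum_mul_left]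
  congr 1 with k; ring

variable (hρ : 0 < ρ) (hμ : 0 < μ) (hb : 0 < b) (hγ : 0 ≤ γ) (ha : 0 ≤ a)
include hρ hμ hb hγ ha

theorem summable_prabhakarResolvent (l : ℝ) {t : ℝ} (ht : 0 < t) :
    Summable fun n : ℕ => (-l) ^ n * prabhakarKernel (γ * n + a) ρ (μ * n + b) ω t := by
  obtain ⟨s, hs⟩ := (eventually_symbolData_family hρ hμ hb hγ ha ω (abs_nonneg l)).exists
  have := (hs.of_abs_le (abs_family_le le_rfl)).summable_mul_powerKernel ht
  simpa only [prabhakar_term_eq _ _ ht] using this.prod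

theorem prabhakarResolvent_eq_tsum (l : ℝ) {t : ℝ} (ht : 0 < t) :
    prabhakarResolvent γ ρ μ ω a b l t = ∑' p : ℕ × ℕ, (-l) ^ p.1 *
      ((ascPochhammer ℝ p.2).eval (γ * p.1 + a) / (p.2.factorial : ℝ) * ω ^ p.2) *
        powerKernel (ρ * p.2 + (μ * p.1 + b)) t := by
  obtain ⟨s, hs⟩ := (eventually_symbolData_family hρ hμ hb hγ ha ω (abs_nonneg l)).exists
  have := (hs.of_abs_le (abs_family_le le_rfl)).summable_mul_powerKernel ht
  rw [this.tsum_prod, prabhakarResolvent]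
  simp only [prabhakar_term_eq _ _ ht]

theorem hasSymbol_prabhakarResolvent (l : ℝ) :
    HasSymbol (prabhakarResolvent γ ρ μ ω a b l) b (fun s => s ^ (-b) * (1 - ω * s ^ (-ρ)) ^ (-a) /
      (1 + l * s ^ (-μ) * (1 - ω * s ^ (-ρ)) ^ (-γ))) := by
  have hev := ((eventually_symbolData_family hρ hμ hb hγ ha ω (abs_nonneg l)).and
    ((tendsto_mul_rpow_neg |ω| hρ).eventually_lt_const one_pos)).and
    ((tendsto_ratio (-l) ω γ hρ hμ).abs.eventually_lt_const (by simp : |(0 : ℝ)| < 1))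
  obtain ⟨s₀, hs₀⟩ := eventually_atTop.1 hev
  refine ⟨ℕ × ℕ, inferInstance, _, _, s₀, (hs₀ s₀ le_rfl).1.1.of_abs_le
    (abs_family_le le_rfl), fun t ht => prabhakarResolvent_eq_tsum hρ hμ hb hγ ha l ht,
    fun s hs => ?_⟩
  obtain ⟨⟨h1, h2⟩, h3⟩ := hs₀ s hs
  rw [(h1.of_abs_le (abs_family_le le_rfl)).summable_mul_rpow.tsum_prod]
  simp only [(hasSum_family h1.s_pos h2 _).tsum_eq]
  rw [tsum_mul_left, tsum_geometric_of_abs_lt_one h3, div_eq_mul_inv]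
  congr 2; ring

theorem continuousOn_prabhakarResolvent :
    ContinuousOn (fun q : ℝ × ℝ => prabhakarResolvent γ ρ μ ω a b q.1 q.2) (univ ×ˢ Ioi 0) := by
  rintro ⟨l, t⟩ ⟨-, ht⟩
  obtain ⟨s, hs⟩ := (eventually_symbolData_family hρ hμ hb hγ ha ω
    (add_nonneg (abs_nonneg l) zero_le_one)).exists
  have h1 := hs.continuousOn_tsum_param (X := ℝ) (S := Ioo (l - 1) (l + 1))
    (a := fun (p : ℕ × ℕ) l => (-l) ^ p.1 *
      ((ascPochhammer ℝ p.2).eval (γ * p.1 + a) / (p.2.factorial : ℝ) * ω ^ p.2))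
    (fun _ => by fun_prop) (fun i x hx => abs_family_le (by
      have := abs_sub_abs_le_abs_sub x l
      have : |x - l| ≤ 1 := abs_le.2 ⟨by linarith [hx.1], by linarith [hx.2]⟩
      linarith) i)
  have h2 : Ioo (l - 1) (l + 1) ×ˢ Ioi (0 : ℝ) ∈ 𝓝 (l, t) :=
    prod_mem_nhds (Ioo_mem_nhds (by linarith) (by linarith)) (Ioi_mem_nhds ht)
  refine ContinuousAt.continuousWithinAt ?_
  refine (h1.continuousAt h2).congr ?_
  filter_upwards [h2] with q hq
  exact (prabhakarResolvent_eq_tsum hρ hμ hb hγ ha q.1 hq.2).symm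

/-- One term is dominated by the whole nonnegative double series. Because `Λ` is arbitrary, this
expresses decay in `n` faster than any geometric rate, which the uniqueness proof needs. -/
theorem exists_bound_pow_mul_prabhakarKernel (T : ℝ) {Λ : ℝ} (hΛ : 0 ≤ Λ) :
    ∃ C, 0 ≤ C ∧ ∀ n : ℕ, ∀ t ∈ Ioc 0 T,
      Λ ^ n * |prabhakarKernel (γ * n + a) ρ (μ * n + b) ω t| ≤ C * t ^ (b - 1) := by
  obtain ⟨s, hs⟩ := (eventually_symbolData_family hρ hμ hb hγ ha ω hΛ).exists
  obtain ⟨C, hC0, hC⟩ := hs.exists_bound T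
  refine ⟨C, hC0, fun n t ht => ?_⟩
  refine le_trans ?_ ((le_abs_self _).trans (hC t ht))
  have h1 := hs.summable_mul_powerKernel ht.1
  have hpos : ∀ p : ℕ × ℕ, 0 ≤ Λ ^ p.1 *
      ((ascPochhammer ℝ p.2).eval (γ * p.1 + a) / (p.2.factorial : ℝ) * |ω| ^ p.2) *
        powerKernel (ρ * p.2 + (μ * p.1 + b)) t := fun p => by
    have := ascPochhammer_eval_nonneg (γ := γ * p.1 + a) (by positivity) p.2
    have := powerKernel_nonneg (hs.pos p) ht.1.le
    positivity
  rw [h1.tsum_prod]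
  refine le_trans ?_ (h1.prod.le_tsum n fun m _ => tsum_nonneg fun k => hpos (m, k))
  have e1 := prabhakar_term_eq (γ := γ) (a := a) (ρ := ρ) (μ := μ) (b := b) (ω := ω) n (-Λ) ht.1
  rw [neg_neg] at e1
  have e2 : Λ ^ n * |prabhakarKernel (γ * n + a) ρ (μ * n + b) ω t| =
      ‖Λ ^ n * prabhakarKernel (γ * n + a) ρ (μ * n + b) ω t‖ := by
    rw [norm_mul, Real.norm_of_nonneg (by positivity), Real.norm_eq_abs]
  rw [e2, e1]
  refine tsum_of_norm_bounded (h1.prod_factor n).hasSum fun k => ?_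
  have := powerKernel_nonneg (hs.pos (n, k)) ht.1.le
  have h3 := abs_family_le (γ := γ) (a := a) (ω := ω) (l := -Λ) (by rw [abs_neg, abs_of_nonneg hΛ]) (n, k)
  rw [neg_neg] at h3
  rw [norm_mul, Real.norm_of_nonneg this, Real.norm_eq_abs]
  refine mul_le_mul_of_nonneg_right (h3.trans (abs_of_nonneg ?_).le) this
  have := ascPochhammer_eval_nonneg (γ := γ * n + a) (by positivity) k
  positivity

end Family

/-- The sign of `γ` is free here, since the operators of the derivative have negative upper index.
Convergence comes from the majorant with `|γ|` and `|ω|`. -/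
theorem hasSymbol_prabhakarKernel {ρ μ : ℝ} (hρ : 0 < ρ) (hμ : 0 < μ) (γ ω : ℝ) :
    HasSymbol (prabhakarKernel γ ρ μ ω) μ (fun s => s ^ (-μ) * (1 - ω * s ^ (-ρ)) ^ (-γ)) := by
  have hev := (eventually_gt_atTop 0).and
    ((tendsto_mul_rpow_neg |ω| hρ).eventually_lt_const one_pos)
  obtain ⟨s₀, hs₀⟩ := eventually_atTop.1 hev
  have key : ∀ γ' ω' : ℝ, |ω'| = |ω| → ∀ s, s₀ ≤ s → HasSum (fun k : ℕ =>
      (ascPochhammer ℝ k).eval γ' / (k.factorial : ℝ) * ω' ^ k * s ^ (-(ρ * k + μ)))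
      (s ^ (-μ) * (1 - ω' * s ^ (-ρ)) ^ (-γ')) := by
    intro γ' ω' hω s hs
    have := hasSum_family (γ := 0) (μ := 0) (a := γ') (b := μ) (Λ := 1) (ω := ω') (hs₀ s hs).1
      (by rw [hω]; exact (hs₀ s hs).2) 0
    simpa using this
  refine ⟨ℕ, inferInstance, _, _, s₀, ⟨hμ, (hs₀ s₀ le_rfl).1, fun k => ?_, ?_⟩,
    fun t ht => prabhakarKernel_eq_tsum γ ρ μ ω ht, fun s hs => (key γ ω rfl s hs).tsum_eq.symm⟩
  · have : 0 ≤ ρ * k := by positivity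
    linarith
  · have hs0 := (hs₀ s₀ le_rfl).1
    refine Summable.of_nonneg_of_le (fun k => by positivity) (fun k => ?_)
      (key |γ| |ω| (abs_abs _) s₀ le_rfl).summable
    refine mul_le_mul_of_nonneg_right ?_ (by positivity)
    rw [abs_mul, abs_div, Nat.abs_cast, abs_pow]
    have := abs_ascPochhammer_eval_le (le_refl |γ|) k
    gcongr

theorem intervalIntegrable_rpow_sub_mul_rpow {a b t : ℝ} (ha : 0 < a) (hb : 0 < b) (ht : 0 < t) :
    IntervalIntegrable (fun y => (t - y) ^ (a - 1) * y ^ (b - 1)) volume 0 t := by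
  have h := (intervalIntegrable_powerKernel_mul ha hb ht).const_mul (Real.Gamma a * Real.Gamma b)
  refine h.congr (fun y _ => ?_)
  have := (Real.Gamma_pos_of_pos ha).ne'
  have := (Real.Gamma_pos_of_pos hb).ne'
  simp only [powerKernel]; field_simp

theorem continuousOn_comp_sub {E : Type*} [TopologicalSpace E] {f : ℝ → E}
    (hf : ContinuousOn f (Ioi 0)) (t : ℝ) : ContinuousOn (fun y => f (t - y)) (Iio t) :=
  hf.comp (by fun_prop) fun _ hy => mem_Ioi.2 (sub_pos.2 hy)

/-- Convolutions of functions with power bounds at `0` converge absolutely. -/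
theorem intervalIntegrable_conv_of_bound {f g : ℝ → ℝ} {a b C C' t : ℝ} (ha : 0 < a) (hb : 0 < b)
    (ht : 0 < t) (hf : ContinuousOn f (Ioi 0)) (hg : ContinuousOn g (Ioi 0))
    (hfC : ∀ y ∈ Ioc 0 t, |f y| ≤ C * y ^ (a - 1)) (hgC : ∀ y ∈ Ioc 0 t, |g y| ≤ C' * y ^ (b - 1)) :
    IntervalIntegrable (fun y => f (t - y) * g y) volume 0 t := by
  have h1 := (intervalIntegrable_rpow_sub_mul_rpow ha hb ht).const_mul (C * C')
  rw [intervalIntegrable_iff_integrableOn_Ioo_of_le ht.le] at h1 ⊢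
  refine Integrable.mono' h1 ?_ ?_
  · refine ContinuousOn.aestronglyMeasurable ?_ measurableSet_Ioo
    exact ((continuousOn_comp_sub hf t).mono fun y hy => hy.2).mul (hg.mono fun y hy => hy.1)
  · refine (ae_restrict_iff' measurableSet_Ioo).2 (Eventually.of_forall fun y hy => ?_)
    have e1 := hfC (t - y) ⟨sub_pos.2 hy.2, by linarith [hy.1]⟩
    have e2 := hgC y ⟨hy.1, hy.2.le⟩
    rw [norm_mul, Real.norm_eq_abs, Real.norm_eq_abs]
    calc |f (t - y)| * |g y| ≤ (C * (t - y) ^ (a - 1)) * (C' * y ^ (b - 1)) :=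
          mul_le_mul e1 e2 (abs_nonneg _) ((abs_nonneg _).trans e1)
      _ = _ := by ring

theorem HasSymbol.intervalIntegrable_conv {f g : ℝ → ℝ} {b b' : ℝ} {D D' : ℝ → ℝ}
    (h : HasSymbol f b D) (h' : HasSymbol g b' D') {t : ℝ} (ht : 0 < t) :
    IntervalIntegrable (fun y => f (t - y) * g y) volume 0 t := by
  obtain ⟨C, -, hC⟩ := h.exists_bound t
  obtain ⟨C', -, hC'⟩ := h'.exists_bound t
  exact intervalIntegrable_conv_of_bound h.exponent_pos h'.exponent_pos ht h.continuousOn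
    h'.continuousOn hC hC'

theorem one_add_mul_rpow_pos {l : ℝ} (hl : 0 ≤ l) {s : ℝ} (hs : 0 < s) (a : ℝ) :
    0 < 1 + l * s ^ a := by positivity

/-! ### The relaxation function: positivity and bounds uniform in the parameter -/

section Relaxation

variable {μ l : ℝ} {f : ℝ → ℝ} (hμ : μ ∈ Ioo (0 : ℝ) 1) (hl : 0 ≤ l)
  (hf : HasSymbol f μ (fun s => s ^ (-μ) / (1 + l * s ^ (-μ))))
include hμ hl hf

/-- With `x = s^(-μ)` this is `x/(1 + l x) = x - l x · x/(1 + l x)`. The function is `t^(μ-1)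
E_{μ,μ}(-l t^μ)`. -/
theorem relaxation_eq {t : ℝ} (ht : 0 < t) :
    f t = powerKernel μ t - l * ∫ y in (0 : ℝ)..t, powerKernel μ (t - y) * f y := by
  have hk := hasSymbol_powerKernel hμ.1
  have h1 := ((hk.conv hf).smul l).weaken hμ.1 (by linarith [hμ.1])
  refine hf.eqOn (hk.sub h1) ?_ ht
  filter_upwards [eventually_gt_atTop 0] with s hs
  have := (one_add_mul_rpow_pos hl hs (-μ)).ne'
  field_simp; ring

/-- The convolution term is `O(t^(2μ-1))`, smaller than the power kernel `t^(μ-1)/Γ(μ)` by a factor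
`t^μ`. -/
theorem exists_pos_near_zero : ∃ ε, 0 < ε ∧ ∀ t ∈ Ioc 0 ε, 0 < f t := by
  have hk := hasSymbol_powerKernel hμ.1
  obtain ⟨C, hC0, hC⟩ := ((hk.conv hf).smul l).exists_bound 1
  have hG := Real.Gamma_pos_of_pos hμ.1
  have ht0 : Tendsto (fun t : ℝ => C * t ^ μ) (𝓝 0) (𝓝 0) := by
    have := (Real.continuousAt_rpow_const 0 μ (Or.inr hμ.1.le)).tendsto.const_mul C
    rwa [Real.zero_rpow hμ.1.ne', mul_zero] at this
  have hev := ht0.eventually_lt_const (inv_pos.2 hG)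
  obtain ⟨ε, hε, hball⟩ := Metric.eventually_nhds_iff.1 hev
  refine ⟨min 1 (ε / 2), by positivity, fun t ht => ?_⟩
  have h1 := hC t ⟨ht.1, ht.2.trans (min_le_left _ _)⟩
  have h2 : C * t ^ μ < (Real.Gamma μ)⁻¹ := hball (by
    rw [dist_zero_right, Real.norm_of_nonneg ht.1.le]
    linarith [ht.2.trans (min_le_right _ _)])
  rw [relaxation_eq hμ hl hf ht.1]
  have h3 : C * t ^ (μ + μ - 1) < powerKernel μ t := by
    have e1 : t ^ (μ + μ - 1) = t ^ μ * t ^ (μ - 1) := by rw [← Real.rpow_add ht.1]; congr 1; ring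
    have := Real.rpow_pos_of_pos ht.1 (μ - 1)
    rw [e1, powerKernel, div_eq_inv_mul, ← mul_assoc]
    gcongr
  linarith [(abs_le.1 h1).2]

/-- Write `k` for the power kernel. At the first point `t₀` where `f ≤ 0`, compare the Volterra
equation with the one at a point `u < t₀` close to it. The ratio `k(t₀ - y)/k(t₀)` is at most `k(u -
y)/k(u)`, so the history on `[0,u]` nearly cancels `k(u)`. What remains is the contribution of
`[u,t₀]`, a small multiple of `f u` when `u` maximises `f` near `t₀`; this forces `f u < f u`. -/
theorem relaxation_pos {t : ℝ} (ht : 0 < t) : 0 < f t := by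
  by_contra hneg
  push Not at hneg
  have hμ1 : μ - 1 ≤ 0 := by linarith [hμ.2]
  obtain ⟨ε, hε, hpos⟩ := exists_pos_near_zero hμ hl hf
  have hεt : ε ≤ t := by
    by_contra h
    exact absurd (hpos t ⟨ht, (not_le.1 h).le⟩) (not_lt.2 hneg)
  have hcont : ContinuousOn f (Icc ε t) := hf.continuousOn.mono fun y hy => hε.trans_le hy.1
  obtain ⟨t₀, ht₀, hleast⟩ := (isCompact_Icc.of_isClosed_subset
    (hcont.preimage_isClosed_of_isClosed isClosed_Icc isClosed_Iic) inter_subset_left :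
      IsCompact (Icc ε t ∩ f ⁻¹' Iic 0)).exists_isLeast ⟨t, ⟨hεt, le_rfl⟩, hneg⟩
  have ht₀p : 0 < t₀ := hε.trans_le ht₀.1.1
  have hlt : ∀ y, 0 < y → y < t₀ → 0 < f y := by
    intro y hy hyt
    rcases le_or_gt y ε with h | h
    · exact hpos y ⟨hy, h⟩
    · by_contra h'
      exact absurd (hleast ⟨⟨h.le, hyt.le.trans ht₀.1.2⟩, not_lt.1 h'⟩) (not_le.2 hyt)
  have hk := hasSymbol_powerKernel hμ.1
  have hk0 : 0 < powerKernel μ t₀ := powerKernel_pos hμ.1 ht₀p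
  have hG := Real.Gamma_pos_of_pos (show 0 < μ + 1 by linarith [hμ.1])
  -- `B δ^μ` will bound `l k(u) / k(t₀) · ∫ k(t₀ - y) dy` over `[u,t₀]`, using `t₀ / 2 ≤ t₀ - δ ≤
  -- u`.
  set B := l * powerKernel μ (t₀ / 2) / powerKernel μ t₀ / Real.Gamma (μ + 1) with hB
  have hB0 : 0 ≤ B := by have := powerKernel_pos hμ.1 (half_pos ht₀p); positivity
  obtain ⟨δ, hδ, hδt, hδB⟩ : ∃ δ, 0 < δ ∧ δ ≤ t₀ / 2 ∧ B * δ ^ μ < 1 := by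
    have h0 : Tendsto (fun t : ℝ => B * t ^ μ) (𝓝[>] 0) (𝓝 0) := by
      have := (Real.continuousAt_rpow_const 0 μ (Or.inr hμ.1.le)).tendsto.const_mul B
      rw [Real.zero_rpow hμ.1.ne', mul_zero] at this
      exact this.mono_left nhdsWithin_le_nhds
    obtain ⟨δ, h1, h2, h3⟩ := ((h0.eventually_lt_const one_pos).and
      (Ioo_mem_nhdsGT (half_pos ht₀p))).exists
    exact ⟨δ, h2, h3.le, h1⟩
  obtain ⟨u, hu, humax⟩ := isCompact_Icc.exists_isMaxOn (s := Icc (t₀ - δ) t₀) (f := f)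
    ⟨t₀, by constructor <;> linarith⟩ (hf.continuousOn.mono fun y hy => by
      have := hy.1; simp only [mem_Ioi]; linarith)
  have hup : 0 < u := by linarith [hu.1]
  have hfu : 0 < f u := (hlt (t₀ - δ) (by linarith) (by linarith)).trans_le
    (humax ⟨le_rfl, by linarith⟩)
  have hut : u < t₀ := lt_of_le_of_ne hu.2 fun h => absurd (h ▸ hfu) (not_lt.2 ht₀.2)
  have hku := powerKernel_pos hμ.1 hup
  have i0 := hk.intervalIntegrable_conv hf ht₀p
  have i1 : IntervalIntegrable (fun y => powerKernel μ (t₀ - y) * f y) volume 0 u :=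
    i0.mono_set (by rw [uIcc_of_le hup.le, uIcc_of_le ht₀p.le]; exact Icc_subset_Icc_right hut.le)
  have i2 : IntervalIntegrable (fun y => powerKernel μ (t₀ - y) * f y) volume u t₀ :=
    i0.mono_set (by rw [uIcc_of_le hut.le, uIcc_of_le ht₀p.le]; exact Icc_subset_Icc_left hup.le)
  have e1 := relaxation_eq hμ hl hf hup
  have e2 := relaxation_eq hμ hl hf ht₀p
  have e2' : f t₀ ≤ 0 := ht₀.2
  -- Monotonicity of the normalised kernel: `(t₀ - y)/t₀ ≥ (u - y)/u`, and the exponent `μ - 1` is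
  -- nonpositive.
  have c1 : powerKernel μ u / powerKernel μ t₀ * ∫ y in (0 : ℝ)..u, powerKernel μ (t₀ - y) * f y ≤
      ∫ y in (0 : ℝ)..u, powerKernel μ (u - y) * f y := by
    rw [← intervalIntegral.integral_const_mul]
    refine intervalIntegral.integral_mono_on_of_le_Ioo hup.le (i1.const_mul _)
      (hk.intervalIntegrable_conv hf hup) fun y hy => ?_
    rw [← mul_assoc]
    refine mul_le_mul_of_nonneg_right ?_ (hlt y hy.1 (hy.2.trans hut)).le
    have a1 : 0 < u - y := sub_pos.2 hy.2
    have a2 : 0 < t₀ - y := sub_pos.2 (hy.2.trans hut)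
    have a3 : ((t₀ - y) / t₀) ^ (μ - 1) ≤ ((u - y) / u) ^ (μ - 1) := by
      refine Real.rpow_le_rpow_of_nonpos (by positivity) ?_ hμ1
      rw [div_le_div_iff₀ hup ht₀p]
      nlinarith [hy.1]
    rw [Real.div_rpow a2.le ht₀p.le, Real.div_rpow a1.le hup.le] at a3
    have b1 := Real.rpow_pos_of_pos hup (μ - 1)
    have b2 := Real.rpow_pos_of_pos ht₀p (μ - 1)
    rw [div_le_div_iff₀ b2 b1] at a3
    have hG' := Real.Gamma_pos_of_pos hμ.1
    simp only [powerKernel]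
    rw [div_div_div_cancel_right₀ hG'.ne', ← mul_div_assoc, div_le_div_iff_of_pos_right hG',
      div_mul_eq_mul_div, div_le_iff₀ b2]
    linarith
  have c2 : ∫ y in u..t₀, powerKernel μ (t₀ - y) * f y ≤ f u * powerKernel (μ + 1) (t₀ - u) := by
    have j : ∫ y in u..t₀, powerKernel μ (t₀ - y) = powerKernel (μ + 1) (t₀ - u) := by
      rw [intervalIntegral.integral_comp_sub_left (fun y => powerKernel μ y) t₀, sub_self]
      simp only [powerKernel]
      rw [intervalIntegral.integral_div, integral_rpow (Or.inl (by linarith [hμ.1])),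
        Real.Gamma_add_one hμ.1.ne']
      simp only [sub_add_cancel, Real.zero_rpow hμ.1.ne', sub_zero, add_sub_cancel_right]
      rw [div_div]
    rw [← j, ← intervalIntegral.integral_const_mul]
    refine intervalIntegral.integral_mono_on hut.le i2 ?_ fun y hy => ?_
    · refine IntervalIntegrable.const_mul ?_ _
      have := (intervalIntegrable_powerKernel hμ.1 (t₀ - u) (t₀ - t₀)).comp_sub_left t₀
      simpa using this
    · rw [mul_comm]
      refine mul_le_mul_of_nonneg_right (humax ⟨hu.1.trans hy.1, hy.2⟩)
        (powerKernel_nonneg hμ.1 (sub_nonneg.2 hy.2))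
  have c3 : ∫ y in (0 : ℝ)..t₀, powerKernel μ (t₀ - y) * f y =
      (∫ y in (0 : ℝ)..u, powerKernel μ (t₀ - y) * f y) +
        ∫ y in u..t₀, powerKernel μ (t₀ - y) * f y :=
    (intervalIntegral.integral_add_adjacent_intervals i1 i2).symm
  set I0 := ∫ y in (0 : ℝ)..u, powerKernel μ (t₀ - y) * f y
  set I1 := ∫ y in u..t₀, powerKernel μ (t₀ - y) * f y
  have d0 : powerKernel μ t₀ - l * (f u * powerKernel (μ + 1) (t₀ - u)) ≤ l * I0 := by
    have := mul_le_mul_of_nonneg_left c2 hl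
    rw [c3] at e2
    nlinarith
  have d1 : f u ≤ powerKernel μ u / powerKernel μ t₀ * (l * (f u * powerKernel (μ + 1) (t₀ - u))) := by
    have hq : 0 < powerKernel μ u / powerKernel μ t₀ := by positivity
    have := mul_le_mul_of_nonneg_left c1 hl
    have h5 := mul_le_mul_of_nonneg_left d0 hq.le
    have h6 : powerKernel μ u / powerKernel μ t₀ * powerKernel μ t₀ = powerKernel μ u := by field_simp
    rw [mul_sub, h6] at h5
    linarith
  have d2 : powerKernel μ u ≤ powerKernel μ (t₀ / 2) := by
    simp only [powerKernel]
    have := Real.Gamma_pos_of_pos hμ.1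
    have : u ^ (μ - 1) ≤ (t₀ / 2) ^ (μ - 1) :=
      Real.rpow_le_rpow_of_nonpos (by linarith) (by linarith [hu.1]) hμ1
    gcongr
  have d3 : powerKernel (μ + 1) (t₀ - u) ≤ δ ^ μ / Real.Gamma (μ + 1) := by
    simp only [powerKernel, add_sub_cancel_right]
    have : (t₀ - u) ^ μ ≤ δ ^ μ := Real.rpow_le_rpow (by linarith) (by linarith [hu.1]) hμ.1.le
    gcongr
  have d4 : f u ≤ f u * (B * δ ^ μ) := by
    refine d1.trans ?_
    have h7 : 0 ≤ powerKernel (μ + 1) (t₀ - u) :=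
      powerKernel_nonneg (by linarith [hμ.1]) (by linarith)
    have h8 := powerKernel_pos hμ.1 (half_pos ht₀p)
    calc _ ≤ powerKernel μ (t₀ / 2) / powerKernel μ t₀ *
          (l * (f u * (δ ^ μ / Real.Gamma (μ + 1)))) := by gcongr
      _ = _ := by rw [hB]; ring
  nlinarith

/-- The power kernel decreases, so the convolution in the Volterra equation is at least the kernel
at `t` times the integral of `f`; since `f` is positive, `l` times that convolution is at most the
kernel at `t`. -/
theorem mul_integral_relaxation_le_one {t : ℝ} (ht : 0 < t) : l * ∫ y in (0 : ℝ)..t, f y ≤ 1 := by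
  have hk := hasSymbol_powerKernel hμ.1
  have hkt := powerKernel_pos hμ.1 ht
  have h1 : powerKernel μ t * ∫ y in (0 : ℝ)..t, f y ≤ ∫ y in (0 : ℝ)..t, powerKernel μ (t - y) * f y := by
    rw [← intervalIntegral.integral_const_mul]
    refine intervalIntegral.integral_mono_on_of_le_Ioo ht.le
      ((hf.intervalIntegrable ht.le).const_mul _) (hk.intervalIntegrable_conv hf ht) fun y hy => ?_
    refine mul_le_mul_of_nonneg_right ?_ (relaxation_pos hμ hl hf hy.1).le
    have := Real.Gamma_pos_of_pos hμ.1
    have : t ^ (μ - 1) ≤ (t - y) ^ (μ - 1) :=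
      Real.rpow_le_rpow_of_nonpos (sub_pos.2 hy.2) (by linarith [hy.1]) (by linarith [hμ.2])
    simp only [powerKernel]
    gcongr
  have h2 := relaxation_eq hμ hl hf ht
  have h3 := relaxation_pos hμ hl hf ht
  have h4 := mul_le_mul_of_nonneg_left h1 hl
  have h5 : powerKernel μ t * (l * ∫ y in (0 : ℝ)..t, f y) ≤ powerKernel μ t * 1 := by nlinarith
  exact le_of_mul_le_mul_left h5 hkt

/-- Multiply the Volterra equation by `t`, use `t ≥ t - y` under the integral and `z k_μ(z) = μ
k_{μ+1}(z)`, and recognise the integrated equation. With the preceding bound this gives `l f(t) ≤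
μ/t`. -/
theorem mul_relaxation_le_integral {t : ℝ} (ht : 0 < t) : t * f t ≤ μ * ∫ y in (0 : ℝ)..t, f y := by
  have hμ' : 0 < μ + 1 := by linarith [hμ.1]
  have hk := hasSymbol_powerKernel hμ.1
  have hk' := hasSymbol_powerKernel hμ'
  have e1 : ∫ y in (0 : ℝ)..t, f y =
      powerKernel (μ + 1) t - l * ∫ y in (0 : ℝ)..t, powerKernel (μ + 1) (t - y) * f y := by
    have h1 := (hasSymbol_one.conv hf).congr (g := fun t => ∫ y in (0 : ℝ)..t, f y)
      (fun t _ => by simp) (Eventually.of_forall fun s => rfl)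
    have h2 := ((hk'.conv hf).smul l).weaken hμ' (by linarith [hμ.1])
    refine h1.eqOn (hk'.sub h2) ?_ ht
    filter_upwards [eventually_gt_atTop 0] with s hs
    have := (one_add_mul_rpow_pos hl hs (-μ)).ne'
    rw [neg_add, Real.rpow_add hs, Real.rpow_neg_one]
    field_simp; ring
  have hmul : ∀ z : ℝ, 0 < z → z * powerKernel μ z = μ * powerKernel (μ + 1) z := by
    intro z hz
    have := (Real.Gamma_pos_of_pos hμ.1).ne'
    have := hμ.1.ne'
    rw [powerKernel, powerKernel, Real.Gamma_add_one hμ.1.ne', add_sub_cancel_right,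
      Real.rpow_sub_one hz.ne']
    field_simp
  have i1 := hk.intervalIntegrable_conv hf ht
  have i2 := hk'.intervalIntegrable_conv hf ht
  have e2 : μ * ∫ y in (0 : ℝ)..t, powerKernel (μ + 1) (t - y) * f y ≤
      t * ∫ y in (0 : ℝ)..t, powerKernel μ (t - y) * f y := by
    rw [← intervalIntegral.integral_const_mul, ← intervalIntegral.integral_const_mul]
    refine intervalIntegral.integral_mono_on_of_le_Ioo ht.le (i2.const_mul _) (i1.const_mul _)
      fun y hy => ?_
    have h0 : 0 < t - y := sub_pos.2 hy.2
    have h1 := (relaxation_pos hμ hl hf hy.1).le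
    have h2 := powerKernel_pos hμ.1 h0
    rw [← mul_assoc, ← hmul _ h0, ← mul_assoc]
    have : (t - y) * powerKernel μ (t - y) ≤ t * powerKernel μ (t - y) :=
      mul_le_mul_of_nonneg_right (by linarith [hy.1]) h2.le
    exact mul_le_mul_of_nonneg_right this h1
  have e3 := mul_le_mul_of_nonneg_left e2 hl
  rw [relaxation_eq hμ hl hf ht, e1, mul_sub, hmul t ht]
  linarith

end Relaxation

/-! ### Volterra estimates -/

theorem rpow_le_of_half_le {a y t : ℝ} (ht : 0 < t) (h1 : t / 2 ≤ y) (h2 : y ≤ t) :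
    y ^ (a - 1) ≤ (1 + 2 ^ (1 - a)) * t ^ (a - 1) := by
  have hy : 0 < y := by linarith
  have ht' := Real.rpow_nonneg ht.le (a - 1)
  have h2' : (0 : ℝ) < 2 ^ (1 - a) := by positivity
  rcases le_total 1 a with h | h
  · have := Real.rpow_le_rpow hy.le h2 (sub_nonneg.2 h)
    nlinarith
  · have h3 := Real.rpow_le_rpow_of_nonpos (by linarith) h1 (show a - 1 ≤ 0 by linarith)
    have h4 : (t / 2) ^ (a - 1) = 2 ^ (1 - a) * t ^ (a - 1) := by
      rw [Real.div_rpow ht.le two_pos.le, div_eq_mul_inv, ← Real.rpow_neg two_pos.le, neg_sub, mul_comm]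
    nlinarith

theorem intervalIntegrable_rpow_sub {a t : ℝ} (ha : 0 < a) :
    IntervalIntegrable (fun y => (t - y) ^ (a - 1)) volume 0 t := by
  have h := (intervalIntegral.intervalIntegrable_rpow' (r := a - 1) (a := t - 0) (b := t - t)
    (by linarith)).comp_sub_left t
  simpa using h

theorem integral_rpow_sub {a t : ℝ} (ha : 0 < a) :
    ∫ y in (0 : ℝ)..t, (t - y) ^ (a - 1) = t ^ a / a := by
  rw [intervalIntegral.integral_comp_sub_left (fun y => y ^ (a - 1)) t, sub_self, sub_zero,
    integral_rpow (Or.inl (by linarith))]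
  simp [Real.zero_rpow ha.ne']

/-- A function bounded by `C t ^ (a - 1)` keeps such a bound under convolution with a function of
integral at most `M` and pointwise bound `M / t`. -/
theorem integral_conv_le_of_bound {f r : ℝ → ℝ} {a C M t : ℝ} (ha : 0 < a) (hC : 0 ≤ C) (hM : 0 ≤ M)
    (ht : 0 < t) (hf : ∀ y ∈ Ioc 0 t, |f y| ≤ C * y ^ (a - 1))
    (hr : ∀ y ∈ Ioc 0 t, |r y| ≤ M / y) (hri : IntervalIntegrable r volume 0 t)
    (hrM : ∫ y in (0 : ℝ)..t, |r y| ≤ M) :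
    ∫ y in (0 : ℝ)..t, |f (t - y) * r y| ≤ C * M * (1 + 2 ^ (1 - a) + 2 / a) * t ^ (a - 1) := by
  -- For `y ≤ t/2` the factor `f (t - y)` is comparable to `t^(a-1)`; for `y ≥ t/2` the factor `r y`
  -- is at most `2M/t`. The sum of the two bounds covers both cases.
  have key : ∀ y ∈ Ioo 0 t, |f (t - y) * r y| ≤
      C * (1 + 2 ^ (1 - a)) * t ^ (a - 1) * |r y| + 2 * M / t * C * (t - y) ^ (a - 1) := by
    intro y hy
    have hty : 0 < t - y := sub_pos.2 hy.2
    have h1 := hf (t - y) ⟨hty, by linarith [hy.1]⟩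
    have h2 := hr y ⟨hy.1, hy.2.le⟩
    have p1 := Real.rpow_nonneg hty.le (a - 1)
    have p2 := Real.rpow_nonneg ht.le (a - 1)
    have p3 := abs_nonneg (r y)
    rw [abs_mul]
    rcases le_total y (t / 2) with h | h
    · have h3 := rpow_le_of_half_le (a := a) ht (show t / 2 ≤ t - y by linarith) (by linarith [hy.1])
      have h4 : |f (t - y)| ≤ C * ((1 + 2 ^ (1 - a)) * t ^ (a - 1)) :=
        h1.trans (mul_le_mul_of_nonneg_left h3 hC)
      have h5 := mul_le_mul_of_nonneg_right h4 p3
      have h6 : 0 ≤ 2 * M / t * C * (t - y) ^ (a - 1) := by positivity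
      linarith
    · have h3 : |r y| ≤ 2 * M / t := h2.trans (by
        rw [div_le_div_iff₀ hy.1 ht]; nlinarith)
      have h4 := mul_le_mul h1 h3 p3 (by positivity)
      have h6 : 0 ≤ C * (1 + 2 ^ (1 - a)) * t ^ (a - 1) * |r y| := by positivity
      linarith
  have i1 := hri.abs.const_mul (C * (1 + 2 ^ (1 - a)) * t ^ (a - 1))
  have i2 := (intervalIntegrable_rpow_sub (t := t) ha).const_mul (2 * M / t * C)
  have h1 : ∫ y in (0 : ℝ)..t, |f (t - y) * r y| ≤ ∫ y in (0 : ℝ)..t,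
      (C * (1 + 2 ^ (1 - a)) * t ^ (a - 1) * |r y| + 2 * M / t * C * (t - y) ^ (a - 1)) := by
    refine (le_abs_self _).trans ?_
    rw [← Real.norm_eq_abs]
    have i3 := i1.add i2
    rw [intervalIntegral.integral_of_le ht.le, intervalIntegral.integral_of_le ht.le,
      integral_Ioc_eq_integral_Ioo, integral_Ioc_eq_integral_Ioo]
    rw [intervalIntegrable_iff_integrableOn_Ioo_of_le ht.le] at i3
    refine norm_integral_le_of_norm_le i3 ?_
    refine (ae_restrict_iff' measurableSet_Ioo).2 (Eventually.of_forall fun y hy => ?_)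
    rw [Real.norm_eq_abs, abs_abs]
    exact key y hy
  refine h1.trans ?_
  rw [intervalIntegral.integral_add i1 i2, intervalIntegral.integral_const_mul,
    intervalIntegral.integral_const_mul, integral_rpow_sub ha]
  have p2 := Real.rpow_nonneg ht.le (a - 1)
  have e1 : t ^ a = t * t ^ (a - 1) := by rw [Real.rpow_sub_one ht.ne']; field_simp
  have h5 : C * (1 + 2 ^ (1 - a)) * t ^ (a - 1) * ∫ y in (0 : ℝ)..t, |r y| ≤
      C * (1 + 2 ^ (1 - a)) * t ^ (a - 1) * M := by gcongr
  have h6 : 2 * M / t * C * (t ^ a / a) = C * M * (2 / a) * t ^ (a - 1) := by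
    rw [e1]; field_simp
  rw [h6]
  linarith

/-- A large exponential weight makes the Volterra kernel a contraction in `L¹`; the value `1/4`
leaves room for the factor `2` lost in the pointwise estimate. -/
theorem exists_weight (C : ℝ) {a : ℝ} (ha : 0 < a) : ∃ R : ℝ, 0 < R ∧
    IntegrableOn (fun z => C * (Real.exp (-(R * z)) * z ^ (a - 1))) (Ioi 0) ∧
    ∫ z in Ioi (0 : ℝ), C * (Real.exp (-(R * z)) * z ^ (a - 1)) ≤ 1 / 4 := by
  have hG := Real.Gamma_pos_of_pos ha
  obtain ⟨R, h1, h2⟩ := ((eventually_gt_atTop 0).and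
    ((tendsto_mul_rpow_neg (C * Real.Gamma a) ha).eventually_le_const
      (show (0 : ℝ) < 1 / 4 by norm_num))).exists
  have e : ∀ z : ℝ, C * (Real.exp (-(R * z)) * z ^ (a - 1)) =
      C * Real.Gamma a * (Real.exp (-(R * z)) * powerKernel a z) := fun z => by
    rw [powerKernel]; field_simp
  refine ⟨R, h1, ?_, ?_⟩ <;> simp only [e]
  · exact (integrableOn_exp_mul_powerKernel ha h1).const_mul _
  · rw [integral_const_mul, integral_exp_mul_powerKernel ha h1]
    exact h2

/-- Bounds for solutions of the Volterra equation `r = r₀ - w ⋆ r`, uniform over all kernels `w`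
with `|w t| ≤ C t ^ (a - 1)`. -/
theorem exists_volterra_bound {T C a : ℝ} (hT : 0 < T) (hC : 0 ≤ C) (ha : 0 < a) :
    ∃ M, 0 ≤ M ∧ ∀ (r r₀ w : ℝ → ℝ) (B m : ℝ), 0 < m → ContinuousOn r (Ioi 0) →
      IntervalIntegrable r₀ volume 0 T →
      (∀ t ∈ Ioc 0 T, |w t| ≤ C * t ^ (a - 1)) →
      (∀ t ∈ Ioc 0 T, |r₀ t| ≤ 1 / t) → ∫ t in (0 : ℝ)..T, |r₀ t| ≤ 1 →
      (∀ t ∈ Ioc 0 T, |r t| ≤ B * t ^ (m - 1)) →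
      (∀ t ∈ Ioc 0 T, r t = r₀ t - ∫ y in (0 : ℝ)..t, w (t - y) * r y) →
      (∀ t ∈ Ioc 0 T, |r t| ≤ M / t) ∧ ∀ t ∈ Ioc 0 T, ∫ y in (0 : ℝ)..t, |r y| ≤ M := by
  obtain ⟨R, hR, hκi, hκ⟩ := exists_weight C ha
  set κ : ℝ → ℝ := fun z => C * (Real.exp (-(R * z)) * z ^ (a - 1)) with hκdef
  -- This bounds `t κ(t - y)` for `y ≤ t/2`.
  set c₁ := C * (1 + 2 ^ (1 - a)) * T ^ a with hc₁
  have hc₁0 : 0 ≤ c₁ := by positivity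
  -- The weighted function `E` satisfies `E ≤ |r₀| + κ ⋆ E`. So `N = ∫ E ≤ 1 + N/4` gives `N ≤ 4/3`,
  -- and `S = sup t E ≤ 1 + (4/3) c₁ + S/2` gives the pointwise constant; `e^(RT)` undoes the
  -- weight. The a priori bound by `B t^(m-1)` only makes `N` and `S` finite and does not enter the
  -- constant.
  refine ⟨Real.exp (R * T) * (2 * (1 + c₁ * (4 / 3))), by positivity, ?_⟩
  intro r r₀ w B m hm hr hr₀ hw hr₀t hr₀i hrB heq
  have hB0 : 0 ≤ B := by
    have := (abs_nonneg _).trans (hrB T ⟨hT, le_rfl⟩)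
    exact nonneg_of_mul_nonneg_left this (Real.rpow_pos_of_pos hT _)
  set E : ℝ → ℝ := fun t => Real.exp (-(R * t)) * |r t| with hE
  have hE0 : ∀ t, 0 ≤ E t := fun t => by positivity
  have hexp1 : ∀ t, 0 ≤ t → Real.exp (-(R * t)) ≤ 1 := fun t ht =>
    Real.exp_le_one_iff.2 (by nlinarith)
  have hEr : ∀ t, 0 ≤ t → E t ≤ |r t| := fun t ht =>
    mul_le_of_le_one_left (abs_nonneg _) (hexp1 t ht)
  have hEc : ContinuousOn E (Ioi 0) := by
    refine ContinuousOn.mul (by fun_prop) hr.abs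
  have hEB : ∀ t ∈ Ioc 0 T, |E t| ≤ B * t ^ (m - 1) := fun t ht => by
    rw [abs_of_nonneg (hE0 t)]
    exact (hEr t ht.1.le).trans (hrB t ht)
  have hκ0 : ∀ z, 0 ≤ z → 0 ≤ κ z := fun z hz => by
    have := Real.rpow_nonneg hz (a - 1)
    simp only [hκdef]; positivity
  have hκC : ∀ z ∈ Ioc 0 T, |κ z| ≤ C * z ^ (a - 1) := fun z hz => by
    rw [abs_of_nonneg (hκ0 z hz.1.le)]
    simp only [hκdef]
    have := Real.rpow_nonneg hz.1.le (a - 1)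
    exact mul_le_mul_of_nonneg_left (mul_le_of_le_one_left this (hexp1 z hz.1.le)) hC
  have hκc : ContinuousOn κ (Ioi 0) := by
    refine continuousOn_const.mul (ContinuousOn.mul (by fun_prop) ?_)
    exact fun z hz => (Real.continuousAt_rpow_const _ _ (Or.inl (ne_of_gt hz))).continuousWithinAt
  have iE : IntegrableOn E (Ioc 0 T) := by
    have h1 : IntervalIntegrable (fun y : ℝ => B * y ^ (m - 1)) volume 0 T :=
      (intervalIntegral.intervalIntegrable_rpow' (by linarith)).const_mul B
    rw [intervalIntegrable_iff_integrableOn_Ioc_of_le hT.le] at h1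
    refine h1.mono' ((hEc.mono fun y hy => hy.1).aestronglyMeasurable measurableSet_Ioc) ?_
    exact (ae_restrict_iff' measurableSet_Ioc).2 (Eventually.of_forall fun y hy => hEB y hy)
  have iκE : ∀ t ∈ Ioc 0 T, IntervalIntegrable (fun y => κ (t - y) * E y) volume 0 t := fun t ht =>
    intervalIntegrable_conv_of_bound ha hm ht.1 hκc hEc
      (fun y hy => hκC y ⟨hy.1, hy.2.trans ht.2⟩) (fun y hy => hEB y ⟨hy.1, hy.2.trans ht.2⟩)
  have hmain : ∀ t ∈ Ioc 0 T, E t ≤ |r₀ t| + ∫ y in (0 : ℝ)..t, κ (t - y) * E y := by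
    intro t ht
    have h1 : |∫ y in (0 : ℝ)..t, Real.exp (-(R * t)) * (w (t - y) * r y)| ≤
        ∫ y in (0 : ℝ)..t, κ (t - y) * E y := by
      have i := iκE t ht
      rw [← Real.norm_eq_abs]
      rw [intervalIntegral.integral_of_le ht.1.le, intervalIntegral.integral_of_le ht.1.le,
        integral_Ioc_eq_integral_Ioo, integral_Ioc_eq_integral_Ioo]
      rw [intervalIntegrable_iff_integrableOn_Ioo_of_le ht.1.le] at i
      refine norm_integral_le_of_norm_le i ?_
      refine (ae_restrict_iff' measurableSet_Ioo).2 (Eventually.of_forall fun y hy => ?_)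
      have h2 := hw (t - y) ⟨sub_pos.2 hy.2, by linarith [hy.1, ht.2]⟩
      rw [norm_mul, norm_mul, Real.norm_eq_abs, Real.norm_eq_abs, Real.norm_eq_abs, abs_of_pos
        (Real.exp_pos _)]
      have h3 : Real.exp (-(R * t)) = Real.exp (-(R * (t - y))) * Real.exp (-(R * y)) := by
        rw [← Real.exp_add]; congr 1; ring
      simp only [hκdef, hE]
      rw [h3]
      calc _ ≤ Real.exp (-(R * (t - y))) * Real.exp (-(R * y)) * (C * (t - y) ^ (a - 1) * |r y|) := by
            gcongr
        _ = _ := by ring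
    rw [intervalIntegral.integral_const_mul, abs_mul, abs_of_pos (Real.exp_pos _)] at h1
    have h2 : |r t| ≤ |r₀ t| + |∫ y in (0 : ℝ)..t, w (t - y) * r y| := by
      conv_lhs => rw [heq t ht]
      exact abs_sub _ _
    have h3 := mul_le_mul_of_nonneg_left h2 (Real.exp_pos (-(R * t))).le
    have h4 := mul_le_of_le_one_left (abs_nonneg (r₀ t)) (hexp1 t ht.1.le)
    simp only [hE] at h1 ⊢
    linarith
  set N := ∫ t in Ioc (0 : ℝ) T, E t with hN
  have hN0 : 0 ≤ N := integral_nonneg hE0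
  have hNle : N ≤ 4 / 3 := by
    -- Cutting `E` off at `T` lets the half-line formula for the integral of a convolution apply.
    set E1 : ℝ → ℝ := (Ioc (0 : ℝ) T).indicator E with hE1
    have iE1 : IntegrableOn E1 (Ioi 0) :=
      ((integrable_indicator_iff measurableSet_Ioc).2 iE).integrableOn
    have hpos := integral_posConvolution iE1 hκi (ContinuousLinearMap.mul ℝ ℝ)
    have hint := integrable_posConvolution iE1 hκi (ContinuousLinearMap.mul ℝ ℝ)
    simp only [ContinuousLinearMap.mul_apply'] at hpos
    have hE1i : ∫ t in Ioi (0 : ℝ), E1 t = N := by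
      rw [hE1, setIntegral_indicator measurableSet_Ioc]
      congr 2
      ext y; simp +contextual
    rw [hE1i] at hpos
    set P : ℝ → ℝ := fun x => ∫ t in (0 : ℝ)..x, E1 t * κ (x - t) with hP
    have hPeq : ∀ t ∈ Ioc 0 T, ∫ y in (0 : ℝ)..t, κ (t - y) * E y = P t := by
      intro t ht
      simp only [hP]
      rw [intervalIntegral.integral_of_le ht.1.le, intervalIntegral.integral_of_le ht.1.le]
      refine setIntegral_congr_fun measurableSet_Ioc fun y hy => ?_
      simp only [hE1]
      rw [indicator_of_mem (show y ∈ Ioc 0 T from ⟨hy.1, hy.2.trans ht.2⟩), mul_comm]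
    have hP0 : ∀ x ∈ Ioi (0 : ℝ), 0 ≤ P x := by
      intro x hx
      refine intervalIntegral.integral_nonneg (le_of_lt hx) fun y hy => ?_
      exact mul_nonneg (indicator_nonneg (fun y _ => hE0 y) _) (hκ0 _ (sub_nonneg.2 hy.2))
    have hPi : IntegrableOn P (Ioi 0) := by
      have := (integrable_indicator_iff measurableSet_Ioi).1 hint
      simpa only [ContinuousLinearMap.mul_apply'] using this
    have hPT : IntegrableOn P (Ioc 0 T) := hPi.mono_set fun y hy => hy.1
    rw [intervalIntegrable_iff_integrableOn_Ioc_of_le hT.le] at hr₀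
    rw [intervalIntegral.integral_of_le hT.le] at hr₀i
    have h1 : N ≤ ∫ t in Ioc (0 : ℝ) T, (|r₀ t| + P t) := by
      refine setIntegral_mono_on iE (hr₀.abs.add hPT) measurableSet_Ioc fun t ht => ?_
      rw [← hPeq t ht]
      exact hmain t ht
    rw [integral_add hr₀.abs hPT] at h1
    have h2 : ∫ t in Ioc (0 : ℝ) T, P t ≤ ∫ t in Ioi (0 : ℝ), P t :=
      setIntegral_mono_set hPi ((ae_restrict_iff' measurableSet_Ioi).2 (Eventually.of_forall hP0))
        (Eventually.of_forall fun y (hy : y ∈ Ioc 0 T) => hy.1)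
    have h3 : ∫ t in Ioi (0 : ℝ), P t ≤ N * (1 / 4) := by
      rw [hpos]; gcongr
    linarith
  have hsup : ∀ t ∈ Ioc 0 T, t * E t ≤ 2 * (1 + c₁ * (4 / 3)) := by
    set S := sSup ((fun t => t * E t) '' Ioc 0 T) with hS
    have hbdd : BddAbove ((fun t => t * E t) '' Ioc 0 T) := by
      refine ⟨B * T ^ m, ?_⟩
      rintro _ ⟨t, ht, rfl⟩
      have h1 := hEB t ht
      rw [abs_of_nonneg (hE0 t)] at h1
      have h2 : t ^ m ≤ T ^ m := Real.rpow_le_rpow ht.1.le ht.2 hm.le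
      have h3 : t ^ m = t * t ^ (m - 1) := by
        rw [Real.rpow_sub_one ht.1.ne']; field_simp [ht.1.ne']
      calc t * E t ≤ t * (B * t ^ (m - 1)) := mul_le_mul_of_nonneg_left h1 ht.1.le
        _ = B * t ^ m := by rw [h3]; ring
        _ ≤ _ := by gcongr
    have hle : ∀ t ∈ Ioc 0 T, t * E t ≤ S := fun t ht => le_csSup hbdd ⟨t, ht, rfl⟩
    have hS0 : 0 ≤ S := (mul_nonneg hT.le (hE0 T)).trans (hle T ⟨hT, le_rfl⟩)
    have hstep : S ≤ 1 + (c₁ * (4 / 3) + 2 * S * (1 / 4)) := by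
      refine csSup_le ⟨_, ⟨T, ⟨hT, le_rfl⟩, rfl⟩⟩ ?_
      rintro _ ⟨t, ht, rfl⟩
      have hm1 := mul_le_mul_of_nonneg_left (hmain t ht) ht.1.le
      have hr0 : t * |r₀ t| ≤ 1 := by
        have := mul_le_mul_of_nonneg_left (hr₀t t ht) ht.1.le
        rwa [mul_one_div_cancel ht.1.ne'] at this
      have hcv : t * ∫ y in (0 : ℝ)..t, κ (t - y) * E y ≤ c₁ * (4 / 3) + 2 * S * (1 / 4) := by
        have iEt : IntervalIntegrable E volume 0 t := by
          rw [intervalIntegrable_iff_integrableOn_Ioc_of_le ht.1.le]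
          exact iE.mono_set (Ioc_subset_Ioc_right ht.2)
        have iκt : IntervalIntegrable (fun y => κ (t - y)) volume 0 t := by
          have h0 : IntervalIntegrable κ volume (t - 0) (t - t) := by
            rw [sub_self, sub_zero]
            refine IntervalIntegrable.symm ?_
            rw [intervalIntegrable_iff_integrableOn_Ioc_of_le ht.1.le]
            exact hκi.mono_set fun y hy => hy.1
          simpa using h0.comp_sub_left t
        have h1 : t * ∫ y in (0 : ℝ)..t, κ (t - y) * E y ≤
            ∫ y in (0 : ℝ)..t, (c₁ * E y + 2 * S * κ (t - y)) := by
          rw [← intervalIntegral.integral_const_mul]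
          refine intervalIntegral.integral_mono_on_of_le_Ioo ht.1.le ((iκE t ht).const_mul _)
            ((iEt.const_mul _).add (iκt.const_mul _)) fun y hy => ?_
          have hty : 0 < t - y := sub_pos.2 hy.2
          have p1 := hκ0 (t - y) hty.le
          have p2 := hE0 y
          rcases le_total y (t / 2) with h | h
          · have h3 := rpow_le_of_half_le (a := a) ht.1 (show t / 2 ≤ t - y by linarith)
              (by linarith [hy.1])
            have h4 := hκC (t - y) ⟨hty, by linarith [hy.1, ht.2]⟩
            rw [abs_of_nonneg p1] at h4
            have h5 : t ^ a ≤ T ^ a := Real.rpow_le_rpow ht.1.le ht.2 ha.le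
            have h6 : t ^ a = t * t ^ (a - 1) := by
              rw [Real.rpow_sub_one ht.1.ne']; field_simp [ht.1.ne']
            have h7 : t * κ (t - y) ≤ c₁ := by
              have ht0 := ht.1.le
              calc t * κ (t - y) ≤ t * (C * ((1 + 2 ^ (1 - a)) * t ^ (a - 1))) :=
                    mul_le_mul_of_nonneg_left (h4.trans (mul_le_mul_of_nonneg_left h3 hC)) ht0
                _ = C * (1 + 2 ^ (1 - a)) * t ^ a := by rw [h6]; ring
                _ ≤ _ := by rw [hc₁]; gcongr
            have h8 := mul_le_mul_of_nonneg_right h7 p2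
            have h9 : 0 ≤ 2 * S * κ (t - y) := by positivity
            linarith
          · have h3 := hle y ⟨hy.1, hy.2.le.trans ht.2⟩
            have h4 : t * E y ≤ 2 * S := by nlinarith
            have h5 := mul_le_mul_of_nonneg_left h4 p1
            have h6 : 0 ≤ c₁ * E y := by positivity
            linarith
        rw [intervalIntegral.integral_add (iEt.const_mul _) (iκt.const_mul _),
          intervalIntegral.integral_const_mul, intervalIntegral.integral_const_mul] at h1
        have h2 : ∫ y in (0 : ℝ)..t, E y ≤ 4 / 3 := by
          refine le_trans ?_ hNle
          rw [intervalIntegral.integral_of_le ht.1.le]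
          exact setIntegral_mono_set iE (Eventually.of_forall hE0)
            (Ioc_subset_Ioc_right ht.2).eventuallyLE
        have h3 : ∫ y in (0 : ℝ)..t, κ (t - y) ≤ 1 / 4 := by
          refine le_trans ?_ hκ
          rw [intervalIntegral.integral_comp_sub_left (fun y => κ y) t, sub_self, sub_zero,
            intervalIntegral.integral_of_le ht.1.le]
          refine setIntegral_mono_set hκi ((ae_restrict_iff' measurableSet_Ioi).2
            (Eventually.of_forall fun z hz => hκ0 z (le_of_lt hz)))
            (Eventually.of_forall fun y (hy : y ∈ Ioc 0 t) => hy.1)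
        have h4 := mul_le_mul_of_nonneg_left h2 hc₁0
        have h5 := mul_le_mul_of_nonneg_left h3 (show 0 ≤ 2 * S by positivity)
        linarith
      simp only
      linarith
    intro t ht
    linarith [hle t ht]
  have hrE : ∀ t ∈ Ioc 0 T, |r t| ≤ Real.exp (R * T) * E t := by
    intro t ht
    have h1 : |r t| = Real.exp (R * t) * E t := by
      simp only [hE]
      rw [← mul_assoc, ← Real.exp_add, add_neg_cancel, Real.exp_zero, one_mul]
    rw [h1]
    have := hE0 t
    have := ht.2
    gcongr
  refine ⟨fun t ht => ?_, fun t ht => ?_⟩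
  · rw [le_div_iff₀ ht.1]
    have h1 := hrE t ht
    have h2 := mul_le_mul_of_nonneg_left (hsup t ht) (Real.exp_pos (R * T)).le
    nlinarith [ht.1]
  · rw [intervalIntegral.integral_of_le ht.1.le]
    have h1 : ∫ y in Ioc 0 t, |r y| ≤ ∫ y in Ioc 0 t, Real.exp (R * T) * E y := by
      have iEt := (iE.mono_set (Ioc_subset_Ioc_right ht.2)).const_mul (Real.exp (R * T))
      refine (le_abs_self _).trans ?_
      rw [← Real.norm_eq_abs]
      refine norm_integral_le_of_norm_le iEt ?_
      refine (ae_restrict_iff' measurableSet_Ioc).2 (Eventually.of_forall fun y hy => ?_)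
      rw [Real.norm_eq_abs, abs_abs]
      exact hrE y ⟨hy.1, hy.2.trans ht.2⟩
    rw [integral_const_mul] at h1
    have h2 : ∫ y in Ioc 0 t, E y ≤ 4 / 3 :=
      (setIntegral_mono_set iE (Eventually.of_forall hE0)
        (Ioc_subset_Ioc_right ht.2).eventuallyLE).trans hNle
    refine h1.trans (mul_le_mul_of_nonneg_left ?_ (Real.exp_pos _).le)
    have : 0 ≤ c₁ * (4 / 3) := by positivity
    linarith

/-- Subtracting `1` removes the constant term of the binomial series, so the remaining exponents
start at `ρ > 0`. -/
theorem exists_hasSymbol_rpow_sub_one {ρ : ℝ} (hρ : 0 < ρ) (γ ω : ℝ) :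
    ∃ w, HasSymbol w ρ (fun s => (1 - ω * s ^ (-ρ)) ^ γ - 1) := by
  have hev := (eventually_gt_atTop 0).and
    ((tendsto_mul_rpow_neg |ω| hρ).eventually_lt_const one_pos)
  obtain ⟨s₀, hs₀⟩ := eventually_atTop.1 hev
  set c : ℝ → ℝ → ℕ → ℝ := fun γ' ω' k =>
    (ascPochhammer ℝ (k + 1)).eval γ' / ((k + 1).factorial : ℝ) * ω' ^ (k + 1) with hc
  have key : ∀ γ' ω' : ℝ, |ω'| = |ω| → ∀ s, s₀ ≤ s → HasSum (fun k : ℕ =>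
      c γ' ω' k * s ^ (-(ρ * (k + 1)))) ((1 - ω' * s ^ (-ρ)) ^ (-γ') - 1) := by
    intro γ' ω' hω s hs
    obtain ⟨h1, h2⟩ := hs₀ s hs
    have h3 := hasSum_ascPochhammer_mul_pow γ' (x := ω' * s ^ (-ρ))
      (by rwa [abs_mul, abs_of_nonneg (Real.rpow_nonneg h1.le _), hω])
    rw [← hasSum_nat_add_iff' 1] at h3
    simp only [Finset.range_one, Finset.sum_singleton, ascPochhammer_zero, Polynomial.eval_one,
      Nat.factorial_zero, Nat.cast_one, div_one, pow_zero, mul_one] at h3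
    convert! h3 using 1
    ext k
    have e1 : s ^ (-(ρ * (k + 1))) = (s ^ (-ρ)) ^ (k + 1) := by
      rw [← Real.rpow_natCast, ← Real.rpow_mul h1.le]; congr 1; push_cast; ring
    simp only [hc]
    rw [e1, mul_pow]; ring
  have hs0 := (hs₀ s₀ le_rfl).1
  refine ⟨fun t => ∑' k : ℕ, c (-γ) ω k * powerKernel (ρ * (k + 1)) t, ℕ, inferInstance, _, _, s₀,
    ⟨hρ, hs0, fun k => ?_, ?_⟩, fun t _ => rfl, fun s hs => ?_⟩
  · have : 0 ≤ ρ * k := by positivity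
    linarith
  · refine Summable.of_nonneg_of_le (fun k => by positivity) (fun k => ?_)
      (key |γ| |ω| (abs_abs _) s₀ le_rfl).summable
    refine mul_le_mul_of_nonneg_right ?_ (by positivity)
    simp only [hc]
    rw [abs_mul, abs_div, Nat.abs_cast, abs_pow]
    have := abs_ascPochhammer_eval_le (abs_neg γ).le (k + 1)
    gcongr
  · have := (key (-γ) ω rfl s hs).tsum_eq
    rw [neg_neg] at this
    exact this.symm

/-! ### Bounds for the resolvents uniform in the spectral parameter -/

section Uniform

variable {γ ρ μ ω : ℝ} (hρ : 0 < ρ) (hμ : μ ∈ Ioo (0 : ℝ) 1) (hγ : 0 ≤ γ)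
include hρ hμ hγ

theorem hasSymbol_resolvent (l : ℝ) :
    HasSymbol (fun t => l * prabhakarResolvent γ ρ μ ω γ μ l t) μ
      (fun s => l * (s ^ (-μ) * (1 - ω * s ^ (-ρ)) ^ (-γ) /
        (1 + l * s ^ (-μ) * (1 - ω * s ^ (-ρ)) ^ (-γ)))) :=
  (hasSymbol_prabhakarResolvent hρ hμ.1 hμ.1 hγ hγ l).smul l

/-- Perturbation from `γ = 0`. Let `r₀` be the resolvent for `γ = 0` and `w` the function with
symbol `A^γ - 1`, where `A = 1 - ω s^(-ρ)`. Then `r = r₀ - (w - r₀ ⋆ w) ⋆ r`, and the bounds on `r₀`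
make `w - r₀ ⋆ w` of size `t^(ρ-1)` with a constant free of `l`. -/
theorem exists_resolvent_bound {T : ℝ} (hT : 0 < T) : ∃ M, 0 ≤ M ∧ ∀ l, 0 ≤ l →
    (∀ t ∈ Ioc 0 T, |l * prabhakarResolvent γ ρ μ ω γ μ l t| ≤ M / t) ∧
    ∀ t ∈ Ioc 0 T, ∫ y in (0 : ℝ)..t, |l * prabhakarResolvent γ ρ μ ω γ μ l y| ≤ M := by
  obtain ⟨w, hw⟩ := exists_hasSymbol_rpow_sub_one hρ γ ω
  obtain ⟨C, hC0, hC⟩ := hw.exists_bound T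
  -- The first term bounds `w`, the second bounds `r₀ ⋆ w` by `integral_conv_le_of_bound` with `M =
  -- 1`.
  set C₁ := C + C * 1 * (1 + 2 ^ (1 - ρ) + 2 / ρ) with hC₁
  have hC₁0 : 0 ≤ C₁ := by positivity
  obtain ⟨M, hM0, hM⟩ := exists_volterra_bound hT hC₁0 hρ
  refine ⟨M, hM0, fun l hl => ?_⟩
  set f := prabhakarResolvent 0 ρ μ ω 0 μ l with hfdef
  have hf : HasSymbol f μ (fun s => s ^ (-μ) / (1 + l * s ^ (-μ))) :=
    (hasSymbol_prabhakarResolvent hρ hμ.1 hμ.1 le_rfl le_rfl l).congr (fun _ _ => rfl)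
      (Eventually.of_forall fun s => by simp)
  have hr₀ := hf.smul l
  have hr := hasSymbol_resolvent (ω := ω) hρ hμ hγ l
  have hfpos : ∀ t, 0 < t → 0 ≤ l * f t := fun t ht =>
    mul_nonneg hl (relaxation_pos hμ hl hf ht).le
  have hr₀i : ∀ t, 0 < t → ∫ y in (0 : ℝ)..t, |l * f y| ≤ 1 := by
    intro t ht
    have h1 : ∫ y in (0 : ℝ)..t, |l * f y| = ∫ y in (0 : ℝ)..t, l * f y := by
      rw [intervalIntegral.integral_of_le ht.le, intervalIntegral.integral_of_le ht.le]
      exact setIntegral_congr_fun measurableSet_Ioc fun y hy => abs_of_nonneg (hfpos y hy.1)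
    rw [h1, intervalIntegral.integral_const_mul]
    exact mul_integral_relaxation_le_one hμ hl hf ht
  have hr₀t : ∀ t, 0 < t → |l * f t| ≤ 1 / t := by
    intro t ht
    rw [abs_of_nonneg (hfpos t ht), le_div_iff₀ ht]
    have h1 := mul_relaxation_le_integral hμ hl hf ht
    have h2 := mul_integral_relaxation_le_one hμ hl hf ht
    have h3 := mul_le_mul_of_nonneg_left h1 hl
    have h4 : μ * (l * ∫ y in (0 : ℝ)..t, f y) ≤ μ * 1 := mul_le_mul_of_nonneg_left h2 hμ.1.le
    linarith [hμ.2]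
  have hcv := hr₀.conv hw
  have hw₁ : HasSymbol (fun t => w t - ∫ y in (0 : ℝ)..t, l * f (t - y) * w y) ρ _ :=
    hw.sub (hcv.weaken hρ (by linarith [hμ.1]))
  obtain ⟨B, -, hB⟩ := hr.exists_bound T
  refine hM _ (fun t => l * f t) (fun t => w t - ∫ y in (0 : ℝ)..t, l * f (t - y) * w y) B μ hμ.1
    hr.continuousOn (hr₀.intervalIntegrable hT.le) ?_ (fun t ht => hr₀t t ht.1) (hr₀i T hT) hB ?_
  · intro t ht
    have h1 : ∫ y in (0 : ℝ)..t, l * f (t - y) * w y = ∫ y in (0 : ℝ)..t, w (t - y) * (l * f y) := by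
      have := intervalIntegral.integral_comp_sub_left (a := 0) (b := t)
        (fun y => l * f (t - y) * w y) t
      rw [sub_self, sub_zero] at this
      rw [← this]
      refine intervalIntegral.integral_congr fun y _ => ?_
      simp only [sub_sub_cancel]; ring
    have h2 := integral_conv_le_of_bound (M := 1) hρ hC0 zero_le_one ht.1
      (fun y hy => hC y ⟨hy.1, hy.2.trans ht.2⟩) (fun y hy => hr₀t y hy.1)
      (hr₀.intervalIntegrable ht.1.le) (hr₀i t ht.1)
    have h3 : |∫ y in (0 : ℝ)..t, w (t - y) * (l * f y)| ≤
        ∫ y in (0 : ℝ)..t, |w (t - y) * (l * f y)| :=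
      intervalIntegral.abs_integral_le_integral_abs ht.1.le
    rw [h1]
    refine (abs_sub _ _).trans ?_
    have h4 := hC t ht
    rw [hC₁, add_mul]
    linarith
  · intro t ht
    refine hr.eqOn ((hr₀.sub ((hw₁.conv hr).weaken hμ.1 (by linarith)))) ?_ ht.1
    filter_upwards [eventually_gt_atTop 0, eventually_one_sub_mul_rpow_pos ω hρ] with s hs hA
    have hx := Real.rpow_pos_of_pos hs (-μ)
    have hAγ := Real.rpow_pos_of_pos hA γ
    rw [Real.rpow_neg hA.le]
    set x := s ^ (-μ)
    set y := (1 - ω * s ^ (-ρ)) ^ γ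
    have h1 : 1 + l * x ≠ 0 := by positivity
    have h2 : 1 + l * x * y⁻¹ ≠ 0 := by positivity
    have h3 : y + l * x ≠ 0 := by positivity
    have h4 : 1 + l * x * y⁻¹ = (y + l * x) / y := by field_simp
    rw [h4]
    field_simp
    ring

/-- Splitting off the resolvent: `∑ₙ (-l)ⁿ e_n = e_0 - e_0 ⋆ r`. -/
theorem prabhakarResolvent_eq_sub_conv {a b : ℝ} (ha : 0 ≤ a) (hb : 0 < b) {l : ℝ} (hl : 0 ≤ l)
    {t : ℝ} (ht : 0 < t) : prabhakarResolvent γ ρ μ ω a b l t = prabhakarKernel a ρ b ω t -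
      ∫ y in (0 : ℝ)..t, prabhakarKernel a ρ b ω (t - y) *
        (l * prabhakarResolvent γ ρ μ ω γ μ l y) := by
  have hr := hasSymbol_resolvent (ω := ω) hρ hμ hγ l
  have hk := hasSymbol_prabhakarKernel hρ hb a ω
  refine (hasSymbol_prabhakarResolvent hρ hμ.1 hb hγ ha l).eqOn
    (hk.sub ((hk.conv hr).weaken hb (by linarith [hμ.1]))) ?_ ht
  filter_upwards [eventually_gt_atTop 0, eventually_one_sub_mul_rpow_pos ω hρ] with s hs hA
  have hx := Real.rpow_pos_of_pos hs (-μ)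
  have hAγ := Real.rpow_pos_of_pos hA (-γ)
  have h2 : 1 + l * s ^ (-μ) * (1 - ω * s ^ (-ρ)) ^ (-γ) ≠ 0 := by positivity
  field_simp
  ring

/-- Termwise estimation of the alternating series would grow with `l`; splitting off the resolvent
leaves only the fixed kernel and quantities bounded uniformly in `l`. -/
theorem exists_prabhakarResolvent_bound {a b : ℝ} (ha : 0 ≤ a) (hb : 0 < b) {T : ℝ} (hT : 0 < T) :
    ∃ C, 0 ≤ C ∧ ∀ l, 0 ≤ l → ∀ t ∈ Ioc 0 T,
      |prabhakarResolvent γ ρ μ ω a b l t| ≤ C * t ^ (b - 1) := by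
  obtain ⟨M, hM0, hM⟩ := exists_resolvent_bound (ω := ω) hρ hμ hγ hT
  obtain ⟨C, hC0, hC⟩ := (hasSymbol_prabhakarKernel hρ hb a ω).exists_bound T
  refine ⟨C + C * M * (1 + 2 ^ (1 - b) + 2 / b), by positivity, fun l hl t ht => ?_⟩
  have hr := hasSymbol_resolvent (ω := ω) hρ hμ hγ l
  obtain ⟨h1, h2⟩ := hM l hl
  have h3 := integral_conv_le_of_bound hb hC0 hM0 ht.1 (fun y hy => hC y ⟨hy.1, hy.2.trans ht.2⟩)
    (fun y hy => h1 y ⟨hy.1, hy.2.trans ht.2⟩) (hr.intervalIntegrable ht.1.le) (h2 t ht)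
  have h4 : |∫ y in (0 : ℝ)..t, prabhakarKernel a ρ b ω (t - y) *
      (l * prabhakarResolvent γ ρ μ ω γ μ l y)| ≤ _ :=
    (intervalIntegral.abs_integral_le_integral_abs ht.1.le).trans h3
  rw [prabhakarResolvent_eq_sub_conv hρ hμ hγ ha hb hl ht.1]
  refine (abs_sub _ _).trans ?_
  have h5 := hC t ht
  rw [add_mul]
  linarith

end Uniform

/-! ### Action of the fractional operators on the solution multiplier -/

section Diffusion

variable {γ ρ μ ν ω : ℝ} (hρ : 0 < ρ) (hμ : μ ∈ Ioo (0 : ℝ) 1) (hγ : 0 ≤ γ)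

theorem diffusion_exponent_pos (hμ : μ ∈ Ioo (0 : ℝ) 1) (hν : ν ∈ Icc (0 : ℝ) 1) :
    0 < μ - ν * (μ - 1) := by
  nlinarith [hμ.1, hμ.2, hν.1]

include hρ hμ hγ

theorem kernel_outer_conv_resolvent (hν0 : 0 < ν) (hν : ν ∈ Icc (0 : ℝ) 1) {l : ℝ} (hl : 0 ≤ l)
    {t : ℝ} (ht : 0 < t) :
    ∫ y in (0 : ℝ)..t, prabhakarKernel (-(γ * ν)) ρ (ν * (1 - μ)) ω (t - y) *
      (l * prabhakarResolvent γ ρ μ ω γ μ l y) =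
    l * prabhakarResolvent γ ρ μ ω (γ * (1 - ν)) (μ - ν * (μ - 1)) l t := by
  have hc : 0 < ν * (1 - μ) := mul_pos hν0 (sub_pos.2 hμ.2)
  have hr := hasSymbol_resolvent (ω := ω) hρ hμ hγ l
  have hk := hasSymbol_prabhakarKernel hρ hc (-(γ * ν)) ω
  have hb := diffusion_exponent_pos hμ hν
  have ha : 0 ≤ γ * (1 - ν) := mul_nonneg hγ (sub_nonneg.2 hν.2)
  refine (hk.conv hr).eqOn ((hasSymbol_prabhakarResolvent hρ hμ.1 hb hγ ha l).smul l) ?_ ht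
  filter_upwards [eventually_gt_atTop 0, eventually_one_sub_mul_rpow_pos ω hρ] with s hs hA
  have hx := Real.rpow_pos_of_pos hs (-μ)
  have hAγ := Real.rpow_pos_of_pos hA (-γ)
  have h2 : 1 + l * s ^ (-μ) * (1 - ω * s ^ (-ρ)) ^ (-γ) ≠ 0 := by positivity
  have e1 : s ^ (-(μ - ν * (μ - 1))) = s ^ (-(ν * (1 - μ))) * s ^ (-μ) := by
    rw [← Real.rpow_add hs]; congr 1; ring
  have e2 : (1 - ω * s ^ (-ρ)) ^ (-(γ * (1 - ν))) =
      (1 - ω * s ^ (-ρ)) ^ (-(-(γ * ν))) * (1 - ω * s ^ (-ρ)) ^ (-γ) := by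
    rw [← Real.rpow_add hA]; congr 1; ring
  rw [e1, e2]
  field_simp

theorem one_sub_integral_resolvent_eq {f : ℝ → ℝ} {b : ℝ} {l : ℝ} (hl : 0 ≤ l)
    (hf : HasSymbol f b (fun s => s⁻¹ / (1 + l * s ^ (-μ) * (1 - ω * s ^ (-ρ)) ^ (-γ)))) {t : ℝ}
    (ht : 0 < t) :
    f t = 1 - ∫ y in (0 : ℝ)..t, l * prabhakarResolvent γ ρ μ ω γ μ l y := by
  have hr := hasSymbol_resolvent (ω := ω) hρ hμ hγ l
  have h1 := (hasSymbol_one.conv hr).congr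
    (g := fun t => ∫ y in (0 : ℝ)..t, l * prabhakarResolvent γ ρ μ ω γ μ l y)
    (fun t _ => by simp only [one_mul]) (Eventually.of_forall fun s => rfl)
  refine hf.eqOn (hasSymbol_one.sub (h1.weaken one_pos (by linarith [hμ.1]))) ?_ ht
  filter_upwards [eventually_gt_atTop 0, eventually_one_sub_mul_rpow_pos ω hρ] with s hs hA
  have hx := Real.rpow_pos_of_pos hs (-μ)
  have hAγ := Real.rpow_pos_of_pos hA (-γ)
  have h2 : 1 + l * s ^ (-μ) * (1 - ω * s ^ (-ρ)) ^ (-γ) ≠ 0 := by positivity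
  field_simp
  ring

theorem kernel_inner_conv_diffusion (hν1 : ν < 1) (hν : ν ∈ Icc (0 : ℝ) 1) {l : ℝ} (hl : 0 ≤ l)
    {t : ℝ} (ht : 0 < t) :
    ∫ y in (0 : ℝ)..t, prabhakarKernel (-(γ * (1 - ν))) ρ ((1 - ν) * (1 - μ)) ω (t - y) *
      prabhakarResolvent γ ρ μ ω (γ * (1 - ν)) (μ - ν * (μ - 1)) l y =
    1 - ∫ y in (0 : ℝ)..t, l * prabhakarResolvent γ ρ μ ω γ μ l y := by
  have hc : 0 < (1 - ν) * (1 - μ) := mul_pos (sub_pos.2 hν1) (sub_pos.2 hμ.2)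
  have hk := hasSymbol_prabhakarKernel hρ hc (-(γ * (1 - ν))) ω
  have hb := diffusion_exponent_pos hμ hν
  have ha : 0 ≤ γ * (1 - ν) := mul_nonneg hγ (sub_nonneg.2 hν.2)
  refine one_sub_integral_resolvent_eq (ω := ω) hρ hμ hγ hl
    ((hk.conv (hasSymbol_prabhakarResolvent hρ hμ.1 hb hγ ha l)).congr (fun _ _ => rfl) ?_) ht
  filter_upwards [eventually_gt_atTop 0, eventually_one_sub_mul_rpow_pos ω hρ] with s hs hA
  have e1 : s ^ (-((1 - ν) * (1 - μ))) * s ^ (-(μ - ν * (μ - 1))) = s⁻¹ := by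
    rw [← Real.rpow_add hs, ← Real.rpow_neg_one]; congr 1; ring
  have e2 : (1 - ω * s ^ (-ρ)) ^ (-(-(γ * (1 - ν)))) * (1 - ω * s ^ (-ρ)) ^ (-(γ * (1 - ν))) = 1 := by
    rw [← Real.rpow_add hA, neg_neg, add_neg_cancel, Real.rpow_zero]
  rw [mul_comm (s ^ (-(μ - ν * (μ - 1)))), mul_div_assoc, ← mul_div_assoc, ← mul_div_assoc]
  congr 1
  linear_combination (s ^ (-((1 - ν) * (1 - μ))) * s ^ (-(μ - ν * (μ - 1)))) * e2 + e1

theorem diffusion_eq_of_order_one {l : ℝ} (hl : 0 ≤ l) {t : ℝ} (ht : 0 < t) :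
    prabhakarResolvent γ ρ μ ω (γ * (1 - 1)) (μ - 1 * (μ - 1)) l t =
    1 - ∫ y in (0 : ℝ)..t, l * prabhakarResolvent γ ρ μ ω γ μ l y := by
  refine one_sub_integral_resolvent_eq (ω := ω) hρ hμ hγ hl ((hasSymbol_prabhakarResolvent hρ hμ.1
    (diffusion_exponent_pos hμ (by simp)) hγ (by simp) l).congr (fun _ _ => rfl) ?_) ht
  filter_upwards with s
  simp [Real.rpow_neg_one]

/-- This allows two space derivatives when `K > 0` without decay of `p² ĝ`. For `ν > 0` the function
is the outer kernel convolved with the resolvent, hence `O(t^(c-1))` with `c = ν(1 - μ)`; for `ν =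
0` it is the resolvent itself. -/
theorem exists_mul_diffusion_bound (hν : ν ∈ Icc (0 : ℝ) 1) {T : ℝ} (hT : 0 < T) :
    ∃ M, 0 ≤ M ∧ ∀ l, 0 ≤ l → (∀ t ∈ Ioc 0 T,
      |l * prabhakarResolvent γ ρ μ ω (γ * (1 - ν)) (μ - ν * (μ - 1)) l t| ≤ M / t) ∧
    ∀ t ∈ Ioc 0 T, ∫ y in (0 : ℝ)..t,
      |l * prabhakarResolvent γ ρ μ ω (γ * (1 - ν)) (μ - ν * (μ - 1)) l y| ≤ M := by
  rcases hν.1.eq_or_lt with rfl | hν0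
  · simpa using exists_resolvent_bound (ω := ω) hρ hμ hγ hT
  have hc : 0 < ν * (1 - μ) := mul_pos hν0 (sub_pos.2 hμ.2)
  obtain ⟨M, hM0, hM⟩ := exists_resolvent_bound (ω := ω) hρ hμ hγ hT
  obtain ⟨C, hC0, hC⟩ := (hasSymbol_prabhakarKernel hρ hc (-(γ * ν)) ω).exists_bound T
  set c := ν * (1 - μ) with hcdef
  set C₁ := C * M * (1 + 2 ^ (1 - c) + 2 / c) with hC₁
  have hC₁0 : 0 ≤ C₁ := by positivity
  have hb := diffusion_exponent_pos hμ hν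
  have ha : 0 ≤ γ * (1 - ν) := mul_nonneg hγ (sub_nonneg.2 hν.2)
  have key : ∀ l, 0 ≤ l → ∀ t ∈ Ioc 0 T,
      |l * prabhakarResolvent γ ρ μ ω (γ * (1 - ν)) (μ - ν * (μ - 1)) l t| ≤ C₁ * t ^ (c - 1) := by
    intro l hl t ht
    have hr := hasSymbol_resolvent (ω := ω) hρ hμ hγ l
    obtain ⟨h1, h2⟩ := hM l hl
    have h3 := integral_conv_le_of_bound hc hC0 hM0 ht.1 (fun y hy => hC y ⟨hy.1, hy.2.trans ht.2⟩)
      (fun y hy => h1 y ⟨hy.1, hy.2.trans ht.2⟩) (hr.intervalIntegrable ht.1.le) (h2 t ht)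
    rw [← kernel_outer_conv_resolvent hρ hμ hγ hν0 hν hl ht.1]
    exact (intervalIntegral.abs_integral_le_integral_abs ht.1.le).trans h3
  -- `T^c` converts `t^(c-1)` into `1/t`, and `T^c / c` is the integral of `t^(c-1)` up to `T`.
  refine ⟨C₁ * T ^ c * (1 + 1 / c), by positivity, fun l hl => ⟨fun t ht => ?_, fun t ht => ?_⟩⟩
  · refine (key l hl t ht).trans ?_
    rw [le_div_iff₀ ht.1, mul_assoc, ← Real.rpow_add_one ht.1.ne', sub_add_cancel]
    have h1 : t ^ c ≤ T ^ c := Real.rpow_le_rpow ht.1.le ht.2 hc.le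
    have h2 : 0 ≤ C₁ * T ^ c * (1 / c) := by positivity
    have h3 := mul_le_mul_of_nonneg_left h1 hC₁0
    linarith
  · have i1 : IntervalIntegrable (fun y : ℝ => C₁ * y ^ (c - 1)) volume 0 t :=
      (intervalIntegral.intervalIntegrable_rpow' (by linarith)).const_mul C₁
    have i2 := ((hasSymbol_prabhakarResolvent (ω := ω) hρ hμ.1 hb hγ ha l).smul l).intervalIntegrable ht.1.le
    have h1 := intervalIntegral.integral_mono_on_of_le_Ioo ht.1.le i2.abs i1 fun y hy =>
      key l hl y ⟨hy.1, hy.2.le.trans ht.2⟩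
    rw [intervalIntegral.integral_const_mul, integral_rpow (Or.inl (by linarith)), sub_add_cancel,
      Real.zero_rpow hc.ne', sub_zero] at h1
    refine h1.trans ?_
    have h3 : t ^ c ≤ T ^ c := Real.rpow_le_rpow ht.1.le ht.2 hc.le
    have h4 : C₁ * (t ^ c / c) ≤ C₁ * (T ^ c / c) := by gcongr
    have h5 : 0 ≤ C₁ * T ^ c := by positivity
    calc _ ≤ C₁ * (T ^ c / c) := h4
      _ = C₁ * T ^ c * (1 / c) := by ring
      _ ≤ _ := by linarith

end Diffusion

/-! ### Absolutely continuous complex primitives -/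

theorem AbsolutelyContinuousOnInterval.of_dist_le_add {X Y Z : Type*} [PseudoMetricSpace X]
    [PseudoMetricSpace Y] [PseudoMetricSpace Z] {A : ℝ → X} {B : ℝ → Y} {F : ℝ → Z} {a b : ℝ}
    (hA : AbsolutelyContinuousOnInterval A a b) (hB : AbsolutelyContinuousOnInterval B a b)
    (h : ∀ x y, dist (F x) (F y) ≤ dist (A x) (A y) + dist (B x) (B y)) :
    AbsolutelyContinuousOnInterval F a b := by
  unfold AbsolutelyContinuousOnInterval at *
  have := hA.add hB
  rw [add_zero] at this
  refine squeeze_zero (fun E => Finset.sum_nonneg fun _ _ => dist_nonneg) (fun E => ?_) this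
  rw [← Finset.sum_add_distrib]
  exact Finset.sum_le_sum fun i _ => h _ _

theorem IntervalIntegrable.exists_absolutelyContinuous {f : ℝ → ℂ} {b : ℝ} (hb : 0 < b)
    (hf : IntervalIntegrable f volume 0 b) (c : ℂ) : ∃ F : ℝ → ℂ,
      AbsolutelyContinuousOnInterval F 0 b ∧ ∀ t ∈ Icc 0 b, F t = c - ∫ y in (0 : ℝ)..t, f y := by
  have hf' := (intervalIntegrable_iff_integrableOn_Ioc_of_le hb.le).1 hf
  have hre : IntervalIntegrable (fun y => (f y).re) volume 0 b :=
    (intervalIntegrable_iff_integrableOn_Ioc_of_le hb.le).2 hf'.re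
  have him : IntervalIntegrable (fun y => (f y).im) volume 0 b :=
    (intervalIntegrable_iff_integrableOn_Ioc_of_le hb.le).2 hf'.im
  have hA := hre.absolutelyContinuousOnInterval_intervalIntegral (c := 0) left_mem_uIcc
  have hB := him.absolutelyContinuousOnInterval_intervalIntegral (c := 0) left_mem_uIcc
  refine ⟨fun t => c - (((∫ y in (0 : ℝ)..t, (f y).re : ℝ) : ℂ) +
    ((∫ y in (0 : ℝ)..t, (f y).im : ℝ) : ℂ) * Complex.I), hA.of_dist_le_add hB fun x y => ?_, ?_⟩
  · rw [dist_sub_left]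
    refine (dist_add_add_le _ _ _ _).trans ?_
    rw [dist_eq_norm (_ * Complex.I), ← sub_mul, norm_mul, Complex.norm_I, mul_one, ← dist_eq_norm,
      Complex.dist_of_im_eq (by simp), Complex.dist_of_im_eq (by simp)]
    simp
  · intro t ht
    have hft : IntervalIntegrable f volume 0 t := hf.mono_set (by
      rw [uIcc_of_le ht.1, uIcc_of_le hb.le]; exact Icc_subset_Icc_right ht.2)
    rw [intervalIntegrable_iff_integrableOn_Ioc_of_le ht.1] at hft
    simp only [intervalIntegral.integral_of_le ht.1]
    congr 1
    have h1 : ∫ y in Ioc 0 t, (f y).re = (∫ y in Ioc 0 t, f y).re := integral_re hft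
    have h2 : ∫ y in Ioc 0 t, (f y).im = (∫ y in Ioc 0 t, f y).im := integral_im hft
    rw [h1, h2, Complex.re_add_im]

/-! ### Inverse Fourier integrals and time-dependent multipliers -/

/-- `(1 / 2π) ∫ e^{ipx} h(p) dp`. -/
noncomputable def fourierInverse (h : ℝ → ℂ) (x : ℝ) : ℂ :=
  1 / (2 * (Real.pi : ℂ)) * ∫ p : ℝ, Complex.exp (Complex.I * p * x) * h p

theorem norm_exp_I_mul (p x : ℝ) : ‖Complex.exp (Complex.I * p * x)‖ = 1 := by
  rw [mul_assoc, ← Complex.ofReal_mul, mul_comm, Complex.norm_exp_ofReal_mul_I]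

theorem integrable_exp_mul {h : ℝ → ℂ} (hh : Integrable h) (x : ℝ) :
    Integrable fun p : ℝ => Complex.exp (Complex.I * p * x) * h p :=
  hh.bdd_mul (c := 1) (by fun_prop) (Eventually.of_forall fun p => (norm_exp_I_mul p x).le)

theorem norm_fourierInverse_le (h : ℝ → ℂ) (x : ℝ) :
    ‖fourierInverse h x‖ ≤ ‖1 / (2 * (Real.pi : ℂ))‖ * ∫ p, ‖h p‖ := by
  rw [fourierInverse, norm_mul]
  refine mul_le_mul_of_nonneg_left ((norm_integral_le_integral_norm _).trans_eq ?_) (norm_nonneg _)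
  simp only [norm_mul, norm_exp_I_mul, one_mul]

theorem fourierInverse_eq_fourier (h : ℝ → ℂ) (x : ℝ) :
    fourierInverse h x = 1 / (2 * (Real.pi : ℂ)) * 𝓕 h (-(1 / (2 * Real.pi)) * x) := by
  rw [fourierInverse, Real.fourier_real_eq_integral_exp_smul]
  congr 2 with p
  rw [smul_eq_mul]
  congr 2
  have := Real.pi_ne_zero
  push_cast
  field_simp

theorem fourierInverse_fourierHat {g : ℝ → ℂ} (hc : Continuous g) (hi : Integrable g)
    (hh : Integrable (fourierHat g)) (x : ℝ) : fourierInverse (fourierHat g) x = g x := by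
  have h2π : (2 * Real.pi) ≠ 0 := by positivity
  have e : 𝓕 g = fun w => fourierHat g (2 * Real.pi * w) := by
    ext w
    rw [Real.fourier_real_eq_integral_exp_smul, fourierHat]
    congr 1 with v
    rw [smul_eq_mul]
    congr 2; push_cast; ring
  have hF : Integrable (𝓕 g) := by rw [e]; exact hh.comp_mul_left' h2π
  have h1 := congrFun (hc.fourierInv_fourier_eq hi hF) x
  rw [Real.fourierInv_eq', e] at h1
  rw [← h1, fourierInverse]
  have h3 := Measure.integral_comp_mul_left
    (fun p : ℝ => Complex.exp (Complex.I * p * x) * fourierHat g p) (2 * Real.pi)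
  have h4 : ∀ v : ℝ, Complex.exp (((2 * Real.pi * inner ℝ v x : ℝ) : ℂ) * Complex.I) •
      fourierHat g (2 * Real.pi * v) =
      Complex.exp (Complex.I * ((2 * Real.pi * v : ℝ) : ℂ) * x) * fourierHat g (2 * Real.pi * v) := by
    intro v
    rw [smul_eq_mul]
    congr 2
    simp only [RCLike.inner_apply, conj_trivial]
    push_cast; ring
  simp only [h4]
  rw [h3, abs_of_pos (by positivity), Complex.real_smul]
  push_cast
  rw [one_div]

theorem contDiff_fourierInverse {h : ℝ → ℂ} (h0 : Integrable h)
    (h2 : Integrable fun p : ℝ => ((p ^ 2 : ℝ) : ℂ) * h p) :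
    ContDiff ℝ 2 (fourierInverse h) ∧ ∀ x, iteratedDeriv 2 (fourierInverse h) x =
      -fourierInverse (fun p => ((p ^ 2 : ℝ) : ℂ) * h p) x := by
  have h1 : Integrable fun p : ℝ => (p : ℂ) * h p := by
    -- The first moment is controlled by the zeroth and second through `|p| ≤ 1 + p²`.
    refine (h0.norm.add h2.norm).mono' ((by fun_prop : AEStronglyMeasurable (fun p : ℝ => (p : ℂ))
      volume).mul h0.1) (Eventually.of_forall fun p => ?_)
    simp only [Pi.add_apply, norm_mul, Complex.norm_real, Real.norm_eq_abs, abs_pow]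
    have : |p| ≤ 1 + |p| ^ 2 := by nlinarith [sq_nonneg (|p| - 1)]
    nlinarith [norm_nonneg (h p)]
  have hn : ∀ n : ℕ, (n : ℕ∞) ≤ ((2 : ℕ) : ℕ∞) → Integrable fun x : ℝ => x ^ n • h x := by
    intro n hn
    have hn' : n ≤ 2 := by exact_mod_cast hn
    interval_cases n
    · simpa using h0
    · simpa [Complex.real_smul] using h1
    · simpa [Complex.real_smul] using h2
  have hc : ContDiff ℝ 2 (𝓕 h) := by
    have := Real.contDiff_fourier (f := h) (N := ((2 : ℕ) : ℕ∞)) fun n hnn => by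
      simpa [norm_smul] using (hn n hnn).norm
    exact_mod_cast this
  have hF : fourierInverse h = (1 / (2 * (Real.pi : ℂ))) • fun x : ℝ =>
      𝓕 h (-(1 / (2 * Real.pi)) * x) := by
    ext x; exact fourierInverse_eq_fourier h x
  have hcomp : ContDiff ℝ 2 fun x : ℝ => 𝓕 h (-(1 / (2 * Real.pi)) * x) :=
    hc.comp (contDiff_const.mul contDiff_id)
  refine ⟨by rw [hF]; exact (contDiff_const (c := 1 / (2 * (Real.pi : ℂ)))).mul hcomp, fun x => ?_⟩
  rw [hF, iteratedDeriv_const_smul_field, iteratedDeriv_comp_const_smul (n := 2) (by exact_mod_cast hc),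
    Real.iteratedDeriv_fourier (N := ((2 : ℕ) : ℕ∞)) hn le_rfl, fourierInverse_eq_fourier]
  beta_reduce
  rw [Real.fourier_real_eq_integral_exp_smul, Real.fourier_real_eq_integral_exp_smul, ← integral_smul,
    ← mul_neg, ← integral_neg, smul_eq_mul]
  congr 2 with p
  simp only [smul_eq_mul, Complex.real_smul]
  have : (Real.pi : ℂ) ≠ 0 := by exact_mod_cast Real.pi_ne_zero
  push_cast
  field_simp
  simp [Complex.I_sq]

theorem tendsto_fourierInverse_cocompact (h : ℝ → ℂ) :
    Tendsto (fourierInverse h) (cocompact ℝ) (𝓝 0) := by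
  have h1 : Tendsto (fun x : ℝ => -(1 / (2 * Real.pi)) * x) (cocompact ℝ) (cocompact ℝ) := by
    have hne : -(1 / (2 * Real.pi)) ≠ 0 := by
      have := Real.pi_ne_zero
      simp [this]
    exact (Homeomorph.mulLeft₀ _ hne).isClosedEmbedding.tendsto_cocompact
  have h2 := ((Real.zero_at_infty_fourier h).comp h1).const_mul (1 / (2 * (Real.pi : ℂ)))
  rw [mul_zero] at h2
  exact h2.congr fun x => (fourierInverse_eq_fourier h x).symm

/-- A family of real Fourier multipliers `m p t`, `t > 0`, continuous and, for `t` in a bounded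
interval, bounded by a power of `t` uniformly in `p`. -/
structure IsMultiplier (m : ℝ → ℝ → ℝ) : Prop where
  cont : ContinuousOn (fun q : ℝ × ℝ => m q.1 q.2) (univ ×ˢ Ioi 0)
  bound : ∀ T, 0 < T → ∃ C e : ℝ, 0 ≤ C ∧ ∀ p, ∀ t ∈ Ioc 0 T, |m p t| ≤ C * t ^ e

/-- The inverse Fourier integral of `ĝ(p) m(p, t)`. -/
noncomputable def multiplierIntegral (G : ℝ → ℂ) (m : ℝ → ℝ → ℝ) (x t : ℝ) : ℂ :=
  fourierInverse (fun p => G p * (m p t : ℂ)) x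

namespace IsMultiplier

variable {G : ℝ → ℂ} {m : ℝ → ℝ → ℝ}

theorem cont_left (hm : IsMultiplier m) {t : ℝ} (ht : 0 < t) : Continuous fun p => m p t := by
  rw [← continuousOn_univ]
  exact hm.cont.comp (f := fun p : ℝ => (p, t)) (by fun_prop) fun p _ => ⟨mem_univ _, ht⟩

theorem cont_right (hm : IsMultiplier m) (p : ℝ) : ContinuousOn (m p) (Ioi 0) :=
  hm.cont.comp (f := fun t : ℝ => (p, t)) (by fun_prop) fun t ht => ⟨mem_univ _, ht⟩

theorem integrable (hm : IsMultiplier m) (hG : Integrable G) {t : ℝ} (ht : 0 < t) :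
    Integrable fun p => G p * (m p t : ℂ) := by
  obtain ⟨C, e, -, hC⟩ := hm.bound t ht
  refine hG.mul_bdd (c := C * t ^ e)
    (Complex.continuous_ofReal.comp (hm.cont_left ht)).aestronglyMeasurable
    (Eventually.of_forall fun p => ?_)
  rw [Complex.norm_real]
  exact hC p t ⟨ht, le_rfl⟩

theorem locally_bounded (hm : IsMultiplier m) {t₁ : ℝ} (h1 : 0 < t₁) (t₂ : ℝ) :
    ∃ C, ∀ p, ∀ t ∈ Icc t₁ t₂, |m p t| ≤ C := by
  obtain ⟨C, e, hC0, hC⟩ := hm.bound (max t₁ t₂) (h1.trans_le (le_max_left _ _))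
  refine ⟨C * (t₁ ^ e + t₂ ^ e), fun p t ht => ?_⟩
  have ht0 : 0 < t := h1.trans_le ht.1
  refine (hC p t ⟨ht0, ht.2.trans (le_max_right _ _)⟩).trans (mul_le_mul_of_nonneg_left ?_ hC0)
  have p1 := Real.rpow_nonneg h1.le e
  have p2 := Real.rpow_nonneg (ht0.le.trans ht.2) e
  rcases le_total 0 e with he | he
  · linarith [Real.rpow_le_rpow ht0.le ht.2 he]
  · linarith [Real.rpow_le_rpow_of_nonpos h1 ht.1 he]

theorem continuousOn_multiplierIntegral (hm : IsMultiplier m) (hG : Integrable G) :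
    ContinuousOn (fun q : ℝ × ℝ => multiplierIntegral G m q.1 q.2) (univ ×ˢ Ioi 0) := by
  rintro ⟨x, t⟩ ⟨-, ht⟩
  have ht : 0 < t := ht
  refine ContinuousAt.continuousWithinAt ?_
  obtain ⟨C, hC⟩ := hm.locally_bounded (half_pos ht) (2 * t)
  have hnhds : (univ : Set ℝ) ×ˢ Ioo (t / 2) (2 * t) ∈ 𝓝 (x, t) :=
    prod_mem_nhds univ_mem (Ioo_mem_nhds (by linarith) (by linarith))
  refine ContinuousAt.mul continuousAt_const ?_
  refine continuousAt_of_dominated (bound := fun p => ‖G p‖ * C) ?_ ?_ (hG.norm.mul_const C) ?_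
  · filter_upwards [hnhds] with q hq
    exact (integrable_exp_mul (hm.integrable hG ((half_pos ht).trans hq.2.1)) q.1).1
  · filter_upwards [hnhds] with q hq
    refine Eventually.of_forall fun p => ?_
    rw [norm_mul, norm_exp_I_mul, one_mul, norm_mul, Complex.norm_real]
    exact mul_le_mul_of_nonneg_left (hC p q.2 ⟨hq.2.1.le, hq.2.2.le⟩) (norm_nonneg _)
  · refine Eventually.of_forall fun p => ?_
    have h1 : ContinuousAt (m p) t := (hm.cont_right p).continuousAt (Ioi_mem_nhds ht)
    have h2 : ContinuousAt (fun q : ℝ × ℝ => m p q.2) (x, t) :=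
      h1.comp (x := (x, t)) (f := Prod.snd) continuousAt_snd
    refine ContinuousAt.mul (by fun_prop) (continuousAt_const.mul ?_)
    exact Complex.continuous_ofReal.continuousAt.comp h2

/-- Absolute convergence of the double integral defining the convolution in time of a kernel with an
inverse Fourier integral. -/
theorem integrable_conv (hm : IsMultiplier m) (hG : Integrable G) {c : ℝ → ℝ}
    (hc : ContinuousOn c (Ioi 0)) {t C : ℝ} (ht : 0 < t)
    (hi : ∀ p, IntervalIntegrable (fun y => c (t - y) * m p y) volume 0 t)
    (hC : ∀ p, ∫ y in (0 : ℝ)..t, |c (t - y) * m p y| ≤ C) :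
    Integrable (fun q : ℝ × ℝ => G q.1 * ((c (t - q.2) * m q.1 q.2 : ℝ) : ℂ))
      (volume.prod (volume.restrict (Ioo 0 t))) := by
  have hmeas : AEStronglyMeasurable (fun q : ℝ × ℝ => G q.1 * ((c (t - q.2) * m q.1 q.2 : ℝ) : ℂ))
      (volume.prod (volume.restrict (Ioo 0 t))) := by
    refine (hG.1.comp_fst).mul ?_
    refine Complex.continuous_ofReal.comp_aestronglyMeasurable ?_
    have : (volume : Measure ℝ).prod (volume.restrict (Ioo 0 t)) =
        ((volume : Measure ℝ).prod volume).restrict (univ ×ˢ Ioo 0 t) := by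
      rw [← Measure.prod_restrict, Measure.restrict_univ]
    rw [this]
    refine ContinuousOn.aestronglyMeasurable ?_ (MeasurableSet.univ.prod measurableSet_Ioo)
    refine ContinuousOn.mul ?_ (hm.cont.mono (prod_mono_right fun y hy => hy.1))
    exact (continuousOn_comp_sub hc t).comp continuousOn_snd fun q hq => hq.2.2
  rw [integrable_prod_iff hmeas]
  have hi' : ∀ p, IntegrableOn (fun y => c (t - y) * m p y) (Ioo 0 t) := fun p =>
    (intervalIntegrable_iff_integrableOn_Ioo_of_le ht.le).1 (hi p)
  refine ⟨Eventually.of_forall fun p => (hi' p).ofReal.const_mul (G p), ?_⟩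
  refine (hG.norm.mul_const C).mono' hmeas.norm.integral_prod_right' (Eventually.of_forall fun p => ?_)
  rw [Real.norm_of_nonneg (integral_nonneg fun _ => norm_nonneg _)]
  simp only [norm_mul, Complex.norm_real, Real.norm_eq_abs, integral_const_mul]
  refine mul_le_mul_of_nonneg_left ?_ (norm_nonneg _)
  have := hC p
  rw [intervalIntegral.integral_of_le ht.le, integral_Ioc_eq_integral_Ioo] at this
  simpa only [abs_mul] using this

/-- Fubini: a convolution in time acts on the multiplier. The bound `C` on the absolute convolution
must not depend on `p`, because `G` is merely integrable. -/
theorem conv_multiplierIntegral (hm : IsMultiplier m) (hG : Integrable G) {c : ℝ → ℝ}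
    (hc : ContinuousOn c (Ioi 0)) {t C : ℝ} (ht : 0 < t)
    (hi : ∀ p, IntervalIntegrable (fun y => c (t - y) * m p y) volume 0 t)
    (hC : ∀ p, ∫ y in (0 : ℝ)..t, |c (t - y) * m p y| ≤ C) (x : ℝ) :
    IntervalIntegrable (fun y => c (t - y) • multiplierIntegral G m x y) volume 0 t ∧
    ∫ y in (0 : ℝ)..t, c (t - y) • multiplierIntegral G m x y =
      fourierInverse (fun p => G p * ((∫ y in (0 : ℝ)..t, c (t - y) * m p y : ℝ) : ℂ)) x := by
  have h0 := hm.integrable_conv hG hc ht hi hC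
  have h1 : Integrable (fun q : ℝ × ℝ => Complex.exp (Complex.I * q.1 * x) *
      (G q.1 * ((c (t - q.2) * m q.1 q.2 : ℝ) : ℂ))) (volume.prod (volume.restrict (Ioo 0 t))) :=
    h0.bdd_mul (c := 1) (by fun_prop) (Eventually.of_forall fun q => (norm_exp_I_mul q.1 x).le)
  have e : ∀ y, c (t - y) • multiplierIntegral G m x y = 1 / (2 * (Real.pi : ℂ)) * ∫ p : ℝ,
      Complex.exp (Complex.I * p * x) * (G p * ((c (t - y) * m p y : ℝ) : ℂ)) := by
    intro y
    rw [multiplierIntegral, fourierInverse, Complex.real_smul, mul_left_comm, ← integral_const_mul]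
    congr 2 with p
    push_cast; ring
  simp only [e]
  constructor
  · rw [intervalIntegrable_iff_integrableOn_Ioo_of_le ht.le]
    exact h1.integral_prod_right.const_mul _
  · rw [intervalIntegral.integral_const_mul, intervalIntegral.integral_of_le ht.le,
      integral_Ioc_eq_integral_Ioo, fourierInverse]
    rw [← integral_integral_swap (f := fun (p y : ℝ) => Complex.exp (Complex.I * p * x) *
      (G p * ((c (t - y) * m p y : ℝ) : ℂ))) h1]
    congr 2 with p
    rw [integral_const_mul, integral_const_mul, intervalIntegral.integral_of_le ht.le,
      integral_Ioc_eq_integral_Ioo, integral_complex_ofReal]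

end IsMultiplier

/-- By Tonelli, `∫ |G(p) m(p,t)| dp` is integrable in `t`; it dominates the function for all `x` at
once, so bounded `x`-intervals suffice. -/
theorem IsMultiplier.integrableOn_strip {G : ℝ → ℂ} {m : ℝ → ℝ → ℝ} (hm : IsMultiplier m)
    (hG : Integrable G) {T C : ℝ} (hT : 0 < T) (hi : ∀ p, IntervalIntegrable (m p) volume 0 T)
    (hC : ∀ p, ∫ y in (0 : ℝ)..T, |m p y| ≤ C) (R : ℝ) :
    IntegrableOn (fun q : ℝ × ℝ => multiplierIntegral G m q.1 q.2) (Icc (-R) R ×ˢ Ioc 0 T) := by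
  have h0 := hm.integrable_conv hG (c := fun _ => 1) continuousOn_const hT
    (fun p => by simpa using hi p) (fun p => by simpa using hC p)
  simp only [one_mul] at h0
  have h1 : IntegrableOn (fun t => ‖1 / (2 * (Real.pi : ℂ))‖ * ∫ p, ‖G p * (m p t : ℂ)‖) (Ioc 0 T) := by
    rw [integrableOn_Ioc_iff_integrableOn_Ioo]
    exact h0.norm.integral_prod_right.const_mul _
  have hr : (volume : Measure (ℝ × ℝ)).restrict (Icc (-R) R ×ˢ Ioc 0 T) =
      (volume.restrict (Icc (-R) R)).prod (volume.restrict (Ioc 0 T)) := by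
    rw [Measure.prod_restrict]; rfl
  refine Integrable.mono' (g := fun q : ℝ × ℝ => ‖1 / (2 * (Real.pi : ℂ))‖ *
    ∫ p, ‖G p * (m p q.2 : ℂ)‖) ?_ ?_ (Eventually.of_forall fun q => norm_fourierInverse_le _ _)
  · rw [hr]
    exact h1.comp_snd (volume.restrict (Icc (-R) R))
  · refine ContinuousOn.aestronglyMeasurable ?_ (measurableSet_Icc.prod measurableSet_Ioc)
    exact (hm.continuousOn_multiplierIntegral hG).mono
      (prod_mono (subset_univ _) fun y hy => hy.1)

/-! ### The multipliers of the Cauchy problem -/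

/-- The Fourier multiplier of the solution operator. -/
noncomputable def diffusionMultiplier (γ μ ν ρ ω K p t : ℝ) : ℝ :=
  prabhakarResolvent γ ρ μ ω (γ * (1 - ν)) (μ - ν * (μ - 1)) (K * p ^ 2) t

/-- The Fourier multiplier of minus the time derivative of the inner fractional integral. -/
noncomputable def resolventMultiplier (γ μ ρ ω K p t : ℝ) : ℝ :=
  K * p ^ 2 * prabhakarResolvent γ ρ μ ω γ μ (K * p ^ 2) t

theorem diffusionTerm_eq (γ μ ν ρ ω K p t : ℝ) (n : ℕ) : diffusionTerm γ μ ν ρ ω K p t n =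
    (-(K * p ^ 2)) ^ n *
      prabhakarKernel (γ * n + γ * (1 - ν)) ρ (μ * n + (μ - ν * (μ - 1))) ω t := by
  have e1 : γ * n + γ * (1 - ν) = γ * (n + 1 - ν) := by ring
  have e2 : μ * n + (μ - ν * (μ - 1)) = μ * (n + 1) - ν * (μ - 1) := by ring
  rw [diffusionTerm, prabhakarKernel, e1, e2, ← neg_mul, mul_pow, ← pow_mul]
  ring

theorem tsum_diffusionTerm (γ μ ν ρ ω K p t : ℝ) :
    ∑' n, diffusionTerm γ μ ν ρ ω K p t n = diffusionMultiplier γ μ ν ρ ω K p t := by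
  simp only [diffusionTerm_eq]; rfl

theorem diffusionSolution_eq (γ μ ν ρ ω K : ℝ) (g : ℝ → ℂ) :
    diffusionSolution γ μ ν ρ ω K g =
      multiplierIntegral (fourierHat g) (diffusionMultiplier γ μ ν ρ ω K) := by
  ext x t
  simp only [diffusionSolution, diffusionIntegrand, tsum_diffusionTerm, multiplierIntegral,
    fourierInverse, mul_assoc]

section Existence

variable {γ μ ν ρ ω K : ℝ} (hμ : μ ∈ Ioo (0 : ℝ) 1) (hν : ν ∈ Icc (0 : ℝ) 1)
  (hρ : 0 < ρ) (hK : 0 ≤ K) (hγ : 0 ≤ γ)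

include hμ hρ hγ in
theorem summable_diffusionTerm (hν : ν ∈ Icc (0 : ℝ) 1) (p : ℝ) {t : ℝ} (ht : 0 < t) :
    Summable (diffusionTerm γ μ ν ρ ω K p t) := by
  have := summable_prabhakarResolvent (ω := ω) hρ hμ.1 (diffusion_exponent_pos hμ hν) hγ
    (mul_nonneg hγ (sub_nonneg.2 hν.2)) (K * p ^ 2) ht
  exact this.congr fun n => (diffusionTerm_eq γ μ ν ρ ω K p t n).symm

include hμ hρ hγ hK

theorem isMultiplier_diffusion (hν : ν ∈ Icc (0 : ℝ) 1) :
    IsMultiplier (diffusionMultiplier γ μ ν ρ ω K) := by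
  have hb := diffusion_exponent_pos hμ hν
  have ha : 0 ≤ γ * (1 - ν) := mul_nonneg hγ (sub_nonneg.2 hν.2)
  refine ⟨?_, fun T hT => ?_⟩
  · exact (continuousOn_prabhakarResolvent (ω := ω) hρ hμ.1 hb hγ ha).comp
      (f := fun q : ℝ × ℝ => (K * q.1 ^ 2, q.2)) (by fun_prop) fun q hq => ⟨mem_univ _, hq.2⟩
  · obtain ⟨C, hC0, hC⟩ := exists_prabhakarResolvent_bound (ω := ω) hρ hμ hγ ha hb hT
    exact ⟨C, _, hC0, fun p t ht => hC (K * p ^ 2) (by positivity) t ht⟩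

theorem isMultiplier_resolvent : IsMultiplier (resolventMultiplier γ μ ρ ω K) := by
  refine ⟨?_, fun T hT => ?_⟩
  · refine ContinuousOn.mul (by fun_prop) ?_
    exact (continuousOn_prabhakarResolvent (ω := ω) hρ hμ.1 hμ.1 hγ hγ).comp
      (f := fun q : ℝ × ℝ => (K * q.1 ^ 2, q.2)) (by fun_prop) fun q hq => ⟨mem_univ _, hq.2⟩
  · obtain ⟨M, hM0, hM⟩ := exists_resolvent_bound (ω := ω) hρ hμ hγ hT
    refine ⟨M, -1, hM0, fun p t ht => ?_⟩
    rw [Real.rpow_neg_one, ← div_eq_mul_inv]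
    exact (hM (K * p ^ 2) (by positivity)).1 t ht

theorem isMultiplier_mul_diffusion (hν : ν ∈ Icc (0 : ℝ) 1) :
    IsMultiplier (fun p t => K * p ^ 2 * diffusionMultiplier γ μ ν ρ ω K p t) := by
  refine ⟨?_, fun T hT => ?_⟩
  · exact ContinuousOn.mul (by fun_prop) (isMultiplier_diffusion hμ hρ hK hγ hν).cont
  · obtain ⟨M, hM0, hM⟩ := exists_mul_diffusion_bound (ω := ω) hρ hμ hγ hν hT
    refine ⟨M, -1, hM0, fun p t ht => ?_⟩
    rw [Real.rpow_neg_one, ← div_eq_mul_inv]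
    exact (hM (K * p ^ 2) (by positivity)).1 t ht

omit hK in
theorem intervalIntegrable_resolventMultiplier (p : ℝ) {t : ℝ} (ht : 0 < t) :
    IntervalIntegrable (resolventMultiplier γ μ ρ ω K p) volume 0 t :=
  (hasSymbol_resolvent (ω := ω) hρ hμ hγ (K * p ^ 2)).intervalIntegrable ht.le

theorem exists_integral_resolventMultiplier_le {t : ℝ} (ht : 0 < t) :
    ∃ C, ∀ p, ∫ y in (0 : ℝ)..t, |resolventMultiplier γ μ ρ ω K p y| ≤ C := by
  obtain ⟨M, hM0, hM⟩ := exists_resolvent_bound (ω := ω) hρ hμ hγ ht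
  exact ⟨M, fun p => (hM (K * p ^ 2) (by positivity)).2 t ⟨ht, le_rfl⟩⟩

variable {G : ℝ → ℂ} (hG : Integrable G)
include hG

theorem intervalIntegrable_multiplierIntegral_resolvent (x : ℝ) {t : ℝ} (ht : 0 < t) :
    IntervalIntegrable (multiplierIntegral G (resolventMultiplier γ μ ρ ω K) x) volume 0 t ∧
    ∫ y in (0 : ℝ)..t, multiplierIntegral G (resolventMultiplier γ μ ρ ω K) x y =
      fourierInverse (fun p => G p * ((∫ y in (0 : ℝ)..t, resolventMultiplier γ μ ρ ω K p y : ℝ) : ℂ)) x := by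
  obtain ⟨C, hC⟩ := exists_integral_resolventMultiplier_le (ω := ω) hμ hρ hK hγ ht
  have := (isMultiplier_resolvent (ω := ω) hμ hρ hK hγ).conv_multiplierIntegral hG (c := fun _ => 1)
    continuousOn_const ht
    (fun p => by simpa using intervalIntegrable_resolventMultiplier (ω := ω) hμ hρ hγ p ht)
    (fun p => by simpa using hC p) x
  simpa using this

omit hK hG in
theorem exists_integral_kernel_mul_resolvent_le {a c : ℝ} (hc : 0 < c) {t : ℝ} (ht : 0 < t) :
    ∃ C, ∀ l, 0 ≤ l → ∫ y in (0 : ℝ)..t, |prabhakarKernel a ρ c ω (t - y) *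
      (l * prabhakarResolvent γ ρ μ ω γ μ l y)| ≤ C := by
  obtain ⟨M, hM0, hM⟩ := exists_resolvent_bound (ω := ω) hρ hμ hγ ht
  obtain ⟨C, hC0, hC⟩ := (hasSymbol_prabhakarKernel hρ hc a ω).exists_bound t
  refine ⟨C * M * (1 + 2 ^ (1 - c) + 2 / c) * t ^ (c - 1), fun l hl => ?_⟩
  obtain ⟨h1, h2⟩ := hM l hl
  exact integral_conv_le_of_bound hc hC0 hM0 ht hC h1
    ((hasSymbol_resolvent (ω := ω) hρ hμ hγ l).intervalIntegrable ht.le) (h2 t ⟨ht, le_rfl⟩)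

theorem outer_multiplierIntegral (hν : ν ∈ Icc (0 : ℝ) 1) (hν0 : 0 < ν) (x : ℝ) {t : ℝ} (ht : 0 < t) :
    IntervalIntegrable (fun y => prabhakarKernel (-(γ * ν)) ρ (ν * (1 - μ)) ω (t - y) •
      multiplierIntegral G (resolventMultiplier γ μ ρ ω K) x y) volume 0 t ∧
    ∫ y in (0 : ℝ)..t, prabhakarKernel (-(γ * ν)) ρ (ν * (1 - μ)) ω (t - y) •
      multiplierIntegral G (resolventMultiplier γ μ ρ ω K) x y =
      multiplierIntegral G (fun p t => K * p ^ 2 * diffusionMultiplier γ μ ν ρ ω K p t) x t := by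
  have hc : 0 < ν * (1 - μ) := mul_pos hν0 (sub_pos.2 hμ.2)
  have hk := hasSymbol_prabhakarKernel hρ hc (-(γ * ν)) ω
  obtain ⟨C, hC⟩ := exists_integral_kernel_mul_resolvent_le (ω := ω) (a := -(γ * ν)) hμ hρ hγ hc ht
  have := (isMultiplier_resolvent (ω := ω) hμ hρ hK hγ).conv_multiplierIntegral hG
    hk.continuousOn ht
    (fun p => hk.intervalIntegrable_conv (hasSymbol_resolvent (ω := ω) hρ hμ hγ (K * p ^ 2)) ht)
    (fun p => hC (K * p ^ 2) (by positivity)) x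
  refine ⟨this.1, this.2.trans ?_⟩
  rw [multiplierIntegral]
  congr 1 with p
  congr 2
  exact kernel_outer_conv_resolvent hρ hμ hγ hν0 hν (by positivity) ht

theorem inner_multiplierIntegral (hν : ν ∈ Icc (0 : ℝ) 1) (hν1 : ν < 1) (x : ℝ) {t : ℝ} (ht : 0 < t) :
    IntervalIntegrable (fun y => prabhakarKernel (-(γ * (1 - ν))) ρ ((1 - ν) * (1 - μ)) ω (t - y) •
      multiplierIntegral G (diffusionMultiplier γ μ ν ρ ω K) x y) volume 0 t ∧
    ∫ y in (0 : ℝ)..t, prabhakarKernel (-(γ * (1 - ν))) ρ ((1 - ν) * (1 - μ)) ω (t - y) •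
      multiplierIntegral G (diffusionMultiplier γ μ ν ρ ω K) x y =
      fourierInverse (fun p => G p *
        ((1 - ∫ y in (0 : ℝ)..t, resolventMultiplier γ μ ρ ω K p y : ℝ) : ℂ)) x := by
  have hc : 0 < (1 - ν) * (1 - μ) := mul_pos (sub_pos.2 hν1) (sub_pos.2 hμ.2)
  have hk := hasSymbol_prabhakarKernel hρ hc (-(γ * (1 - ν))) ω
  have hb := diffusion_exponent_pos hμ hν
  have ha : 0 ≤ γ * (1 - ν) := mul_nonneg hγ (sub_nonneg.2 hν.2)
  have hΦ := fun p : ℝ => hasSymbol_prabhakarResolvent (ω := ω) hρ hμ.1 hb hγ ha (K * p ^ 2)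
  obtain ⟨C, hC0, hC⟩ := exists_prabhakarResolvent_bound (ω := ω) hρ hμ hγ ha hb ht
  obtain ⟨C', hC0', hC'⟩ := hk.exists_bound t
  have hi := fun p => hk.intervalIntegrable_conv (hΦ p) ht
  have hbd : ∀ p, ∫ y in (0 : ℝ)..t, |prabhakarKernel (-(γ * (1 - ν))) ρ ((1 - ν) * (1 - μ)) ω (t - y) *
      diffusionMultiplier γ μ ν ρ ω K p y| ≤ ∫ y in (0 : ℝ)..t, C' * C *
        ((t - y) ^ ((1 - ν) * (1 - μ) - 1) * y ^ (μ - ν * (μ - 1) - 1)) := by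
    intro p
    refine intervalIntegral.integral_mono_on_of_le_Ioo ht.le (hi p).abs
      ((intervalIntegrable_rpow_sub_mul_rpow hc hb ht).const_mul _) fun y hy => ?_
    have e1 := hC' (t - y) ⟨sub_pos.2 hy.2, by linarith [hy.1]⟩
    have e2 := hC (K * p ^ 2) (by positivity) y ⟨hy.1, hy.2.le⟩
    rw [abs_mul]
    refine (mul_le_mul e1 e2 (abs_nonneg _) ((abs_nonneg _).trans e1)).trans_eq ?_
    ring
  have := (isMultiplier_diffusion (ω := ω) hμ hρ hK hγ hν).conv_multiplierIntegral hG
    hk.continuousOn ht hi hbd x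
  refine ⟨this.1, this.2.trans ?_⟩
  congr 1 with p
  congr 2
  exact kernel_inner_conv_diffusion hρ hμ hγ hν1 hν (by positivity) ht

end Existence

/-! ### Existence and admissibility -/

section Solution

variable {γ μ ν ρ ω K : ℝ} (hμ : μ ∈ Ioo (0 : ℝ) 1) (hν : ν ∈ Icc (0 : ℝ) 1)
  (hρ : 0 < ρ) (hK : 0 ≤ K) (hγ : 0 ≤ γ) {g : ℝ → ℂ} (hgc : Continuous g) (hgi : Integrable g)
  (hgh : Integrable (fourierHat g)) (hg0 : K = 0 → ContDiff ℝ 2 g)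
include hμ hν hρ hK hγ hgc hgi hgh

/-- The inner operator turns the solution multiplier into `1 - ∫₀ᵗ r`; Fourier inversion of the
constant `1` returns `g`. Exhibiting a primitive yields the initial value, absolute continuity and
the derivative at every `t > 0`. -/
theorem hilferPrabhakarInner_diffusionSolution (x : ℝ) {t : ℝ} (ht : 0 < t) :
    PrabhakarConverges (-(γ * (1 - ν))) ρ ((1 - ν) * (1 - μ)) ω
      (diffusionSolution γ μ ν ρ ω K g x) t ∧
    hilferPrabhakarInner γ μ ν ρ ω (diffusionSolution γ μ ν ρ ω K g x) t =
      g x - ∫ y in (0 : ℝ)..t,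
        multiplierIntegral (fourierHat g) (resolventMultiplier γ μ ρ ω K) x y := by
  obtain ⟨hri, hre⟩ := intervalIntegrable_multiplierIntegral_resolvent (ω := ω) hμ hρ hK hγ hgh x ht
  obtain ⟨M, hM⟩ := exists_integral_resolventMultiplier_le (ω := ω) hμ hρ hK hγ ht
  have hΘ : fourierInverse (fun p => fourierHat g p *
      ((1 - ∫ y in (0 : ℝ)..t, resolventMultiplier γ μ ρ ω K p y : ℝ) : ℂ)) x =
      g x - ∫ y in (0 : ℝ)..t,
        multiplierIntegral (fourierHat g) (resolventMultiplier γ μ ρ ω K) x y := by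
    rw [hre, ← fourierInverse_fourierHat hgc hgi hgh x]
    simp only [fourierInverse]
    rw [← mul_sub, ← integral_sub (integrable_exp_mul hgh x)]
    · congr 2 with p
      push_cast; ring
    · refine integrable_exp_mul ?_ x
      have h0 := (isMultiplier_resolvent (ω := ω) hμ hρ hK hγ).integrable_conv hgh
        (c := fun _ => 1) continuousOn_const ht
        (fun p => by simpa using intervalIntegrable_resolventMultiplier (ω := ω) hμ hρ hγ p ht)
        (fun p => by simpa using hM p)
      refine h0.integral_prod_left.congr (Eventually.of_forall fun p => ?_)
      simp only [one_mul]
      rw [integral_const_mul, integral_complex_ofReal, intervalIntegral.integral_of_le ht.le,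
        integral_Ioc_eq_integral_Ioo]
  rw [← hΘ, diffusionSolution_eq]
  -- At `ν = 1` the inner operator is the identity, and the multiplier itself equals `1 - ∫₀ᵗ r`.
  rcases hν.2.eq_or_lt with rfl | hν1
  · refine ⟨Or.inl (by simp), ?_⟩
    rw [hilferPrabhakarInner, prabhakarIntegral, if_pos (by simp), multiplierIntegral]
    congr 1 with p
    congr 2
    exact diffusion_eq_of_order_one hρ hμ hγ (by positivity) ht
  · have hc : (1 - ν) * (1 - μ) ≠ 0 := (mul_pos (sub_pos.2 hν1) (sub_pos.2 hμ.2)).ne'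
    obtain ⟨h1, h2⟩ := inner_multiplierIntegral (ω := ω) hμ hρ hK hγ hgh hν hν1 x ht
    refine ⟨Or.inr h1, ?_⟩
    rw [hilferPrabhakarInner, prabhakarIntegral, if_neg (by simp [hc])]
    exact h2

theorem hasDerivAt_inner_diffusionSolution (x : ℝ) {t : ℝ} (ht : 0 < t) :
    HasDerivAt (hilferPrabhakarInner γ μ ν ρ ω (diffusionSolution γ μ ν ρ ω K g x))
      (-multiplierIntegral (fourierHat g) (resolventMultiplier γ μ ρ ω K) x t) t := by
  have hcont : ContinuousOn (multiplierIntegral (fourierHat g) (resolventMultiplier γ μ ρ ω K) x)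
      (Ioi 0) :=
    ((isMultiplier_resolvent (ω := ω) hμ hρ hK hγ).continuousOn_multiplierIntegral hgh).comp
      (f := fun t : ℝ => (x, t)) (by fun_prop) fun t ht => ⟨mem_univ _, ht⟩
  have h1 := intervalIntegral.integral_hasDerivAt_right
    (intervalIntegrable_multiplierIntegral_resolvent (ω := ω) hμ hρ hK hγ hgh x ht).1
    (hcont.stronglyMeasurableAtFilter isOpen_Ioi t ht) (hcont.continuousAt (Ioi_mem_nhds ht))
  refine (h1.const_sub (g x)).congr_of_eventuallyEq ?_
  filter_upwards [Ioi_mem_nhds ht] with s hs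
  exact (hilferPrabhakarInner_diffusionSolution hμ hν hρ hK hγ hgc hgi hgh x hs).2

theorem outer_diffusionSolution (x : ℝ) {t : ℝ} (ht : 0 < t) :
    PrabhakarConverges (-(γ * ν)) ρ (ν * (1 - μ)) ω
      (deriv (hilferPrabhakarInner γ μ ν ρ ω (diffusionSolution γ μ ν ρ ω K g x))) t ∧
    hilferPrabhakarDeriv γ μ ν ρ ω (diffusionSolution γ μ ν ρ ω K g x) t =
      -multiplierIntegral (fourierHat g)
        (fun p t => K * p ^ 2 * diffusionMultiplier γ μ ν ρ ω K p t) x t := by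
  have hd : ∀ y : ℝ, 0 < y →
      deriv (hilferPrabhakarInner γ μ ν ρ ω (diffusionSolution γ μ ν ρ ω K g x)) y =
        -multiplierIntegral (fourierHat g) (resolventMultiplier γ μ ρ ω K) x y := fun y hy =>
    (hasDerivAt_inner_diffusionSolution (ω := ω) hμ hν hρ hK hγ hgc hgi hgh x hy).deriv
  rw [hilferPrabhakarDeriv, prabhakarIntegral]
  -- At `ν = 0` the outer operator is the identity, and `l` times the solution multiplier is the
  -- resolvent.
  rcases hν.1.eq_or_lt with rfl | hν0
  · refine ⟨Or.inl (by simp), ?_⟩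
    rw [if_pos (by simp), hd t ht]
    congr 2
    ext p t
    simp [diffusionMultiplier, resolventMultiplier]
  · have hc : ν * (1 - μ) ≠ 0 := (mul_pos hν0 (sub_pos.2 hμ.2)).ne'
    obtain ⟨h1, h2⟩ := outer_multiplierIntegral (ω := ω) hμ hρ hK hγ hgh hν hν0 x ht
    constructor
    · refine Or.inr (h1.neg.congr fun y hy => ?_)
      rw [uIoc_of_le ht.le] at hy
      simp only [Pi.neg_apply]
      rw [hd y hy.1, smul_neg]
    · rw [if_neg (by simp [hc]), ← h2, ← intervalIntegral.integral_neg,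
        intervalIntegral.integral_of_le ht.le, intervalIntegral.integral_of_le ht.le]
      refine setIntegral_congr_fun measurableSet_Ioc fun y hy => ?_
      rw [hd y hy.1, smul_neg]

omit hgc hgi in
theorem continuousOn_diffusionSolution (x : ℝ) :
    ContinuousOn (diffusionSolution γ μ ν ρ ω K g x) (Ioi 0) := by
  rw [diffusionSolution_eq]
  exact ((isMultiplier_diffusion (ω := ω) hμ hρ hK hγ hν).continuousOn_multiplierIntegral hgh).comp
    (f := fun t : ℝ => (x, t)) (by fun_prop) fun t ht => ⟨mem_univ _, ht⟩

omit hgc hgi in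
theorem exists_majorant_diffusionSolution {T : ℝ} (hT : 0 < T) : ∃ m : ℝ → ℝ,
    IntegrableOn m (Ioc 0 T) ∧ ∀ x : ℝ, ∀ t ∈ Ioc 0 T, ‖diffusionSolution γ μ ν ρ ω K g x t‖ ≤ m t := by
  have hb := diffusion_exponent_pos hμ hν
  have ha : 0 ≤ γ * (1 - ν) := mul_nonneg hγ (sub_nonneg.2 hν.2)
  obtain ⟨C, hC0, hC⟩ := exists_prabhakarResolvent_bound (ω := ω) hρ hμ hγ ha hb hT
  refine ⟨fun t => ‖1 / (2 * (Real.pi : ℂ))‖ * (∫ p, ‖fourierHat g p‖) *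
    (C * t ^ (μ - ν * (μ - 1) - 1)), ?_, fun x t ht => ?_⟩
  · rw [← intervalIntegrable_iff_integrableOn_Ioc_of_le hT.le]
    exact ((intervalIntegral.intervalIntegrable_rpow' (by linarith)).const_mul C).const_mul _
  · rw [diffusionSolution_eq]
    refine (norm_fourierInverse_le _ _).trans ?_
    beta_reduce
    rw [mul_assoc]
    refine mul_le_mul_of_nonneg_left ?_ (norm_nonneg _)
    rw [← integral_mul_const]
    refine integral_mono ((isMultiplier_diffusion hμ hρ hK hγ hν).integrable hgh ht.1).norm
      (hgh.norm.mul_const _) fun p => ?_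
    simp only [norm_mul, Complex.norm_real]
    exact mul_le_mul_of_nonneg_left (hC (K * p ^ 2) (by positivity) t ht) (norm_nonneg _)

omit hgc hgi in
theorem contDiff_diffusionSolution_of_pos (hK0 : 0 < K) {t : ℝ} (ht : 0 < t) :
    ContDiff ℝ 2 (fun x => diffusionSolution γ μ ν ρ ω K g x t) ∧ ∀ x,
      iteratedDeriv 2 (fun ξ => diffusionSolution γ μ ν ρ ω K g ξ t) x =
        -((K : ℂ)⁻¹ * multiplierIntegral (fourierHat g)
          (fun p t => K * p ^ 2 * diffusionMultiplier γ μ ν ρ ω K p t) x t) := by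
  have hKc : (K : ℂ) ≠ 0 := by exact_mod_cast hK0.ne'
  have h0 := (isMultiplier_diffusion (ω := ω) hμ hρ hK hγ hν).integrable hgh ht
  have h2 := ((isMultiplier_mul_diffusion (ω := ω) hμ hρ hK hγ hν).integrable hgh ht).const_mul
    (K : ℂ)⁻¹
  have e : ∀ p : ℝ, (K : ℂ)⁻¹ * (fourierHat g p *
      ((K * p ^ 2 * diffusionMultiplier γ μ ν ρ ω K p t : ℝ) : ℂ)) = ((p ^ 2 : ℝ) : ℂ) *
      (fourierHat g p * (diffusionMultiplier γ μ ν ρ ω K p t : ℂ)) := fun p => by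
    push_cast; field_simp
  obtain ⟨h3, h4⟩ := contDiff_fourierInverse h0 (h2.congr (Eventually.of_forall e))
  rw [diffusionSolution_eq]
  refine ⟨h3, fun x => (h4 x).trans ?_⟩
  simp only [← e]
  rw [multiplierIntegral, fourierInverse, fourierInverse, mul_left_comm, ← integral_const_mul,
    ← integral_const_mul, ← integral_const_mul]
  refine congrArg Neg.neg (integral_congr_ae (ae_of_all _ fun p => ?_))
  ring_nf

omit hμ hν hρ hK hγ in
-- For `K = 0` the multiplier does not depend on `p`, so nothing is smoothed: regularity in `x` is
-- that of `g`.
theorem diffusionSolution_of_zero (x t : ℝ) : diffusionSolution γ μ ν ρ ω 0 g x t =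
    (diffusionMultiplier γ μ ν ρ ω 0 0 t : ℂ) * g x := by
  rw [diffusionSolution_eq, multiplierIntegral, ← fourierInverse_fourierHat hgc hgi hgh x,
    fourierInverse, fourierInverse, mul_left_comm, ← integral_const_mul,
    ← integral_const_mul, ← integral_const_mul]
  refine integral_congr_ae (ae_of_all _ fun p => ?_)
  simp only [diffusionMultiplier, zero_mul]
  ring

include hg0

theorem contDiff_diffusionSolution {t : ℝ} (ht : 0 < t) :
    ContDiff ℝ 2 (fun x => diffusionSolution γ μ ν ρ ω K g x t) ∧ ∀ x,
      K * iteratedDeriv 2 (fun ξ => diffusionSolution γ μ ν ρ ω K g ξ t) x =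
        -multiplierIntegral (fourierHat g)
          (fun p t => K * p ^ 2 * diffusionMultiplier γ μ ν ρ ω K p t) x t := by
  rcases hK.eq_or_lt with rfl | hK0
  · constructor
    · simp only [diffusionSolution_of_zero hgc hgi hgh]
      exact contDiff_const.mul (hg0 rfl)
    · intro x
      simp [multiplierIntegral, fourierInverse]
  · obtain ⟨h1, h2⟩ := contDiff_diffusionSolution_of_pos (ω := ω) hμ hν hρ hK hγ hgh hK0 ht
    refine ⟨h1, fun x => ?_⟩
    have hKc : (K : ℂ) ≠ 0 := by exact_mod_cast hK0.ne'
    rw [h2, mul_neg, mul_inv_cancel_left₀ hKc]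

theorem isDiffusionSolution_diffusionSolution :
    IsDiffusionSolution γ μ ν ρ ω K g (diffusionSolution γ μ ν ρ ω K g) := by
  have hAC : ∀ x b, 0 < b → ∃ F : ℝ → ℂ, AbsolutelyContinuousOnInterval F 0 b ∧
      EqOn (hilferPrabhakarInner γ μ ν ρ ω (diffusionSolution γ μ ν ρ ω K g x)) F (Ioc 0 b) ∧
      F 0 = g x := by
    intro x b hb
    obtain ⟨F, hF, hFe⟩ := (intervalIntegrable_multiplierIntegral_resolvent (ω := ω) hμ hρ hK hγ hgh
      x hb).1.exists_absolutelyContinuous hb (g x)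
    refine ⟨F, hF, fun t ht => ?_, ?_⟩
    · rw [(hilferPrabhakarInner_diffusionSolution hμ hν hρ hK hγ hgc hgi hgh x ht.1).2,
        hFe t ⟨ht.1.le, ht.2⟩]
    · rw [hFe 0 ⟨le_rfl, hb.le⟩]; simp
  have hdecay : ∀ t, Tendsto (fun x => diffusionSolution γ μ ν ρ ω K g x t) (cocompact ℝ) (𝓝 0) := by
    intro t
    rw [diffusionSolution_eq]
    exact tendsto_fourierInverse_cocompact _
  refine ⟨continuousOn_diffusionSolution hμ hν hρ hK hγ hgh,
    fun t ht => (contDiff_diffusionSolution hμ hν hρ hK hγ hgc hgi hgh hg0 ht).1,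
    fun x => ⟨fun b hb => ?_, fun b hb => ?_, fun t ht => ?_, fun t ht => ?_, fun t ht => ?_⟩,
    fun x t ht => ?_, fun x => ?_, fun t _ => (hdecay t).mono_left atTop_le_cocompact,
    fun t _ => (hdecay t).mono_left atBot_le_cocompact⟩
  · obtain ⟨m, hm, hle⟩ := exists_majorant_diffusionSolution (ω := ω) hμ hν hρ hK hγ hgh hb
    rw [intervalIntegrable_iff_integrableOn_Ioc_of_le hb.le]
    refine hm.mono' ?_ ((ae_restrict_iff' measurableSet_Ioc).2 (Eventually.of_forall (hle x)))
    exact ((continuousOn_diffusionSolution hμ hν hρ hK hγ hgh x).mono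
      fun y hy => hy.1).aestronglyMeasurable measurableSet_Ioc
  · obtain ⟨F, h1, h2, -⟩ := hAC x b hb
    exact ⟨F, h1, h2⟩
  · exact (hilferPrabhakarInner_diffusionSolution hμ hν hρ hK hγ hgc hgi hgh x ht).1
  · exact (hasDerivAt_inner_diffusionSolution hμ hν hρ hK hγ hgc hgi hgh x ht).differentiableAt
  · exact (outer_diffusionSolution hμ hν hρ hK hγ hgc hgi hgh x ht).1
  · rw [(outer_diffusionSolution hμ hν hρ hK hγ hgc hgi hgh x ht).2,
      (contDiff_diffusionSolution hμ hν hρ hK hγ hgc hgi hgh hg0 ht).2 x]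
  · obtain ⟨F, h1, h2, h3⟩ := hAC x 1 one_pos
    have hc := h1.continuousOn
    rw [uIcc_of_le zero_le_one] at hc
    have h4 : Tendsto F (𝓝[>] 0) (𝓝 (g x)) := by
      rw [← h3]
      exact (hc 0 ⟨le_rfl, zero_le_one⟩).mono_left
        (nhdsWithin_le_of_mem (Icc_mem_nhdsGT_of_mem ⟨le_rfl, one_pos⟩))
    refine h4.congr' ?_
    filter_upwards [Ioc_mem_nhdsGT one_pos] with t ht
    exact (h2 ht).symm

theorem isDiffusionAdmissible_diffusionSolution :
    IsDiffusionAdmissible (diffusionSolution γ μ ν ρ ω K g) := by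
  refine ⟨fun T hT => exists_majorant_diffusionSolution hμ hν hρ hK hγ hgh hT,
    fun R T hR hT => ?_⟩
  have hms : MeasurableSet (Icc (-R) R ×ˢ Ioc (0 : ℝ) T) := measurableSet_Icc.prod measurableSet_Ioc
  have hb := diffusion_exponent_pos hμ hν
  have ha : 0 ≤ γ * (1 - ν) := mul_nonneg hγ (sub_nonneg.2 hν.2)
  rcases hK.eq_or_lt with rfl | hK0
  · have hg2 := (hg0 rfl).continuous_iteratedDeriv 2 le_rfl
    have h1 : IntegrableOn (iteratedDeriv 2 g) (Icc (-R) R) := hg2.integrableOn_Icc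
    have h2 : IntegrableOn (fun t => (diffusionMultiplier γ μ ν ρ ω 0 0 t : ℂ)) (Ioc 0 T) := by
      have := (hasSymbol_prabhakarResolvent (ω := ω) hρ hμ.1 hb hγ ha (0 * 0 ^ 2)).intervalIntegrable
        hT.le
      rw [intervalIntegrable_iff_integrableOn_Ioc_of_le hT.le] at this
      exact this.ofReal
    have h3 := h1.mul_prod h2
    rw [Measure.prod_restrict] at h3
    refine IntegrableOn.congr_fun (f := fun q : ℝ × ℝ => iteratedDeriv 2 g q.1 *
      (diffusionMultiplier γ μ ν ρ ω 0 0 q.2 : ℂ)) h3 (fun q _ => ?_) hms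
    simp only [diffusionSolution_of_zero hgc hgi hgh]
    rw [show (fun ξ => (diffusionMultiplier γ μ ν ρ ω 0 0 q.2 : ℂ) * g ξ) =
      (diffusionMultiplier γ μ ν ρ ω 0 0 q.2 : ℂ) • g from rfl, iteratedDeriv_const_smul_field,
      smul_eq_mul, mul_comm]
  · obtain ⟨M, hM0, hM⟩ := exists_mul_diffusion_bound (ω := ω) hρ hμ hγ hν hT
    have h1 := (isMultiplier_mul_diffusion (ω := ω) hμ hρ hK hγ hν).integrableOn_strip hgh hT
      (fun p => ((hasSymbol_prabhakarResolvent (ω := ω) hρ hμ.1 hb hγ ha (K * p ^ 2)).smul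
        (K * p ^ 2)).intervalIntegrable hT.le)
      (fun p => (hM (K * p ^ 2) (by positivity)).2 T ⟨hT, le_rfl⟩) R
    have h2 := (h1.const_mul ((K : ℂ)⁻¹)).neg
    refine IntegrableOn.congr_fun h2 (fun q hq => ?_) hms
    exact ((contDiff_diffusionSolution_of_pos (ω := ω) hμ hν hρ hK hγ hgh hK0 hq.2.1).2 q.1).symm

omit hgc hgi hg0 in
theorem integrable_diffusionIntegrand (x : ℝ) {t : ℝ} (ht : 0 < t) :
    Integrable (diffusionIntegrand γ μ ν ρ ω K g x t) := by
  have := integrable_exp_mul ((isMultiplier_diffusion (ω := ω) hμ hρ hK hγ hν).integrable hgh ht) x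
  refine this.congr (Eventually.of_forall fun p => ?_)
  simp only [diffusionIntegrand, tsum_diffusionTerm, mul_assoc]

end Solution

/-! ### Associativity of convolution and the Prabhakar semigroup -/

section Convolution

variable {f e : ℝ → ℝ} {F : ℝ → ℂ} {t : ℝ}

/-- Cutting both factors off to `(0,t)` reduces the claim to convolution of integrable functions on
the line. For `s < t` the cutoff of `e` at zero removes exactly the part `y ≥ s`. -/
theorem integrable_truncated_conv (ht : 0 ≤ t) (he : IntervalIntegrable e volume 0 t)
    (hF : IntervalIntegrable F volume 0 t) :
    Integrable (fun p : ℝ × ℝ => (Ioo 0 t).indicator e (p.1 - p.2) • F p.2)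
      ((volume.restrict (Ioo 0 t)).prod (volume.restrict (Ioo 0 t))) := by
  rw [intervalIntegrable_iff_integrableOn_Ioo_of_le ht] at he hF
  have h := (Integrable.convolution_integrand
    (ContinuousLinearMap.lsmul ℝ ℝ : ℝ →L[ℝ] ℂ →L[ℝ] ℂ).flip
    (hF.integrable_indicator measurableSet_Ioo)
    (he.integrable_indicator measurableSet_Ioo)).integrableOn (s := Ioo 0 t ×ˢ Ioo 0 t)
  rw [Measure.prod_restrict]
  refine IntegrableOn.congr_fun h (fun p hp => ?_) (measurableSet_Ioo.prod measurableSet_Ioo)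
  simp [indicator_of_mem hp.2]

theorem setIntegral_truncated_conv {s : ℝ} (hs : s ∈ Ioo 0 t) :
    ∫ y in Ioo 0 t, (Ioo 0 t).indicator e (s - y) • F y =
      ∫ y in (0 : ℝ)..s, e (s - y) • F y := by
  rw [intervalIntegral.integral_of_le hs.1.le, integral_Ioc_eq_integral_Ioo,
    ← integral_indicator measurableSet_Ioo, ← integral_indicator measurableSet_Ioo]
  congr 1 with y
  by_cases hy : y ∈ Ioo 0 s
  · have h1 : y ∈ Ioo 0 t := ⟨hy.1, hy.2.trans hs.2⟩
    have h2 : s - y ∈ Ioo 0 t := ⟨sub_pos.2 hy.2, by linarith [hy.1, hs.2]⟩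
    rw [indicator_of_mem hy, indicator_of_mem h1, indicator_of_mem h2]
  · rw [indicator_of_notMem hy]
    by_cases h1 : y ∈ Ioo 0 t
    · have h2 : s - y ∉ Ioo 0 t := fun h => hy ⟨h1.1, sub_pos.1 h.1⟩
      rw [indicator_of_mem h1, indicator_of_notMem h2, zero_smul]
    · rw [indicator_of_notMem h1]

theorem intervalIntegrable_conv_smul (ht : 0 ≤ t) (he : IntervalIntegrable e volume 0 t)
    (hF : IntervalIntegrable F volume 0 t) :
    IntervalIntegrable (fun s => ∫ y in (0 : ℝ)..s, e (s - y) • F y) volume 0 t := by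
  rw [intervalIntegrable_iff_integrableOn_Ioo_of_le ht]
  exact IntegrableOn.congr_fun (integrable_truncated_conv ht he hF).integral_prod_left
    (fun s hs => setIntegral_truncated_conv hs) measurableSet_Ioo

theorem integral_conv_assoc (ht : 0 ≤ t) (hf : ContinuousOn f (Ioi 0)) {C : ℝ}
    (hfC : ∀ s ∈ Ioc 0 t, |f s| ≤ C)
    (he : IntervalIntegrable e volume 0 t) (hF : IntervalIntegrable F volume 0 t) :
    ∫ s in (0 : ℝ)..t, f (t - s) • ∫ y in (0 : ℝ)..s, e (s - y) • F y =
      ∫ y in (0 : ℝ)..t, (∫ z in (0 : ℝ)..(t - y), f (t - y - z) * e z) • F y := by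
  have hfm : ContinuousOn (fun s => f (t - s)) (Ioo 0 t) :=
    hf.comp (by fun_prop) fun s hs => sub_pos.2 hs.2
  have hint : Integrable (fun p : ℝ × ℝ => f (t - p.1) •
      ((Ioo 0 t).indicator e (p.1 - p.2) • F p.2))
      ((volume.restrict (Ioo 0 t)).prod (volume.restrict (Ioo 0 t))) := by
    refine (integrable_truncated_conv ht he hF).bdd_smul (φ := fun p : ℝ × ℝ => f (t - p.1)) C ?_ ?_
    · exact (hfm.aestronglyMeasurable measurableSet_Ioo).comp_fst
    · have : ∀ᵐ p : ℝ × ℝ ∂((volume.restrict (Ioo 0 t)).prod (volume.restrict (Ioo 0 t))),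
          p ∈ Ioo 0 t ×ˢ Ioo 0 t := by
        rw [Measure.prod_restrict]
        exact ae_restrict_mem (measurableSet_Ioo.prod measurableSet_Ioo)
      filter_upwards [this] with p hp
      exact hfC _ ⟨sub_pos.2 hp.1.2, by linarith [hp.1.1]⟩
  rw [intervalIntegral.integral_of_le ht, intervalIntegral.integral_of_le ht,
    integral_Ioc_eq_integral_Ioo, integral_Ioc_eq_integral_Ioo]
  calc _ = ∫ s in Ioo 0 t, ∫ y in Ioo 0 t, f (t - s) • ((Ioo 0 t).indicator e (s - y) • F y) := by
        refine setIntegral_congr_fun measurableSet_Ioo fun s hs => ?_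
        rw [integral_smul, setIntegral_truncated_conv hs]
    _ = ∫ y in Ioo 0 t, ∫ s in Ioo 0 t, f (t - s) • ((Ioo 0 t).indicator e (s - y) • F y) :=
        integral_integral_swap hint
    _ = _ := by
        refine setIntegral_congr_fun measurableSet_Ioo fun y hy => ?_
        simp_rw [smul_smul]
        rw [integral_smul_const]
        congr 1
        have e1 : ∫ z in (0 : ℝ)..(t - y), f (t - y - z) * e z =
            ∫ s in y..t, f (t - s) * e (s - y) := by
          rw [← sub_self y, ← intervalIntegral.integral_comp_sub_right (a := y) (b := t)
            (fun z => f (t - y - z) * e z) y]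
          congr 1 with s
          congr 2
          ring
        rw [e1, intervalIntegral.integral_of_le hy.2.le, integral_Ioc_eq_integral_Ioo,
          ← integral_indicator measurableSet_Ioo, ← integral_indicator measurableSet_Ioo]
        congr 1 with s
        by_cases hs : s ∈ Ioo y t
        · have h1 : s ∈ Ioo 0 t := ⟨hy.1.trans hs.1, hs.2⟩
          have h2 : s - y ∈ Ioo 0 t := ⟨sub_pos.2 hs.1, by linarith [hy.1, hs.2]⟩
          rw [indicator_of_mem hs, indicator_of_mem h1, indicator_of_mem h2]
        · rw [indicator_of_notMem hs]
          by_cases h1 : s ∈ Ioo 0 t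
          · have h2 : s - y ∉ Ioo 0 t := fun h => hs ⟨sub_pos.1 h.1, h1.2⟩
            rw [indicator_of_mem h1, indicator_of_notMem h2, mul_zero]
          · rw [indicator_of_notMem h1]

end Convolution

section Semigroup

variable {γ₁ γ₂ ρ μ₁ μ₂ ω : ℝ} (hρ : 0 < ρ)
include hρ

theorem exists_bound_prabhakarKernel (γ : ℝ) {μ : ℝ} (hμ : 1 ≤ μ) (ω t : ℝ) :
    ∃ C, 0 ≤ C ∧ ∀ s ∈ Ioc 0 t, |prabhakarKernel γ ρ μ ω s| ≤ C := by
  obtain ⟨C, hC0, hC⟩ :=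
    ((hasSymbol_prabhakarKernel hρ (by linarith) γ ω).weaken one_pos hμ).exists_bound t
  exact ⟨C, hC0, fun s hs => by simpa using hC s hs⟩

theorem prabhakarKernel_conv (h₁ : 0 < μ₁) (h₂ : 0 < μ₂) {t : ℝ} (ht : 0 < t) :
    ∫ z in (0 : ℝ)..t, prabhakarKernel γ₁ ρ μ₁ ω (t - z) * prabhakarKernel γ₂ ρ μ₂ ω z =
      prabhakarKernel (γ₁ + γ₂) ρ (μ₁ + μ₂) ω t := by
  refine ((hasSymbol_prabhakarKernel hρ h₁ γ₁ ω).conv (hasSymbol_prabhakarKernel hρ h₂ γ₂ ω)).eqOn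
    (hasSymbol_prabhakarKernel hρ (add_pos h₁ h₂) (γ₁ + γ₂) ω) ?_ ht
  filter_upwards [eventually_one_sub_mul_rpow_pos ω hρ, eventually_gt_atTop 0] with s hs hs0
  rw [neg_add, neg_add, Real.rpow_add hs0, Real.rpow_add hs]
  ring

/-- The order `μ₁ ≥ 1` makes the first kernel bounded, so the identity holds at every `t` for an `F`
that is only integrable. The second operator may be the identity. -/
theorem prabhakarIntegral_conv (h₁ : 1 ≤ μ₁) (h₂ : 0 < μ₂ ∨ μ₂ = 0 ∧ γ₂ = 0) {F : ℝ → ℂ} {t : ℝ}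
    (ht : 0 < t) (hF : IntervalIntegrable F volume 0 t) :
    ∫ s in (0 : ℝ)..t, prabhakarKernel γ₁ ρ μ₁ ω (t - s) • prabhakarIntegral γ₂ ρ μ₂ ω F s =
      ∫ y in (0 : ℝ)..t, prabhakarKernel (γ₁ + γ₂) ρ (μ₁ + μ₂) ω (t - y) • F y := by
  rcases h₂ with h₂ | ⟨rfl, rfl⟩
  · have h1 : 0 < μ₁ := by linarith
    simp only [prabhakarIntegral, h₂.ne', false_and, if_false]
    obtain ⟨C, -, hC⟩ := exists_bound_prabhakarKernel hρ γ₁ h₁ ω t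
    rw [integral_conv_assoc ht.le (hasSymbol_prabhakarKernel hρ h1 γ₁ ω).continuousOn hC
      ((hasSymbol_prabhakarKernel hρ h₂ γ₂ ω).intervalIntegrable ht.le) hF,
      intervalIntegral.integral_of_le ht.le, intervalIntegral.integral_of_le ht.le,
      integral_Ioc_eq_integral_Ioo, integral_Ioc_eq_integral_Ioo]
    refine setIntegral_congr_fun measurableSet_Ioo fun y hy => ?_
    rw [prabhakarKernel_conv hρ h1 h₂ (sub_pos.2 hy.2)]
  · simp [prabhakarIntegral]

theorem intervalIntegrable_prabhakarIntegral (h₂ : 0 < μ₂ ∨ μ₂ = 0 ∧ γ₂ = 0) {F : ℝ → ℂ} {t : ℝ}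
    (ht : 0 < t) (hF : IntervalIntegrable F volume 0 t) :
    IntervalIntegrable (prabhakarIntegral γ₂ ρ μ₂ ω F) volume 0 t := by
  rcases h₂ with h₂ | ⟨rfl, rfl⟩
  · have := intervalIntegrable_conv_smul ht.le
      ((hasSymbol_prabhakarKernel hρ h₂ γ₂ ω).intervalIntegrable ht.le) hF
    refine this.congr fun s _ => ?_
    simp [prabhakarIntegral, h₂.ne']
  · refine hF.congr fun s _ => ?_
    simp [prabhakarIntegral]

theorem intervalIntegrable_kernel_smul (γ : ℝ) {μ : ℝ} (h : 1 ≤ μ) (ω : ℝ) {F : ℝ → ℂ} {t : ℝ}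
    (ht : 0 < t) (hF : IntervalIntegrable F volume 0 t) :
    IntervalIntegrable (fun s => prabhakarKernel γ ρ μ ω (t - s) • F s) volume 0 t := by
  obtain ⟨C, -, hC⟩ := exists_bound_prabhakarKernel hρ γ h ω t
  rw [intervalIntegrable_iff_integrableOn_Ioo_of_le ht.le] at hF ⊢
  refine Integrable.bdd_smul (φ := fun s => prabhakarKernel γ ρ μ ω (t - s)) hF C ?_ ?_
  · refine ContinuousOn.aestronglyMeasurable ?_ measurableSet_Ioo
    exact (hasSymbol_prabhakarKernel hρ (by linarith) γ ω).continuousOn.comp (by fun_prop)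
      fun s hs => sub_pos.2 hs.2
  · filter_upwards [ae_restrict_mem measurableSet_Ioo] with s hs
    exact hC _ ⟨sub_pos.2 hs.2, by linarith [hs.1]⟩

theorem prabhakarKernel_zero_one {t : ℝ} (ht : 0 < t) : prabhakarKernel 0 ρ 1 ω t = 1 := by
  refine (hasSymbol_prabhakarKernel hρ one_pos 0 ω).eqOn hasSymbol_one ?_ ht
  filter_upwards with s
  simp [Real.rpow_neg_one]

theorem prabhakarIntegral_zero_one (F : ℝ → ℂ) {t : ℝ} (ht : 0 < t) :
    prabhakarIntegral 0 ρ 1 ω F t = ∫ y in (0 : ℝ)..t, F y := by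
  simp only [prabhakarIntegral, one_ne_zero, false_and, if_false]
  rw [intervalIntegral.integral_of_le ht.le, intervalIntegral.integral_of_le ht.le,
      integral_Ioc_eq_integral_Ioo, integral_Ioc_eq_integral_Ioo]
  refine setIntegral_congr_fun measurableSet_Ioo fun y hy => ?_
  rw [prabhakarKernel_zero_one hρ (sub_pos.2 hy.2), one_smul]

end Semigroup

/-! ### The integrated form of the fractional equation -/

theorem intervalIntegrable_deriv_of_absolutelyContinuous {I F : ℝ → ℂ} {b : ℝ} (hb : 0 < b)
    (hF : AbsolutelyContinuousOnInterval F 0 b) (hIF : EqOn I F (Ioc 0 b))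
    (hI : ∀ t, 0 < t → DifferentiableAt ℝ I t) : IntervalIntegrable (deriv I) volume 0 b := by
  have hre : AbsolutelyContinuousOnInterval (fun t => (F t).re) 0 b :=
    hF.of_dist_le_add hF fun x y => by
      have : dist (F x).re (F y).re ≤ dist (F x) (F y) := by
        rw [Real.dist_eq, dist_eq_norm, ← Complex.sub_re]; exact Complex.abs_re_le_norm _
      linarith [dist_nonneg (x := F x) (y := F y)]
  have him : AbsolutelyContinuousOnInterval (fun t => (F t).im) 0 b :=
    hF.of_dist_le_add hF fun x y => by
      have : dist (F x).im (F y).im ≤ dist (F x) (F y) := by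
        rw [Real.dist_eq, dist_eq_norm, ← Complex.sub_im]; exact Complex.abs_im_le_norm _
      linarith [dist_nonneg (x := F x) (y := F y)]
  have h1 := hre.intervalIntegrable_deriv
  have h2 := him.intervalIntegrable_deriv
  rw [intervalIntegrable_iff_integrableOn_Ioo_of_le hb.le] at h1 h2 ⊢
  refine IntegrableOn.congr_fun (h1.ofReal.add (h2.ofReal.mul_const Complex.I))
    (fun t ht => ?_) measurableSet_Ioo
  have hev : F =ᶠ[𝓝 t] I := by
    filter_upwards [Ioo_mem_nhds ht.1 ht.2] with s hs
    exact (hIF ⟨hs.1, hs.2.le⟩).symm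
  have hd : HasDerivAt F (deriv I t) t := (hI t ht.1).hasDerivAt.congr_of_eventuallyEq hev
  have e1 : deriv (fun t => (F t).re) t = (deriv I t).re :=
    (Complex.reCLM.hasFDerivAt.comp_hasDerivAt t hd).deriv
  have e2 : deriv (fun t => (F t).im) t = (deriv I t).im :=
    (Complex.imCLM.hasFDerivAt.comp_hasDerivAt t hd).deriv
  simp only [Pi.add_apply, e1, e2]
  exact Complex.re_add_im _

/-- Apply one kernel to `I = c + ∫ I'`, with `I` the inner operator of `f`. Composed with the inner
operator it becomes the kernel of order `μn + 2`. Composed with the primitive of `I'` it is the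
kernel of order `μ(n+1) + 2` after the outer operator. The term in `c` depends only on the initial
value and cancels between two solutions. -/
theorem kernel_conv_eq_of_hilferPrabhakarDifferentiable {γ μ ν ρ ω : ℝ} (hρ : 0 < ρ)
    (hμ : μ ∈ Ioo (0 : ℝ) 1) (hν : ν ∈ Icc (0 : ℝ) 1) {f : ℝ → ℂ} {c : ℂ}
    (hf : HilferPrabhakarDifferentiable γ μ ν ρ ω f)
    (hc : Tendsto (hilferPrabhakarInner γ μ ν ρ ω f) (𝓝[>] 0) (𝓝 c)) {t : ℝ} (ht : 0 < t) :
    IntervalIntegrable (hilferPrabhakarDeriv γ μ ν ρ ω f) volume 0 t ∧ ∀ n : ℕ,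
    ∫ s in (0 : ℝ)..t, prabhakarKernel (γ * n) ρ (μ * n + 2) ω (t - s) • f s =
      (∫ s in (0 : ℝ)..t, prabhakarKernel (γ * (1 - ν) + γ * n) ρ
        (2 - (1 - ν) * (1 - μ) + μ * n) ω (t - s) • c) +
      ∫ s in (0 : ℝ)..t, prabhakarKernel (γ * (n + 1 : ℕ)) ρ (μ * (n + 1 : ℕ) + 2) ω (t - s) •
        hilferPrabhakarDeriv γ μ ν ρ ω f s := by
  have hμ0 := hμ.1
  have h1ν : 0 ≤ 1 - ν := sub_nonneg.2 hν.2
  have h1μ : 0 < 1 - μ := sub_pos.2 hμ.2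
  set I := hilferPrabhakarInner γ μ ν ρ ω f with hI
  obtain ⟨F, hF, hIF⟩ := hf.absolutelyContinuous t ht
  have hI' : IntervalIntegrable (deriv I) volume 0 t :=
    intervalIntegrable_deriv_of_absolutelyContinuous ht hF hIF hf.differentiable_inner
  have hout : 0 < ν * (1 - μ) ∨ ν * (1 - μ) = 0 ∧ -(γ * ν) = 0 := by
    rcases hν.1.eq_or_lt with rfl | h
    · right; simp
    · left; positivity
  have hin : 0 < (1 - ν) * (1 - μ) ∨ (1 - ν) * (1 - μ) = 0 ∧ -(γ * (1 - ν)) = 0 := by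
    rcases h1ν.eq_or_lt with h | h
    · right; simp [← h]
    · left; positivity
  refine ⟨intervalIntegrable_prabhakarIntegral hρ hout ht hI', fun n => ?_⟩
  have hIeq : ∀ s ∈ Ioc 0 t, I s = c + ∫ y in (0 : ℝ)..s, deriv I y := fun s hs => by
    rw [intervalIntegral.integral_eq_sub_of_hasDerivAt_of_tendsto hs.1
      (fun y hy => (hf.differentiable_inner y hy.1).hasDerivAt)
      (hI'.mono_set (by
        rw [uIcc_of_le hs.1.le, uIcc_of_le ht.le]; exact Icc_subset_Icc_right hs.2)) hc
      ((hf.differentiable_inner s hs.1).continuousAt.tendsto.mono_left nhdsWithin_le_nhds)]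
    ring
  -- The shift by `2` in the orders is there to make this kernel bounded for every `n`.
  have hd : 1 ≤ 2 - (1 - ν) * (1 - μ) + μ * n := by
    have : (1 - ν) * (1 - μ) ≤ 1 := by nlinarith [hν.1]
    have : 0 ≤ μ * n := by positivity
    linarith
  have he : 1 ≤ μ * (n + 1 : ℕ) + 2 := by
    have : 0 ≤ μ * (n + 1 : ℕ) := by positivity
    linarith
  have e1 := prabhakarIntegral_conv (γ₁ := γ * (1 - ν) + γ * n) (ω := ω) hρ hd hin ht
    (hf.integrable t ht)
  have e2 := prabhakarIntegral_conv (γ₁ := γ * (n + 1 : ℕ)) (ω := ω) hρ he hout ht hI'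
  have e3 := prabhakarIntegral_conv (γ₁ := γ * (1 - ν) + γ * n) (γ₂ := 0) (μ₂ := 1) (ω := ω) hρ hd
    (Or.inl one_pos) ht hI'
  have e4 : ∫ s in (0 : ℝ)..t, prabhakarKernel (γ * (1 - ν) + γ * n) ρ
      (2 - (1 - ν) * (1 - μ) + μ * n) ω (t - s) • I s =
      (∫ s in (0 : ℝ)..t, prabhakarKernel (γ * (1 - ν) + γ * n) ρ
      (2 - (1 - ν) * (1 - μ) + μ * n) ω (t - s) • c) +
      ∫ s in (0 : ℝ)..t, prabhakarKernel (γ * (1 - ν) + γ * n) ρ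
      (2 - (1 - ν) * (1 - μ) + μ * n) ω (t - s) • prabhakarIntegral 0 ρ 1 ω (deriv I) s := by
    rw [← intervalIntegral.integral_add
      (intervalIntegrable_kernel_smul hρ _ hd ω ht intervalIntegrable_const)
      (intervalIntegrable_kernel_smul hρ _ hd ω ht
        (intervalIntegrable_prabhakarIntegral hρ (Or.inl one_pos) ht hI')),
      intervalIntegral.integral_of_le ht.le, intervalIntegral.integral_of_le ht.le]
    refine setIntegral_congr_fun measurableSet_Ioc fun s hs => ?_
    rw [← smul_add, prabhakarIntegral_zero_one hρ _ hs.1, hIeq s hs]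
  have e5 : ∫ s in (0 : ℝ)..t, prabhakarKernel (γ * (n + 1 : ℕ)) ρ (μ * (n + 1 : ℕ) + 2) ω (t - s) •
        hilferPrabhakarDeriv γ μ ν ρ ω f s = _ := e2
  rw [e5]
  have e6 : γ * (1 - ν) + γ * n + -(γ * (1 - ν)) = γ * n := by ring
  have e7 : 2 - (1 - ν) * (1 - μ) + μ * n + (1 - ν) * (1 - μ) = μ * n + 2 := by ring
  have e8 : γ * (n + 1 : ℕ) + -(γ * ν) = γ * (1 - ν) + γ * n + 0 := by push_cast; ring
  have e9 : μ * (n + 1 : ℕ) + 2 + ν * (1 - μ) = 2 - (1 - ν) * (1 - μ) + μ * n + 1 := by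
    push_cast; ring
  rw [e6, e7] at e1
  rw [e8, e9, ← e3, ← e4, ← e1]
  rfl

/-! ### A bandlimited test function with geometric derivative bounds -/

section Bandlimited

open scoped ContDiff

/-- `(1 + x²) |𝓕 f x|` is at most the sum of the `L¹` norms of `f` and `f''`, and `1/(1 + x²)` has
integral `π`. -/
theorem integrable_fourier_of_compactSupport {f : ℝ → ℂ} (hf : ContDiff ℝ ∞ f)
    (hs : HasCompactSupport f) : Integrable (𝓕 f) ∧
      ∫ x, ‖𝓕 f x‖ ≤ Real.pi * ((∫ x, ‖f x‖) + ∫ x, ‖deriv (deriv f) x‖) := by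
  have hf1 : ContDiff ℝ ∞ (deriv f) := by
    simpa using hf.iterate_deriv 1
  have hf2 : ContDiff ℝ ∞ (deriv (deriv f)) := by
    simpa using hf1.iterate_deriv 1
  have i0 : Integrable f := hf.continuous.integrable_of_hasCompactSupport hs
  have i1 : Integrable (deriv f) := hf1.continuous.integrable_of_hasCompactSupport hs.deriv
  have i2 : Integrable (deriv (deriv f)) :=
    hf2.continuous.integrable_of_hasCompactSupport hs.deriv.deriv
  have e : ∀ x, 𝓕 (deriv (deriv f)) x = (2 * Real.pi * Complex.I * x) •
      ((2 * Real.pi * Complex.I * x) • 𝓕 f x) := fun x => by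
    rw [Real.fourier_deriv i1 (hf1.differentiable (by simp)) i2,
      Real.fourier_deriv i0 (hf.differentiable (by simp)) i1]
  have hle : ∀ (h : ℝ → ℂ) (x : ℝ), ‖𝓕 h x‖ ≤ ∫ x, ‖h x‖ := fun h x => by
    rw [Real.fourier_eq]
    refine (norm_integral_le_integral_norm _).trans_eq ?_
    simp
  have hb : ∀ x, ‖𝓕 f x‖ ≤ ((∫ x, ‖f x‖) + ∫ x, ‖deriv (deriv f) x‖) * (1 + x ^ 2)⁻¹ := fun x => by
    have h1 := hle f x
    have h2 := hle (deriv (deriv f)) x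
    rw [e x, norm_smul, norm_smul, ← mul_assoc] at h2
    have h3 : ‖(2 * Real.pi * Complex.I * x : ℂ)‖ = 2 * Real.pi * |x| := by
      simp [abs_of_pos Real.pi_pos]
    have h4 : x ^ 2 ≤ ‖(2 * Real.pi * Complex.I * x : ℂ)‖ * ‖(2 * Real.pi * Complex.I * x : ℂ)‖ := by
      rw [h3, ← sq, mul_pow, sq_abs]
      have : 1 ≤ (2 * Real.pi) ^ 2 := by nlinarith [Real.pi_gt_three]
      nlinarith [sq_nonneg x]
    rw [← div_eq_mul_inv, le_div_iff₀ (by positivity), mul_add, mul_one, mul_comm _ (x ^ 2)]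
    exact add_le_add h1 ((mul_le_mul_of_nonneg_right h4 (norm_nonneg _)).trans h2)
  have hi := (integrable_inv_one_add_sq).const_mul
    ((∫ x, ‖f x‖) + ∫ x, ‖deriv (deriv f) x‖)
  have hc : Continuous (𝓕 f) := by
    exact VectorFourier.fourierIntegral_continuous Real.continuous_fourierChar
      (by exact continuous_inner) i0
  have hint : Integrable (𝓕 f) := hi.mono' hc.aestronglyMeasurable (ae_of_all _ hb)
  refine ⟨hint, (integral_mono hint.norm hi hb).trans_eq ?_⟩
  rw [integral_const_mul, integral_univ_inv_one_add_sq, mul_comm]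

/-- Take `ψ k` to be the Fourier transform of `(-2πip)^k χ(p)` with `χ` a bump supported in
`[-1,1]`. On that support the powers of `p` are at most `1`, which leaves geometric growth in `k`.
-/
theorem exists_bandlimited : ∃ (ψ : ℕ → ℝ → ℂ) (C B : ℝ), 0 ≤ C ∧ 0 < B ∧
    (∀ k x, HasDerivAt (ψ k) (ψ (k + 1) x) x) ∧ (∀ k, Integrable (ψ k)) ∧
    (∀ k, ∫ x, ‖ψ k x‖ ≤ C * B ^ k) ∧ ∫ x, ψ 0 x ≠ 0 := by
  let χ : ContDiffBump (0 : ℝ) := ⟨1 / 2, 1, by norm_num, by norm_num⟩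
  set c : ℂ := -2 * Real.pi * Complex.I with hc
  have hcn : ‖c‖ = 2 * Real.pi := by simp [hc, abs_of_pos Real.pi_pos]
  have hχ : ContDiff ℝ ∞ (fun p => (χ p : ℂ)) := Complex.ofRealCLM.contDiff.comp χ.contDiff
  have hχs : HasCompactSupport (fun p => (χ p : ℂ)) :=
    χ.hasCompactSupport.comp_left (g := fun r : ℝ => (r : ℂ)) (by simp)
  have hχ1 : ContDiff ℝ ∞ (deriv fun p => (χ p : ℂ)) := by simpa using hχ.iterate_deriv 1
  have hχ2 : ContDiff ℝ ∞ (deriv (deriv fun p => (χ p : ℂ))) := by simpa using hχ1.iterate_deriv 1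
  let h : ℕ → ℝ → ℂ := fun k p => (c * p) ^ k * χ p
  have hh : ∀ k, ContDiff ℝ ∞ (h k) := fun k =>
    ((contDiff_const.mul Complex.ofRealCLM.contDiff).pow k).mul hχ
  have hhs : ∀ k, HasCompactSupport (h k) := fun k => hχs.mul_left
  have hhi : ∀ k, Integrable (h k) := fun k =>
    (hh k).continuous.integrable_of_hasCompactSupport (hhs k)
  have hsupp : ∀ k p, p ∉ Icc (-1 : ℝ) 1 → h k p = 0 := fun k p hp => by
    have : χ p = 0 := χ.zero_of_le_dist (by
      rw [Real.dist_eq, sub_zero]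
      by_contra! hlt
      exact hp ⟨(abs_lt.1 hlt).1.le, (abs_lt.1 hlt).2.le⟩)
    simp [h, this]
  have hd2 : ∀ k p, p ∉ Icc (-1 : ℝ) 1 → deriv (deriv (h k)) p = 0 := fun k p hp => by
    have h0 : h k =ᶠ[𝓝 p] fun _ => 0 := by
      filter_upwards [isClosed_Icc.isOpen_compl.mem_nhds hp] with q hq using hsupp k q hq
    have h1 := h0.deriv.deriv.eq_of_nhds
    simpa using h1
  obtain ⟨M₀, hM₀⟩ := hχ.continuous.bounded_above_of_compact_support hχs
  obtain ⟨M₁, hM₁⟩ := hχ1.continuous.bounded_above_of_compact_support hχs.deriv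
  obtain ⟨M₂, hM₂⟩ := hχ2.continuous.bounded_above_of_compact_support hχs.deriv.deriv
  have n0 := (norm_nonneg _).trans (hM₀ 0)
  have n1 := (norm_nonneg _).trans (hM₁ 0)
  have n2 := (norm_nonneg _).trans (hM₂ 0)
  set M := M₀ + M₁ + M₂ with hM
  have hpow : ∀ k : ℕ, ∀ p ∈ Icc (-1 : ℝ) 1, ‖(p : ℂ) ^ k‖ ≤ 1 := fun k p hp => by
    rw [norm_pow, Complex.norm_real, Real.norm_eq_abs]
    exact pow_le_one₀ (abs_nonneg _) (abs_le.2 hp)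
  -- The truncated exponents `k - 1` and `k - 1 - 1` are harmless: whenever truncation occurs, the
  -- coefficient in front is zero.
  have hderiv : ∀ k p, deriv (deriv (h k)) p = c ^ k * ((k * (k - 1 : ℕ) * (p : ℂ) ^ (k - 1 - 1)) * χ p +
      2 * (k * (p : ℂ) ^ (k - 1)) * deriv (fun p => (χ p : ℂ)) p +
      (p : ℂ) ^ k * deriv (deriv fun p => (χ p : ℂ)) p) := by
    intro k
    have d0 : ∀ (j : ℕ) (p : ℝ), HasDerivAt (fun p : ℝ => (p : ℂ) ^ j) (j * (p : ℂ) ^ (j - 1)) p :=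
      fun j p => by simpa using (hasDerivAt_pow j (p : ℂ)).comp_ofReal
    have d1 : ∀ p, HasDerivAt (fun p => (χ p : ℂ)) (deriv (fun p => (χ p : ℂ)) p) p := fun p =>
      (hχ.differentiable (by simp) p).hasDerivAt
    have d2 : ∀ p, HasDerivAt (deriv fun p => (χ p : ℂ)) (deriv (deriv fun p => (χ p : ℂ)) p) p :=
      fun p => (hχ1.differentiable (by simp) p).hasDerivAt
    have e1 : deriv (h k) = fun p : ℝ => c ^ k * ((k * (p : ℂ) ^ (k - 1)) * χ p +
        (p : ℂ) ^ k * deriv (fun p => (χ p : ℂ)) p) := by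
      ext p
      have : h k = fun p : ℝ => c ^ k * ((p : ℂ) ^ k * χ p) := by
        ext p; simp only [h]; ring
      rw [this]
      exact (((d0 k p).mul (d1 p)).const_mul _).deriv
    intro p
    rw [e1]
    have := (((((d0 (k - 1) p).const_mul (k : ℂ)).mul (d1 p)).add
      ((d0 k p).mul (d2 p))).const_mul (c ^ k)).deriv
    refine Eq.trans this ?_
    ring
  have hbound : ∀ k p, ‖deriv (deriv (h k)) p‖ ≤ M * (8 * Real.pi) ^ k := by
    intro k p
    by_cases hp : p ∈ Icc (-1 : ℝ) 1
    · have hk : ((k : ℝ) + 1) ^ 2 ≤ 4 ^ k := by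
        have h2 : (k : ℝ) + 1 ≤ 2 ^ k := by exact_mod_cast Nat.lt_two_pow_self (n := k)
        calc ((k : ℝ) + 1) ^ 2 ≤ (2 ^ k) ^ 2 := by gcongr
          _ = 4 ^ k := by rw [← pow_mul, mul_comm, pow_mul]; norm_num
      have hk1 : ((k - 1 : ℕ) : ℝ) ≤ k := by exact_mod_cast Nat.sub_le k 1
      have b0 : ‖(k * (k - 1 : ℕ) * (p : ℂ) ^ (k - 1 - 1)) * χ p‖ ≤ ((k : ℝ) * k) * M := by
        rw [norm_mul, norm_mul, norm_mul, Complex.norm_natCast, Complex.norm_natCast]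
        have := hM₀ p
        have := hpow (k - 1 - 1) p hp
        calc (k : ℝ) * (k - 1 : ℕ) * ‖(p : ℂ) ^ (k - 1 - 1)‖ * ‖(χ p : ℂ)‖
            ≤ (k : ℝ) * k * 1 * M := by gcongr; linarith
          _ = _ := by ring
      have b1 : ‖2 * (k * (p : ℂ) ^ (k - 1)) * deriv (fun p => (χ p : ℂ)) p‖ ≤ (2 * k) * M := by
        rw [norm_mul, norm_mul, norm_mul, Complex.norm_natCast]
        have := hM₁ p
        have := hpow (k - 1) p hp
        calc ‖(2 : ℂ)‖ * ((k : ℝ) * ‖(p : ℂ) ^ (k - 1)‖) * ‖deriv (fun p => (χ p : ℂ)) p‖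
            ≤ ‖(2 : ℂ)‖ * (k * 1) * M := by gcongr; linarith
          _ = _ := by simp
      have b2 : ‖(p : ℂ) ^ k * deriv (deriv fun p => (χ p : ℂ)) p‖ ≤ M := by
        rw [norm_mul]
        have := hM₂ p
        have := hpow k p hp
        calc _ ≤ 1 * M := by gcongr; linarith
          _ = _ := one_mul _
      rw [hderiv, norm_mul, norm_pow, hcn]
      calc _ ≤ (2 * Real.pi) ^ k * (k * k * M + 2 * k * M + M) := by
            gcongr
            exact (norm_add₃_le).trans (by linarith)
        _ = (2 * Real.pi) ^ k * (((k : ℝ) + 1) ^ 2 * M) := by ring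
        _ ≤ (2 * Real.pi) ^ k * (4 ^ k * M) := by gcongr
        _ = _ := by rw [show 8 * Real.pi = 2 * Real.pi * 4 by ring, mul_pow (2 * Real.pi)]; ring
    · rw [hd2 k p hp, norm_zero]; positivity
  have hbound0 : ∀ k p, ‖h k p‖ ≤ M * (8 * Real.pi) ^ k := by
    intro k p
    by_cases hp : p ∈ Icc (-1 : ℝ) 1
    · simp only [h]
      rw [mul_pow, norm_mul, norm_mul, norm_pow, hcn]
      have := hM₀ p
      have := hpow k p hp
      calc (2 * Real.pi) ^ k * ‖(p : ℂ) ^ k‖ * ‖(χ p : ℂ)‖ ≤ (8 * Real.pi) ^ k * 1 * M := by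
            gcongr
            · linarith [Real.pi_pos]
            · linarith
        _ = _ := by ring
    · rw [hsupp k p hp, norm_zero]; positivity
  have hL1 : ∀ (f : ℝ → ℂ) (A : ℝ), (∀ p, ‖f p‖ ≤ A) → (∀ p, p ∉ Icc (-1 : ℝ) 1 → f p = 0) →
      ∫ p, ‖f p‖ ≤ A * 2 := by
    intro f A h1 h2
    rw [← setIntegral_eq_integral_of_forall_compl_eq_zero (s := Icc (-1 : ℝ) 1)
      fun p hp => by rw [h2 p hp, norm_zero]]
    have := norm_setIntegral_le_of_norm_le_const (μ := volume) (s := Icc (-1 : ℝ) 1)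
      (f := fun p => ‖f p‖) (C := A) (by simp) fun p _ => by rw [norm_norm]; exact h1 p
    refine (le_abs_self _).trans (this.trans_eq ?_)
    norm_num [Measure.real]
  refine ⟨fun k => 𝓕 (h k), Real.pi * (M * 2 + M * 2), 8 * Real.pi, by positivity, by positivity,
    fun k x => ?_, fun k => (integrable_fourier_of_compactSupport (hh k) (hhs k)).1, fun k => ?_, ?_⟩
  · have := Real.hasDerivAt_fourier (hhi k) (f := h k) (by
      refine ((continuous_id.smul (hh k).continuous).integrable_of_hasCompactSupport
        (hhs k).smul_left)) x
    have he : (fun p : ℝ => (-2 * Real.pi * Complex.I * p : ℂ) • h k p) = h (k + 1) := by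
      ext p
      simp only [h, hc, smul_eq_mul]
      ring
    rwa [he] at this
  · refine (integrable_fourier_of_compactSupport (hh k) (hhs k)).2.trans ?_
    rw [mul_assoc]
    refine mul_le_mul_of_nonneg_left ?_ Real.pi_pos.le
    have := hL1 _ _ (hbound0 k) (hsupp k)
    have := hL1 _ _ (hbound k) (hd2 k)
    linarith
  · have h1 := congrFun ((hh 0).continuous.fourierInv_fourier_eq (hhi 0)
      (integrable_fourier_of_compactSupport (hh 0) (hhs 0)).1) 0
    rw [Real.fourierInv_eq] at h1
    have h2 : h 0 0 = 1 := by
      simp only [h, pow_zero, one_mul]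
      rw [χ.one_of_mem_closedBall (by simp [χ])]
      simp
    simp only [inner_zero_right, AddChar.map_zero_eq_one, one_smul, h2] at h1
    rw [h1]
    exact one_ne_zero

end Bandlimited

/-! ### Sequences of bounded second primitives -/

/-- Landau's inequality on a unit step: `v(x+1) - v(x)` differs from `v'(x)` by at most the bound on
`v''`. It supplies the bounded first derivative needed for integration by parts on the line. -/
theorem norm_deriv_le_of_second_deriv {v v' w : ℝ → ℂ} {A B : ℝ}
    (h1 : ∀ x, HasDerivAt v (v' x) x) (h2 : ∀ x, HasDerivAt v' (w x) x)
    (hA : ∀ x, ‖v x‖ ≤ A) (hB : ∀ x, ‖w x‖ ≤ B) (x : ℝ) : ‖v' x‖ ≤ 2 * A + B := by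
  have hv' : ∀ y ∈ Icc x (x + 1), ‖v' y - v' x‖ ≤ B := fun y hy => by
    have := (convex_Icc x (x + 1)).norm_image_sub_le_of_norm_hasDerivWithin_le
      (fun z _ => (h2 z).hasDerivWithinAt) (fun z _ => hB z) (left_mem_Icc.2 (by linarith)) hy
    refine this.trans (mul_le_of_le_one_right ((norm_nonneg _).trans (hB 0)) ?_)
    rw [Real.norm_eq_abs, abs_le]
    constructor <;> linarith [hy.1, hy.2]
  have := (convex_Icc x (x + 1)).norm_image_sub_le_of_norm_hasDerivWithin_le
      (f := fun y : ℝ => v y - y * v' x) (f' := fun y => v' y - v' x)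
      (fun z _ => ((h1 z).sub (((hasDerivAt_id (z : ℂ)).comp_ofReal.mul_const (v' x)).congr_deriv
        (one_mul _))).hasDerivWithinAt)
      hv' (left_mem_Icc.2 (by linarith)) (right_mem_Icc.2 (by linarith))
  have e : v' x = (v (x + 1) - v x) - ((v (x + 1) - ((x + 1 : ℝ) : ℂ) * v' x) - (v x - x * v' x)) := by
    push_cast; ring
  rw [add_sub_cancel_left, norm_one, mul_one] at this
  rw [e]
  refine (norm_sub_le _ _).trans (add_le_add ((norm_sub_le _ _).trans ?_) this)
  linarith [hA x, hA (x + 1)]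

theorem integral_mul_second_deriv {v v' w p₀ p₁ p₂ : ℝ → ℂ} {A B : ℝ}
    (h1 : ∀ x, HasDerivAt v (v' x) x) (h2 : ∀ x, HasDerivAt v' (w x) x) (hw : Continuous w)
    (hA : ∀ x, ‖v x‖ ≤ A) (hB : ∀ x, ‖w x‖ ≤ B)
    (k1 : ∀ x, HasDerivAt p₀ (p₁ x) x) (k2 : ∀ x, HasDerivAt p₁ (p₂ x) x)
    (i0 : Integrable p₀) (i1 : Integrable p₁) (i2 : Integrable p₂) :
    ∫ x, p₀ x * w x = ∫ x, p₂ x * v x := by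
  have hv : Continuous v := continuous_iff_continuousAt.2 fun x => (h1 x).continuousAt
  have hv' : Continuous v' := continuous_iff_continuousAt.2 fun x => (h2 x).continuousAt
  have hC := norm_deriv_le_of_second_deriv h1 h2 hA hB
  have key : ∀ {p q : ℝ → ℂ} {D : ℝ}, Integrable p → Continuous q → (∀ x, ‖q x‖ ≤ D) →
      Integrable (p * q) := fun {p q D} hp hq hD => by
    rw [mul_comm]
    exact hp.bdd_smul (φ := q) D hq.aestronglyMeasurable (ae_of_all _ hD)
  rw [integral_mul_deriv_eq_deriv_mul_of_integrable (fun x _ => k1 x) (fun x _ => h2 x)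
    (key i0 hw hB) (key i1 hv' hC) (key i0 hv' hC),
    integral_mul_deriv_eq_deriv_mul_of_integrable (fun x _ => k2 x) (fun x _ => h1 x)
    (key i1 hv' hC) (key i2 hv hA) (key i1 hv hA), neg_neg]

/-- Moving `2n` derivatives onto a bandlimited test function at scale `ε` costs a fixed geometric
factor, while `a n` decays faster than any such factor; so every pairing vanishes, and `ε → 0`
recovers the point value. -/
theorem eq_zero_of_bounded_second_primitives {Z Z' : ℕ → ℝ → ℂ} {a : ℕ → ℝ} {c : ℂ} (hc : c ≠ 0)
    (hZ : Continuous (Z 0))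
    (h1 : ∀ n x, HasDerivAt (Z (n + 1)) (Z' n x) x) (h2 : ∀ n x, HasDerivAt (Z' n) (c * Z n x) x)
    (hb : ∀ n x, ‖Z n x‖ ≤ a n) (ha : ∀ Λ, 0 ≤ Λ → ∃ C, ∀ n, Λ ^ n * a n ≤ C) (x : ℝ) :
    Z 0 x = 0 := by
  obtain ⟨ψ, C, B, hC, hB, hψ, hψi, hψC, hψ0⟩ := exists_bandlimited
  have hcont : ∀ n, Continuous (Z n) := fun n => by
    cases n with
    | zero => exact hZ
    | succ n => exact continuous_iff_continuousAt.2 fun x => (h1 n x).continuousAt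
  have key : ∀ ε : ℝ, 0 < ε → ∫ y, ψ 0 y * Z 0 (x + ε * y) = 0 := by
    intro ε hε
    have hlin : ∀ y : ℝ, HasDerivAt (fun y : ℝ => x + ε * y) ε y := fun y => by
      simpa using ((hasDerivAt_id y).const_mul ε).const_add x
    set q : ℂ := ε ^ 2 * c with hq
    have hq0 : 0 < ‖q‖ := norm_pos_iff.2 (mul_ne_zero (by exact_mod_cast (pow_pos hε 2).ne') hc)
    have hstep : ∀ n, q ^ n * ∫ y, ψ 0 y * Z 0 (x + ε * y) = ∫ y, ψ (2 * n) y * Z n (x + ε * y) := by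
      intro n
      induction n with
      | zero => simp
      | succ n ih =>
        have := integral_mul_second_deriv (v := fun y => Z (n + 1) (x + ε * y))
          (v' := fun y => ε * Z' n (x + ε * y)) (w := fun y => q * Z n (x + ε * y))
          (A := a (n + 1)) (B := ‖q‖ * a n) (p₀ := ψ (2 * n))
          (fun y => (h1 n (x + ε * y)).scomp y (hlin y))
          (fun y => by
            have := ((h2 n (x + ε * y)).scomp y (hlin y)).const_mul (ε : ℂ)
            refine this.congr_deriv ?_
            rw [hq, Complex.real_smul]; ring)
          (continuous_const.mul ((hcont n).comp (by fun_prop)))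
          (fun y => hb _ _) (fun y => by rw [norm_mul]; gcongr; exact hb _ _)
          (hψ _) (hψ _) (hψi _) (hψi _) (hψi _)
        rw [pow_succ', mul_assoc, ih, ← integral_const_mul]
        refine Eq.trans ?_ this
        congr 1 with y
        ring
    have hle : ∀ n, ‖q‖ ^ n * ‖∫ y, ψ 0 y * Z 0 (x + ε * y)‖ ≤ C * B ^ (2 * n) * a n := by
      intro n
      rw [← norm_pow, ← norm_mul, hstep]
      refine (norm_integral_le_of_norm_le ((hψi (2 * n)).norm.mul_const (a n))
        (ae_of_all _ fun y => ?_)).trans ?_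
      · rw [norm_mul]; gcongr; exact hb _ _
      · rw [integral_mul_const]
        exact mul_le_mul_of_nonneg_right (hψC _) ((norm_nonneg _).trans (hb n 0))
    -- `B² / ‖q‖` is the geometric loss per step; the extra factor `2` leaves `2^(-n)`.
    obtain ⟨D, hD⟩ := ha (2 * (B ^ 2 / ‖q‖)) (by positivity)
    have hlim : Tendsto (fun n : ℕ => C * D * (1 / 2 : ℝ) ^ n) atTop (𝓝 0) := by
      simpa using (tendsto_pow_atTop_nhds_zero_of_lt_one (by norm_num : (0 : ℝ) ≤ 1 / 2)
        (by norm_num)).const_mul (C * D)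
    refine norm_le_zero_iff.1 (ge_of_tendsto' hlim fun n => ?_)
    have e1 := hle n
    have e2 := mul_le_mul_of_nonneg_left (hD n) (by positivity : 0 ≤ C * (1 / 2) ^ n)
    refine le_of_mul_le_mul_left ((e1.trans_eq ?_).trans
      (mul_le_mul_of_nonneg_left e2 (by positivity : 0 ≤ ‖q‖ ^ n)) |>.trans_eq ?_)
      (by positivity : 0 < ‖q‖ ^ n)
    · rw [mul_pow, div_pow, div_pow, one_pow, pow_mul]
      field_simp
    · ring
  have hlim : Tendsto (fun m : ℕ => ∫ y, ψ 0 y * Z 0 (x + (1 / ((m : ℝ) + 1)) * y)) atTop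
      (𝓝 (∫ y, ψ 0 y * Z 0 x)) := by
    refine tendsto_integral_of_dominated_convergence (fun y => ‖ψ 0 y‖ * a 0) (fun m => ?_)
      ((hψi 0).norm.mul_const _) (fun m => ae_of_all _ fun y => ?_) (ae_of_all _ fun y => ?_)
    · exact (hψi 0).aestronglyMeasurable.mul
        (hZ.comp (by fun_prop)).aestronglyMeasurable
    · rw [norm_mul]; gcongr; exact hb _ _
    · refine Tendsto.const_mul _ ((hZ.tendsto x).comp ?_)
      simpa using (tendsto_one_div_add_atTop_nhds_zero_nat.mul_const y).const_add x
  simp only [key _ Nat.one_div_pos_of_nat, integral_mul_const] at hlim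
  exact (mul_eq_zero.1 (tendsto_nhds_unique hlim tendsto_const_nhds)).resolve_left hψ0

theorem taylor_sub_eq {v : ℝ → ℂ} (hv : ContDiff ℝ 2 v) (x : ℝ) :
    v x = v 0 + x * deriv v 0 + ∫ ξ in (0 : ℝ)..x, ((x - ξ : ℝ) : ℂ) * iteratedDeriv 2 v ξ := by
  have h1 : ContDiff ℝ 1 (deriv v) := by simpa using hv.iterate_deriv' 1 1
  have e2 : iteratedDeriv 2 v = deriv (deriv v) := by rw [iteratedDeriv_succ, iteratedDeriv_one]
  have c2 : Continuous (deriv (deriv v)) := h1.continuous_deriv le_rfl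
  have d1 : ∀ y, HasDerivAt v (deriv v y) y := fun y => (hv.differentiable (by simp) y).hasDerivAt
  have d2 : ∀ y, HasDerivAt (deriv v) (deriv (deriv v) y) y := fun y =>
    (h1.differentiable (by simp) y).hasDerivAt
  have d0 : ∀ y : ℝ, HasDerivAt (fun ξ : ℝ => ((x - ξ : ℝ) : ℂ)) (-1) y := fun y => by
    simpa using ((hasDerivAt_id y).const_sub x).ofReal_comp
  have ibp := intervalIntegral.integral_mul_deriv_eq_deriv_mul (a := 0) (b := x)
    (fun y _ => d0 y) (fun y _ => d2 y) intervalIntegrable_const (c2.intervalIntegrable _ _)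
  have ftc := intervalIntegral.integral_eq_sub_of_hasDerivAt (a := 0) (b := x) (fun y _ => d1 y)
    (h1.continuous.intervalIntegrable _ _)
  rw [e2, ibp]
  simp only [neg_mul, one_mul, intervalIntegral.integral_neg, ftc]
  simp
  ring

theorem hasDerivAt_integral_sub_mul {V : ℝ → ℂ} (hV : Continuous V) (x : ℝ) :
    HasDerivAt (fun x : ℝ => ∫ ξ in (0 : ℝ)..x, ((x - ξ : ℝ) : ℂ) * V ξ)
      (∫ ξ in (0 : ℝ)..x, V ξ) x := by
  have e : (fun x : ℝ => ∫ ξ in (0 : ℝ)..x, ((x - ξ : ℝ) : ℂ) * V ξ) = fun x : ℝ =>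
      x * (∫ ξ in (0 : ℝ)..x, V ξ) - ∫ ξ in (0 : ℝ)..x, ξ * V ξ := by
    ext x
    have i1 : IntervalIntegrable (fun ξ => (x : ℂ) * V ξ) volume 0 x :=
      (continuous_const.mul hV).intervalIntegrable _ _
    have i2 : IntervalIntegrable (fun ξ : ℝ => (ξ : ℂ) * V ξ) volume 0 x :=
      (Complex.continuous_ofReal.mul hV).intervalIntegrable _ _
    rw [← intervalIntegral.integral_const_mul, ← intervalIntegral.integral_sub i1 i2]
    congr 1 with ξ
    push_cast; ring
  rw [e]
  have h1 := hV.integral_hasStrictDerivAt 0 x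
  have h2 := (Complex.continuous_ofReal.mul hV).integral_hasStrictDerivAt 0 x
  refine (((hasDerivAt_id (x : ℂ)).comp_ofReal.mul h1.hasDerivAt).sub h2.hasDerivAt).congr_deriv ?_
  simp

/-- Differentiation under the integral without any integrability assumption on `w_x`. Taylor's
formula at `0` contains `w_x(0,s)`; subtracting `x` times the formula at `1` eliminates it. What is
left involves only `w` and `w_xx`, so Fubini applies. -/
theorem hasDerivAt_setIntegral_smul {w : ℝ → ℝ → ℂ} {e : ℝ → ℝ} {t C : ℝ} {m : ℝ → ℝ} {V : ℝ → ℂ}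
    (he : ContinuousOn e (Ioo 0 t)) (heC : ∀ s ∈ Ioo 0 t, |e s| ≤ C)
    (hc : ∀ x, ContinuousOn (w x) (Ioo 0 t)) (hw : ∀ s ∈ Ioo 0 t, ContDiff ℝ 2 (fun x => w x s))
    (hm : IntegrableOn m (Ioo 0 t)) (hle : ∀ x, ∀ s ∈ Ioo 0 t, ‖w x s‖ ≤ m s)
    (hxx : ∀ R, 0 < R → IntegrableOn (fun q : ℝ × ℝ => iteratedDeriv 2 (fun ξ => w ξ q.2) q.1)
      (Icc (-R) R ×ˢ Ioo 0 t))
    (hV : Continuous V)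
    (hVe : ∀ x, ∫ s in Ioo 0 t, e s • iteratedDeriv 2 (fun ξ => w ξ s) x = V x) :
    ∃ A : ℂ, ∀ x, HasDerivAt (fun x => ∫ s in Ioo 0 t, e s • w x s)
      (A + ∫ ξ in (0 : ℝ)..x, V ξ) x := by
  have hem := he.aestronglyMeasurable (μ := volume) measurableSet_Ioo
  have heC' : ∀ᵐ s ∂volume.restrict (Ioo 0 t), ‖e s‖ ≤ C := by
    filter_upwards [ae_restrict_mem measurableSet_Ioo] with s hs using heC s hs
  have hwi : ∀ x, IntegrableOn (fun s => e s • w x s) (Ioo 0 t) := fun x =>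
    Integrable.bdd_smul (φ := e) (hm.mono' ((hc x).aestronglyMeasurable measurableSet_Ioo)
      ((ae_restrict_iff' measurableSet_Ioo).2 (ae_of_all _ (hle x)))) C hem heC'
  set P : ℝ → ℝ → ℂ := fun x s => ∫ ξ in (0 : ℝ)..x, e s • (((x - ξ : ℝ) : ℂ) *
    iteratedDeriv 2 (fun ξ => w ξ s) ξ) with hP
  have hprod : ∀ x, Integrable (Function.uncurry fun (ξ s : ℝ) => e s • (((x - ξ : ℝ) : ℂ) *
      iteratedDeriv 2 (fun ξ => w ξ s) ξ))
      ((volume.restrict (uIoc 0 x)).prod (volume.restrict (Ioo 0 t))) := by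
    intro x
    have hsub : uIoc 0 x ⊆ Icc (-(|x| + 1)) (|x| + 1) := fun ξ hξ => by
      rw [mem_uIoc] at hξ
      rcases hξ with h | h <;> constructor <;> linarith [le_abs_self x, neg_abs_le x, h.1, h.2]
    have h0 := (hxx (|x| + 1) (by positivity)).mono_set (prod_mono hsub (subset_refl (Ioo 0 t)))
    rw [IntegrableOn, Measure.volume_eq_prod, ← Measure.prod_restrict] at h0
    have h1 := h0.bdd_smul (φ := fun q : ℝ × ℝ => (((x - q.1 : ℝ) : ℂ))) (2 * |x|)
      (by fun_prop) (by
        rw [Measure.prod_restrict]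
        filter_upwards [ae_restrict_mem (measurableSet_uIoc.prod measurableSet_Ioo)] with q hq
        have := hq.1
        rw [Complex.norm_real, Real.norm_eq_abs, abs_le]
        rw [mem_uIoc] at this
        rcases this with h | h <;> constructor <;>
          linarith [le_abs_self x, neg_abs_le x, h.1, h.2])
    refine h1.bdd_smul (φ := fun q : ℝ × ℝ => e q.2) C hem.comp_snd ?_
    exact Measure.quasiMeasurePreserving_snd.ae heC'
  have hPi : ∀ x, IntegrableOn (P x) (Ioo 0 t) ∧
      ∫ s in Ioo 0 t, P x s = ∫ ξ in (0 : ℝ)..x, ((x - ξ : ℝ) : ℂ) * V ξ := by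
    intro x
    constructor
    · have := (hprod x).integral_prod_right
      simp only [hP, intervalIntegral.intervalIntegral_eq_integral_uIoc]
      exact this.smul _
    · simp only [hP]
      rw [← intervalIntegral_integral_swap (hprod x)]
      congr 1 with ξ
      rw [← hVe, ← integral_const_mul]
      congr 1 with s
      simp only [Complex.real_smul]
      ring
  have htaylor : ∀ x, ∀ s ∈ Ioo 0 t, e s • w x s - e s • w 0 s - x * (e s • w 1 s - e s • w 0 s) =
      P x s - x * P 1 s := by
    intro x s hs
    have h1 := taylor_sub_eq (hw s hs) x
    have h2 := taylor_sub_eq (hw s hs) 1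
    simp only [hP, intervalIntegral.integral_smul]
    rw [h1, h2]
    simp only [Complex.real_smul]
    push_cast
    ring
  set W : ℝ → ℂ := fun x => ∫ s in Ioo 0 t, e s • w x s with hW
  set A : ℂ := W 1 - W 0 - ∫ ξ in (0 : ℝ)..1, ((1 - ξ : ℝ) : ℂ) * V ξ with hA
  have hWeq : W = fun x : ℝ => W 0 + x * A + ∫ ξ in (0 : ℝ)..x, ((x - ξ : ℝ) : ℂ) * V ξ := by
    ext x
    have h := setIntegral_congr_fun (μ := volume) measurableSet_Ioo (htaylor x)
    have i1 : ∀ x, IntegrableOn (fun s => e s • w x s - e s • w 0 s) (Ioo 0 t) := fun x =>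
      (hwi x).sub (hwi 0)
    rw [integral_sub (i1 x) ((i1 1).const_mul _), integral_sub (hwi x) (hwi 0), integral_const_mul, integral_sub (hwi 1) (hwi 0),
      integral_sub (hPi x).1 ((hPi 1).1.const_mul _), integral_const_mul, (hPi x).2, (hPi 1).2] at h
    simp only [hA, hW]
    linear_combination h
  refine ⟨A, fun x => ?_⟩
  rw [hWeq]
  refine ((((hasDerivAt_id (x : ℂ)).comp_ofReal.mul_const A).const_add (W 0)).add
    (hasDerivAt_integral_sub_mul hV x)).congr_deriv ?_
  simp

theorem eq_zero_of_forall_integral_eq_zero {f : ℝ → ℂ} (hc : ContinuousOn f (Ioi 0))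
    (hi : ∀ t, 0 < t → IntervalIntegrable f volume 0 t)
    (h0 : ∀ t, 0 < t → ∫ y in (0 : ℝ)..t, f y = 0) {t : ℝ} (ht : 0 < t) : f t = 0 := by
  have h1 := intervalIntegral.integral_hasDerivAt_right (hi t ht)
    (hc.stronglyMeasurableAtFilter isOpen_Ioi t ht) (hc.continuousAt (Ioi_mem_nhds ht))
  have h2 : HasDerivAt (fun u => ∫ y in (0 : ℝ)..u, f y) 0 t :=
    (hasDerivAt_const t (0 : ℂ)).congr_of_eventuallyEq (by
      filter_upwards [Ioi_mem_nhds ht] with s hs using h0 s hs)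
  exact h1.unique h2

/-- The kernel of order `2` and upper index `0` produces the double primitive, which is
differentiated twice. -/
theorem eq_zero_of_forall_kernel_two_conv_eq_zero {ρ ω : ℝ} (hρ : 0 < ρ) {f : ℝ → ℂ}
    (hc : ContinuousOn f (Ioi 0)) (hi : ∀ t, 0 < t → IntervalIntegrable f volume 0 t)
    (h0 : ∀ t, 0 < t → ∫ s in (0 : ℝ)..t, prabhakarKernel 0 ρ 2 ω (t - s) • f s = 0)
    {t : ℝ} (ht : 0 < t) : f t = 0 := by
  have hprim : ContinuousOn (fun s => ∫ y in (0 : ℝ)..s, f y) (Ioi 0) := fun s hs => by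
    have := intervalIntegral.integral_hasDerivAt_right (hi s hs)
      (hc.stronglyMeasurableAtFilter isOpen_Ioi s hs) (hc.continuousAt (Ioi_mem_nhds hs))
    exact this.continuousAt.continuousWithinAt
  refine eq_zero_of_forall_integral_eq_zero hc hi (fun s hs => ?_) ht
  refine eq_zero_of_forall_integral_eq_zero hprim (fun t ht => ?_) (fun t ht => ?_) hs
  · exact (intervalIntegral.continuousOn_primitive_interval' (hi t ht)
      left_mem_uIcc).intervalIntegrable
  · have h1 := prabhakarIntegral_conv (γ₁ := 0) (γ₂ := 0) (μ₁ := 1) (μ₂ := 1) (ω := ω) hρ le_rfl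
      (Or.inl one_pos) ht (hi t ht)
    rw [zero_add, one_add_one_eq_two, h0 t ht] at h1
    have h2 := prabhakarIntegral_zero_one (ω := ω) hρ (prabhakarIntegral 0 ρ 1 ω f) ht
    rw [prabhakarIntegral, if_neg (by simp), h1, intervalIntegral.integral_of_le ht.le] at h2
    rw [intervalIntegral.integral_of_le ht.le, h2]
    exact setIntegral_congr_fun measurableSet_Ioc fun s hs =>
      (prabhakarIntegral_zero_one hρ f hs.1).symm

/-! ### Uniqueness among admissible solutions -/

section Uniqueness

variable {γ μ ν ρ ω K : ℝ} (hμ : μ ∈ Ioo (0 : ℝ) 1) (hν : ν ∈ Icc (0 : ℝ) 1) (hρ : 0 < ρ)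
  {g : ℝ → ℂ} {v u : ℝ → ℝ → ℂ}
  (hv : IsDiffusionSolution γ μ ν ρ ω K g v) (hu : IsDiffusionSolution γ μ ν ρ ω K g u)

include hμ hν hρ hv hu in
theorem IsDiffusionSolution.kernel_conv_sub (n : ℕ) (x : ℝ) {t : ℝ} (ht : 0 < t) :
    ∫ s in Ioo 0 t, prabhakarKernel (γ * n) ρ (μ * n + 2) ω (t - s) • (v x s - u x s) =
      K * ∫ s in Ioo 0 t, prabhakarKernel (γ * (n + 1 : ℕ)) ρ (μ * (n + 1 : ℕ) + 2) ω (t - s) •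
        iteratedDeriv 2 (fun ξ => v ξ s - u ξ s) x := by
  obtain ⟨i1, e1⟩ := kernel_conv_eq_of_hilferPrabhakarDifferentiable hρ hμ hν
    (hv.differentiable_time x) (hv.initial x) ht
  obtain ⟨i2, e2⟩ := kernel_conv_eq_of_hilferPrabhakarDifferentiable hρ hμ hν
    (hu.differentiable_time x) (hu.initial x) ht
  have hn : ∀ n : ℕ, 1 ≤ μ * n + 2 := fun n => by
    have := hμ.1
    have : 0 ≤ μ * n := by positivity
    linarith
  have h := congrArg₂ (· - ·) (e1 n) (e2 n)
  simp only [add_sub_add_left_eq_sub] at h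
  rw [← intervalIntegral.integral_sub
      (intervalIntegrable_kernel_smul hρ _ (hn n) ω ht ((hv.differentiable_time x).integrable t ht))
      (intervalIntegrable_kernel_smul hρ _ (hn n) ω ht ((hu.differentiable_time x).integrable t ht)),
    ← intervalIntegral.integral_sub
      (intervalIntegrable_kernel_smul hρ _ (hn (n + 1)) ω ht i1)
      (intervalIntegrable_kernel_smul hρ _ (hn (n + 1)) ω ht i2),
    intervalIntegral.integral_of_le ht.le, intervalIntegral.integral_of_le ht.le,
    integral_Ioc_eq_integral_Ioo, integral_Ioc_eq_integral_Ioo] at h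
  simp only [← smul_sub] at h
  rw [h, ← integral_const_mul]
  refine setIntegral_congr_fun measurableSet_Ioo fun s hs => ?_
  rw [hv.equation x s hs.1, hu.equation x s hs.1, ← mul_sub, mul_smul_comm]
  congr 2
  exact (iteratedDeriv_fun_sub (hv.contDiff_space s hs.1).contDiffAt
    (hu.contDiff_space s hs.1).contDiffAt).symm

theorem exists_superexponential_bound (hμ : 0 < μ) (hρ : 0 < ρ) (hγ : 0 ≤ γ) {t : ℝ} (ht : 0 < t) :
    ∃ a : ℕ → ℝ, (∀ n : ℕ, ∀ s ∈ Ioc 0 t, |prabhakarKernel (γ * n) ρ (μ * n + 2) ω s| ≤ a n) ∧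
      ∀ Λ, 0 ≤ Λ → ∃ C, ∀ n, Λ ^ n * a n ≤ C := by
  have key : ∀ Λ : ℝ, 0 ≤ Λ → ∃ C, ∀ n : ℕ, ∀ s ∈ Ioc 0 t,
      Λ ^ n * |prabhakarKernel (γ * n) ρ (μ * n + 2) ω s| ≤ C := fun Λ hΛ => by
    obtain ⟨C, hC0, hC⟩ := exists_bound_pow_mul_prabhakarKernel (ω := ω) hρ hμ two_pos hγ le_rfl t hΛ
    refine ⟨C * t ^ (2 - 1 : ℝ), fun n s hs => ?_⟩
    have := hC n s hs
    rw [add_zero] at this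
    refine this.trans (mul_le_mul_of_nonneg_left ?_ hC0)
    exact Real.rpow_le_rpow hs.1.le hs.2 (by norm_num)
  have : Nonempty (Ioc 0 t) := ⟨⟨t, ht, le_rfl⟩⟩
  -- The supremum gives one sequence `a` for all `Λ`, whereas the constants in `key` depend on `Λ`.
  refine ⟨fun n => ⨆ s : Ioc 0 t, |prabhakarKernel (γ * n) ρ (μ * n + 2) ω s|, fun n s hs => ?_,
    fun Λ hΛ => ?_⟩
  · obtain ⟨C, hC⟩ := key 1 zero_le_one
    refine le_ciSup (f := fun s : Ioc 0 t => |prabhakarKernel (γ * n) ρ (μ * n + 2) ω s|)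
      ⟨C, ?_⟩ ⟨s, hs⟩
    rintro _ ⟨s, rfl⟩
    simpa using hC n s s.2
  · obtain ⟨C, hC⟩ := key Λ hΛ
    refine ⟨C, fun n => ?_⟩
    rw [Real.mul_iSup_of_nonneg (by positivity)]
    exact ciSup_le fun s => hC n s s.2

include hμ hν hρ hv hu

theorem IsDiffusionSolution.unique (hγ : 0 ≤ γ) (hv' : IsDiffusionAdmissible v)
    (hu' : IsDiffusionAdmissible u) (x : ℝ) {t : ℝ} (ht : 0 < t) : v x t = u x t := by
  have hc : ∀ x, ContinuousOn (fun s => v x s - u x s) (Ioi 0) := fun x =>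
    (hv.continuous_time x).sub (hu.continuous_time x)
  have hw : ∀ s, 0 < s → ContDiff ℝ 2 (fun x => v x s - u x s) := fun s hs =>
    (hv.contDiff_space s hs).sub (hu.contDiff_space s hs)
  rw [← sub_eq_zero]
  refine eq_zero_of_forall_kernel_two_conv_eq_zero (ω := ω) hρ (hc x) (fun t ht =>
    ((hv.differentiable_time x).integrable t ht).sub ((hu.differentiable_time x).integrable t ht))
    (fun t ht => ?_) ht
  rw [intervalIntegral.integral_of_le ht.le, integral_Ioc_eq_integral_Ioo]
  have hid := hv.kernel_conv_sub hμ hν hρ hu (ht := ht)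
  rcases eq_or_ne K 0 with rfl | hK
  · simpa using hid 0 x
  obtain ⟨a, ha, haΛ⟩ := exists_superexponential_bound (ω := ω) hμ.1 hρ hγ ht
  obtain ⟨m₁, hm₁, hle₁⟩ := hv'.majorant t ht
  obtain ⟨m₂, hm₂, hle₂⟩ := hu'.majorant t ht
  have hm : IntegrableOn (fun s => m₁ s + m₂ s) (Ioo 0 t) :=
    (hm₁.add hm₂).mono_set Ioo_subset_Ioc_self
  have hle : ∀ x, ∀ s ∈ Ioo 0 t, ‖v x s - u x s‖ ≤ m₁ s + m₂ s := fun x s hs =>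
    (norm_sub_le _ _).trans (add_le_add (hle₁ x s ⟨hs.1, hs.2.le⟩) (hle₂ x s ⟨hs.1, hs.2.le⟩))
  set e : ℕ → ℝ → ℝ := fun n s => prabhakarKernel (γ * n) ρ (μ * n + 2) ω (t - s) with he
  have heC : ∀ n, ∀ s ∈ Ioo 0 t, |e n s| ≤ a n := fun n s hs =>
    ha n (t - s) ⟨sub_pos.2 hs.2, by linarith [hs.1]⟩
  have hec : ∀ n, ContinuousOn (e n) (Ioo 0 t) := fun n => by
    have hpos : 0 < μ * n + 2 := by have := hμ.1; positivity
    exact (hasSymbol_prabhakarKernel hρ hpos _ ω).continuousOn.comp (by fun_prop)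
      fun s hs => sub_pos.2 hs.2
  set Z : ℕ → ℝ → ℂ := fun n x => ∫ s in Ioo 0 t, e n s • (v x s - u x s) with hZ
  have hbd : ∀ n x, ∀ s ∈ Ioo 0 t, ‖e n s • (v x s - u x s)‖ ≤ a n * (m₁ s + m₂ s) :=
    fun n x s hs => by
      rw [norm_smul]
      exact mul_le_mul (heC n s hs) (hle x s hs) (norm_nonneg _) ((abs_nonneg _).trans (heC n s hs))
  have hZc : ∀ n, Continuous (Z n) := fun n => by
    refine continuous_of_dominated (bound := fun s => a n * (m₁ s + m₂ s)) (fun x => ?_)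
      (fun x => ?_) (hm.const_mul _) ?_
    · exact ((hec n).smul ((hc x).mono fun s hs => hs.1)).aestronglyMeasurable measurableSet_Ioo
    · exact (ae_restrict_iff' measurableSet_Ioo).2 (ae_of_all _ (hbd n x))
    · filter_upwards [ae_restrict_mem measurableSet_Ioo] with s hs
      exact (hw s hs.1).continuous.const_smul (e n s)
  have hxx : ∀ R, 0 < R → IntegrableOn (fun q : ℝ × ℝ =>
      iteratedDeriv 2 (fun ξ => v ξ q.2 - u ξ q.2) q.1) (Icc (-R) R ×ˢ Ioo 0 t) := fun R hR => by
    refine IntegrableOn.congr_fun (((hv'.integrable_xx R t hR ht).sub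
      (hu'.integrable_xx R t hR ht)).mono_set (prod_mono subset_rfl Ioo_subset_Ioc_self))
      (fun q hq => ?_) (measurableSet_Icc.prod measurableSet_Ioo)
    exact (iteratedDeriv_fun_sub (hv.contDiff_space q.2 hq.2.1).contDiffAt
      (hu.contDiff_space q.2 hq.2.1).contDiffAt).symm
  have hKc : (K : ℂ) ≠ 0 := by exact_mod_cast hK
  -- By the integrated equation, `K⁻¹ Z n` is the integral of `w_xx`, with `w = v - u`, against the
  -- next kernel; hence it is the second derivative of `Z (n + 1)`.
  have hV : ∀ n, Continuous fun x => (K : ℂ)⁻¹ * Z n x := fun n => continuous_const.mul (hZc n)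
  have hder : ∀ n, ∃ A : ℂ, ∀ x, HasDerivAt (Z (n + 1))
      (A + ∫ ξ in (0 : ℝ)..x, (K : ℂ)⁻¹ * Z n ξ) x := fun n =>
    hasDerivAt_setIntegral_smul (hec (n + 1)) (heC (n + 1))
      (fun x => (hc x).mono fun s hs => hs.1) (fun s hs => hw s hs.1) hm hle hxx (hV n)
      fun x => by rw [eq_inv_mul_iff_mul_eq₀ hKc]; exact (hid n x).symm
  choose A hA using hder
  have := eq_zero_of_bounded_second_primitives (a := fun n => a n * ∫ s in Ioo 0 t, (m₁ s + m₂ s))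
    (inv_ne_zero hKc) (hZc 0) hA
    (fun n x => (((hV n).integral_hasStrictDerivAt 0 x).hasDerivAt.const_add (A n)))
    (fun n x => ?_) (fun Λ hΛ => ?_) x
  · simpa [hZ, he] using this
  · rw [← integral_const_mul]
    exact norm_integral_le_of_norm_le (hm.const_mul _)
      ((ae_restrict_iff' measurableSet_Ioo).2 (ae_of_all _ (hbd n x)))
  · obtain ⟨C, hC⟩ := haΛ Λ hΛ
    have hM : 0 ≤ ∫ s in Ioo 0 t, (m₁ s + m₂ s) :=
      setIntegral_nonneg measurableSet_Ioo fun s hs => (norm_nonneg _).trans (hle x s hs)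
    exact ⟨C * ∫ s in Ioo 0 t, (m₁ s + m₂ s), fun n => by
      rw [← mul_assoc]; exact mul_le_mul_of_nonneg_right (hC n) hM⟩

end Uniqueness

theorem theorem4p3 (γ μ ν ρ ω K : ℝ) (hμ : μ ∈ Set.Ioo (0 : ℝ) 1) (hν : ν ∈ Set.Icc (0 : ℝ) 1)
    (hρ : 0 < ρ) (hK : 0 ≤ K) (hγ : 0 ≤ γ)
    (g : ℝ → ℂ) (hg_cont : Continuous g) (hg_int : Integrable g)
    (hg_hat : Integrable (fourierHat g)) (hg_zero : K = 0 → ContDiff ℝ 2 g) :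
    (∀ p t : ℝ, 0 < t → Summable (diffusionTerm γ μ ν ρ ω K p t)) ∧
    (∀ x t : ℝ, 0 < t → Integrable (diffusionIntegrand γ μ ν ρ ω K g x t)) ∧
    IsDiffusionSolution γ μ ν ρ ω K g (diffusionSolution γ μ ν ρ ω K g) ∧
    IsDiffusionAdmissible (diffusionSolution γ μ ν ρ ω K g) ∧
    ∀ v : ℝ → ℝ → ℂ, IsDiffusionSolution γ μ ν ρ ω K g v → IsDiffusionAdmissible v →
      ∀ x t : ℝ, 0 < t → v x t = diffusionSolution γ μ ν ρ ω K g x t := by 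
  refine ⟨fun p t ht => summable_diffusionTerm hμ hρ hγ hν p ht,
    fun x t ht => integrable_diffusionIntegrand hμ hν hρ hK hγ hg_hat x ht,
    isDiffusionSolution_diffusionSolution hμ hν hρ hK hγ hg_cont hg_int hg_hat hg_zero,
    isDiffusionAdmissible_diffusionSolution hμ hν hρ hK hγ hg_cont hg_int hg_hat hg_zero,
    fun v hv hv' x t ht => ?_⟩
  exact hv.unique hμ hν hρ
    (isDiffusionSolution_diffusionSolution hμ hν hρ hK hγ hg_cont hg_int hg_hat hg_zero) hγ hv'
    (isDiffusionAdmissible_diffusionSolution hμ hν hρ hK hγ hg_cont hg_int hg_hat hg_zero) x ht
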